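/- **Lemma (frontloading).** There is an absolute constant $\varepsilon_0>0$ such that the following holds for every $\varepsilon\in(0,\varepsilon_0)$ for which $K=\varepsilon^{-4}$ is an integer. *Instance.* Let $X_1,\dots,X_n$ be independent, where $X_i=v_i\ge 0$ with probability $p_i\in(0,1]$ and $X_i=0$ otherwise, and let $q_i=-\ln(1-p_i)$ ($q_i=\infty$ if $p_i=1$). Assume that there is one value $v_{\max}>1/\varepsilon^2$ such that every $v_i$ is $0$, or an integer power of $1+\varepsilon$ in $[\varepsilon,1/\varepsilon^2]$, or $v_{\max}$. Assume also that the prophet secretary problem (the variables arrive in uniformly random order; on each arrival the gambler sees which variable arrives and its realized value, and either takes the value and stops, or discards it for good) has optimal expected online reward at most $1$. For a support value $v>0$ put $s_v=1$ if $v\le 1/\varepsilon^2$ and $s_{v_{\max}}=\sum_{i:\,v_i=v_{\max}}q_i$, and let $$\mathbf X^*_v=\{i:\ v_i=v,\ q_i<\varepsilon^{20}s_v\},\quad \overline Q^*_v=\sum_{i\in\mathbf X^*_v}q_i,\quad Q^*_v=\min(\varepsilon^{-1},\overline Q^*_v),\quad Q^o_v=\varepsilon^4Q^*_v,\quad \delta_v=Q^o_v/\overline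 Q^*_v .$$ Assume that for every $v>0$ either $\mathbf X^*_v=\emptyset$ (then $\delta_v:=0$) or $\overline Q^*_v\ge\varepsilon^{10}s_v$. For each support value $v>0$ the sequence of $n$ arrivals is cut into consecutive blocks $\mathbf B^v_0,\mathbf B^v_1,\dots,\mathbf B^v_K$, where each of $\mathbf B^v_1,\dots,\mathbf B^v_K$ has $\delta_v n$ arrivals, the last one ends with the last arrival, and $\mathbf B^v_0$ is the remaining initial segment (if the endpoints $n-(K-k)\delta_v n$ are not integers, they are rounded up). *Game $G_3$.* The prophet secretary problem with two changes: a variable of $\mathbf X^*_v$ that arrives in $\mathbf B^v_0$ is not realized (its value is replaced by $0$); and the reward is $0$ if, for some support value $v>0$ and some $k\in\{1,\dots,K\}$, the sum of $q_i$ over the variables of $\mathbf X^*_v$ that arrive in $\mathbf B^v_k$ is outside $[(1-\varepsilon)Q^o_v,(1+\varepsilon)Q^o_v]$. *Game $G_4$.* As $G_3$, but for each $v>0$ and each $k\ge1$ the variables of $\mathbf X^*_v$ that arrive in $\mathbf B^v_k$ are realized together at the start of the block: at its first step, before deciding, the gambler is shown the outside option $Z_v$, which is $v$ if at least one of these variables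 realizes $v$, and $0$ otherwise. On stopping at any step of the block, the gambler may take $Z_v$ in place of the arriving variable; when the block ends, $Z_v$ is cleared. The gambler still sees everything that is seen in $G_3$. *Claim.* With $\mathrm{OPT}(G)$ the maximum expected reward of an online strategy in the game $G$, $$\mathrm{OPT}(G_3)\ \le\ \mathrm{OPT}(G_4)\ \le\ (1+\varepsilon)\,\mathrm{OPT}(G_3).$$ -/

import Mathlib

namespace ProphetSecretary

/-- `n` independent two-point variables: the `i`-th one is `value i` with probability `prob i`
and `0` otherwise. -/
structure Instance (n : ℕ) where
  value : Fin n → ℝ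
  prob : Fin n → ℝ
  value_nonneg : ∀ i, 0 ≤ value i
  prob_pos : ∀ i, 0 < prob i
  prob_le_one : ∀ i, prob i ≤ 1

/-- An outcome: the arrival order (`ω.1 t` is the variable that arrives at time `t`) and, for every
variable, whether it takes its non-zero value. Times are `0, …, n - 1`. -/
abbrev Outcome (n : ℕ) : Type := Equiv.Perm (Fin n) × (Fin n → Bool)

/-- A stopping game: at time `t` the gambler first sees `signal ω t`, then may stop and collect
`payoff ω t`. The payoff itself need not be visible (it may depend on the future). -/
structure Game (n : ℕ) (α : Type) where
  signal : Outcome n → Fin n → α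
  payoff : Outcome n → Fin n → ℝ

/-- A (deterministic) online strategy, `none` meaning that the gambler never stops: whether it stops
at time `t` is determined by the signals seen up to and including time `t`. -/
def Game.IsStrategy {n : ℕ} {α : Type} (G : Game n α) (τ : Outcome n → Option (Fin n)) : Prop :=
  ∀ (t : Fin n) (ω ω' : Outcome n), (∀ s, s ≤ t → G.signal ω s = G.signal ω' s) →
    (τ ω = some t ↔ τ ω' = some t)

namespace Instance

variable {n : ℕ} (I : Instance n)

/-- Uniformly random arrival order, independent realizations. -/
noncomputable def weight (ω : Outcome n) : ℝ :=
  (∏ i, if ω.2 i then I.prob i else 1 - I.prob i) / (n.factorial : ℝ)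

/-- Expected reward of a strategy. -/
noncomputable def reward {α : Type} (G : Game n α) (τ : Outcome n → Option (Fin n)) : ℝ :=
  ∑ ω, I.weight ω * (τ ω).elim 0 (G.payoff ω)

/-- Optimal expected reward. There are finitely many strategies, and never stopping is one, so this
supremum is a maximum. -/
noncomputable def opt {α : Type} (G : Game n α) : ℝ :=
  ⨆ τ : {τ : Outcome n → Option (Fin n) // G.IsStrategy τ}, I.reward G τ.1

/-- The realized value of the variable that arrives at time `t`. -/
noncomputable def arrivalValue (ω : Outcome n) (t : Fin n) : ℝ :=
  if ω.2 (ω.1 t) then I.value (ω.1 t) else 0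

/-- Game `G₁`: the prophet secretary problem. -/
noncomputable def gameOne : Game n (Fin n × ℝ) where
  signal ω t := (ω.1 t, I.arrivalValue ω t)
  payoff ω t := I.arrivalValue ω t

/-- `q i = -ln (1 - p i)`. This is meaningful for `prob i < 1` only. -/
noncomputable def q (i : Fin n) : ℝ := -Real.log (1 - I.prob i)

/-- The reference mass of the support value `v`: `1` for an ordinary value `v ≤ 1/ε²`, and the total
`Q_max` of all `q i` with `value i = v` for a large value (only `v_max` in a normalized instance). -/
noncomputable def scale (ε v : ℝ) : ℝ :=
  if v ≤ 1 / ε ^ 2 then 1 else ∑ i with I.value i = v, I.q i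

open scoped Classical in
/-- `X*_v`: the small-probability variables with support value `v`. A variable with `prob i = 1`
has infinite `q i`, hence is never small. -/
noncomputable def small (ε v : ℝ) : Finset (Fin n) :=
  {i | I.value i = v ∧ I.prob i < 1 ∧ I.q i < ε ^ 20 * I.scale ε v}

/-- The total mass of `X*_v`. -/
noncomputable def totalMass (ε v : ℝ) : ℝ := ∑ i ∈ I.small ε v, I.q i

/-- `Q*_v`. -/
noncomputable def cappedMass (ε v : ℝ) : ℝ := min (1 / ε) (I.totalMass ε v)

/-- `Q°_v`: the average mass of small variables in a block. -/
noncomputable def blockMass (ε v : ℝ) : ℝ := ε ^ 4 * I.cappedMass ε v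

/-- `δ_v`: the fraction of all arrivals that forms one block. -/
noncomputable def blockFraction (ε v : ℝ) : ℝ := I.blockMass ε v / I.totalMass ε v

/-- The end of the initial segment of `v` followed by `k` blocks of `δ_v n` arrivals, when there are
`K` blocks altogether and the last one ends at `n`. -/
noncomputable def blockEnd (ε v : ℝ) (K k : ℕ) : ℝ :=
  n - ((K : ℝ) - k) * (I.blockFraction ε v * n)

open scoped Classical in
/-- The initial segment `B^v_0`, as a set of times. -/
noncomputable def initialBlock (ε v : ℝ) (K : ℕ) : Finset (Fin n) :=
  {t | ((t : ℕ) : ℝ) < I.blockEnd ε v K 0}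

open scoped Classical in
/-- The block `B^v_{k+1}`, `k = 0, …, K - 1`, as a set of times. Endpoints that are not integers are
rounded up. -/
noncomputable def block (ε v : ℝ) (K : ℕ) (k : Fin K) : Finset (Fin n) :=
  {t | I.blockEnd ε v K k ≤ ((t : ℕ) : ℝ) ∧ ((t : ℕ) : ℝ) < I.blockEnd ε v K (k + 1)}

open scoped Classical in
/-- The arrival order fails if, for some support value `v > 0`, some block `B^v_k` with `k ≥ 1` has
a mass of small variables outside `[(1 - ε) Q°_v, (1 + ε) Q°_v]`. -/
def Fails (ε : ℝ) (K : ℕ) (σ : Equiv.Perm (Fin n)) : Prop :=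
  ∃ i, 0 < I.value i ∧ ∃ k : Fin K,
    ∑ t ∈ I.block ε (I.value i) K k with σ t ∈ I.small ε (I.value i), I.q (σ t) ∉
      Set.Icc ((1 - ε) * I.blockMass ε (I.value i)) ((1 + ε) * I.blockMass ε (I.value i))

open scoped Classical in
/-- The value available at time `t` from the arriving variable: small variables that arrive in the
initial segment of their support value are not realized. -/
noncomputable def lazyValue (ε : ℝ) (K : ℕ) (ω : Outcome n) (t : Fin n) : ℝ :=
  if ω.1 t ∈ I.small ε (I.value (ω.1 t)) ∧ t ∈ I.initialBlock ε (I.value (ω.1 t)) K then 0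
  else I.arrivalValue ω t

open scoped Classical in
/-- Game `G₃`: lazy decision, and no reward if the arrival order fails. -/
noncomputable def gameThree (ε : ℝ) (K : ℕ) : Game n (Fin n × ℝ) where
  signal ω t := (ω.1 t, I.lazyValue ε K ω t)
  payoff ω t := if I.Fails ε K ω.1 then 0 else I.lazyValue ε K ω t

open scoped Classical in
/-- The outside option `Z_v` at time `t`: it equals `v` if some small variable of the block
`B^v_k`, `k ≥ 1`, to which `t` belongs is realized (even if it arrives after `t`), and `0` if not. -/
noncomputable def outsideOption (ε : ℝ) (K : ℕ) (v : ℝ) (ω : Outcome n) (t : Fin n) : ℝ :=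
  if ∃ k : Fin K, t ∈ I.block ε v K k ∧
      ∃ s ∈ I.block ε v K k, ω.1 s ∈ I.small ε v ∧ ω.2 (ω.1 s) = true
  then v else 0

open scoped Classical in
/-- Game `G₄`: as `G₃`, but throughout each block the gambler also sees the outside option of every
support value, from the first step of the block on, and on stopping may take it instead of
the arriving variable. The best choice is the largest of the available values. -/
noncomputable def gameFour (ε : ℝ) (K : ℕ) : Game n (Fin n × ℝ × (Fin n → ℝ)) where
  signal ω t :=
    (ω.1 t, I.lazyValue ε K ω t, fun i => I.outsideOption ε K (I.value i) ω t)
  payoff ω t := if I.Fails ε K ω.1 then 0 else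
    max (I.lazyValue ε K ω t) (⨆ i, I.outsideOption ε K (I.value i) ω t)

/-- The standing normalization: every value is `0`, or a power of `1 + ε` between `ε` and `1/ε²`, or
equal to a single value `v_max > 1/ε²`; the optimal reward of the original game is at most `1`;
and small variables with the same support value are either absent or not negligible. -/
structure IsNormalized (ε : ℝ) : Prop where
  values : ∃ vmax : ℝ, 1 / ε ^ 2 < vmax ∧ ∀ i, I.value i = 0 ∨
    (ε ≤ I.value i ∧ I.value i ≤ 1 / ε ^ 2 ∧ ∃ m : ℤ, I.value i = (1 + ε) ^ m) ∨
    I.value i = vmax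
  opt_le_one : I.opt I.gameOne ≤ 1
  mass : ∀ v, 0 < v → (I.small ε v).Nonempty → ε ^ 10 * I.scale ε v ≤ I.totalMass ε v

end Instance

end ProphetSecretary

/-! The first inequality holds because G₄ shows and offers all that G₃ does. For the second, call
the small variables of one positive value a class, and let C be the optimal value of the game in
which class members are dead in their initial segment but no order is punished. It solves a dynamic
program V_m(S) over the set S of the m variables still to come (`contValue`). The threshold rule of
this program, played in G₃, loses only on atypical orders, where some block mass deviates from Q° by
more than a relative tolerance η. On typical orders G₄ is bounded by a potential that starts at
(1+o(ε))C.

Change of measure. In G₄ the outside options depend on the future order. They are replaced by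
independent bits ζ, one per block, with probability ρ = 1 - exp(-Q), where Q = (1+η)Q° is a nominal
mass. The past is reweighted by the density it has if the mass missing up to Q could still realize
the option. This density is a martingale (`nextDensity_mean`), and on typical orders it is at least
exp(-κ), with κ the total missing mass. Hence G₄ on typical orders earns at most exp(κ) times its
nominal value (`Nominal.sum_frontPay_le`).

Potential. When a block starts, an option v appears with probability ρ and gains (v-V)⁺. Without
frontloading the same income flows in gradually, as the share of the class in the drift of V. The
potential is max(V, held option) minus a debt: the gain at the start of a block is a loan, repaid
step by step by this share. Three errors remain. While an option is held, the maximum may grow by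
2·drift + V/m per step; this rests on the stability V_m(S∖j) ≤ (1+1/m)·V_{m+1}(S)
(`stopValue_erase_sub_le`), and it is weighted by ρ = O(ε³). The arrival rate of a class fluctuates;
sampling without replacement is a martingale with small variance. Finally, the last block of each
class, where the sum of 1/m is not controlled, is simply given away.

Sizes. Each class satisfies v·min(1, total mass) ≤ 8C (`val_mul_min_le`), and ηQ* ≤ ε^2.5·min(1,
total mass). So each class costs O(ε^2.5 + ε³ log(1/ε))·C. There are O(ε⁻¹ log(1/ε)) classes, so the
total is o(ε)C. A Chernoff bound for random orders (`sum_perm_deviation_le`) gives each block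
probability at most 2exp(-1/(32ε)) of being atypical, and the expected maximum of all variables is
at most 9C times the number of values. -/

namespace ProphetSecretary

/-! ### Optimal stopping of a uniformly random arrival order -/

section DynamicProgram

variable {α : Type*} [DecidableEq α]

/-- The mean of `f` over the sets obtained by deleting a uniformly random element. -/
noncomputable def eraseMean (f : Finset α → ℝ) (S : Finset α) : ℝ :=
  (∑ j ∈ S, f (S.erase j)) / S.card

/-- The optimal value of stopping when `m` elements, those of `S`, are still to arrive in uniformly
random order; `j` is worth `x m j` with probability `p j`, and nothing otherwise, when it arrives
with `m` elements still to come. -/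
noncomputable def stopValue (p : α → ℝ) (x : ℕ → α → ℝ) : ℕ → Finset α → ℝ
  | 0, _ => 0
  | m + 1, S => (∑ j ∈ S, (p j * max (x m j) (stopValue p x m (S.erase j)) +
      (1 - p j) * stopValue p x m (S.erase j))) / S.card

/-- The expected reward, above the continuation value, that is collected from `l`. -/
noncomputable def stopShare (p : α → ℝ) (x : ℕ → α → ℝ) : ℕ → Finset α → α → ℝ
  | 0, _, _ => 0
  | m + 1, S, l => (p l * max 0 (x m l - stopValue p x m (S.erase l)) +
      ∑ i ∈ S.erase l, (if stopValue p x m (S.erase i) < x m i then 1 - p i else 1) *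
        stopShare p x m (S.erase i) l) / S.card

/-- The expected loss of the continuation value in one step. -/
noncomputable def stopDrift (p : α → ℝ) (x : ℕ → α → ℝ) (m : ℕ) (S : Finset α) : ℝ :=
  (∑ j ∈ S, p j * max 0 (x m j - stopValue p x m (S.erase j))) / S.card

theorem eraseMean_mono {f g : Finset α → ℝ} {S : Finset α}
    (h : ∀ j ∈ S, f (S.erase j) ≤ g (S.erase j)) : eraseMean f S ≤ eraseMean g S := by
  unfold eraseMean
  gcongr with j hj
  exact h j hj

theorem eraseMean_nonneg {f : Finset α → ℝ} {S : Finset α}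
    (h : ∀ j ∈ S, 0 ≤ f (S.erase j)) : 0 ≤ eraseMean f S :=
  div_nonneg (Finset.sum_nonneg h) (Nat.cast_nonneg _)

theorem eraseMean_add (f g : Finset α → ℝ) (S : Finset α) :
    eraseMean (fun T => f T + g T) S = eraseMean f S + eraseMean g S := by
  simp only [eraseMean, Finset.sum_add_distrib, add_div]

theorem eraseMean_sum {β : Type*} (B : Finset β) (f : β → Finset α → ℝ) (S : Finset α) :
    eraseMean (fun T => ∑ b ∈ B, f b T) S = ∑ b ∈ B, eraseMean (f b) S := by
  simp only [eraseMean]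
  rw [Finset.sum_comm, Finset.sum_div]

theorem eraseMean_const_mul (c : ℝ) (f : Finset α → ℝ) (S : Finset α) :
    eraseMean (fun T => c * f T) S = c * eraseMean f S := by
  simp only [eraseMean, ← Finset.mul_sum, mul_div_assoc]

theorem eraseMean_const {S : Finset α} (h : S.Nonempty) (c : ℝ) :
    eraseMean (fun _ => c) S = c := by
  have : (S.card : ℝ) ≠ 0 := by exact_mod_cast h.card_pos.ne'
  simp [eraseMean]
  field_simp

variable {p : α → ℝ} (hp0 : ∀ j, 0 ≤ p j) (hp1 : ∀ j, p j ≤ 1) (x : ℕ → α → ℝ)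

include hp0 hp1

theorem stopValue_nonneg (m : ℕ) (S : Finset α) : 0 ≤ stopValue p x m S := by
  induction m generalizing S with
  | zero => simp [stopValue]
  | succ m ih =>
    rw [stopValue]
    refine div_nonneg (Finset.sum_nonneg fun j _ => ?_) (Nat.cast_nonneg _)
    have h1 := ih (S.erase j)
    have h2 : 0 ≤ 1 - p j := by linarith [hp1 j]
    have h3 := hp0 j
    have h4 : 0 ≤ max (x m j) (stopValue p x m (S.erase j)) := le_max_of_le_right h1
    positivity

theorem stopShare_nonneg (m : ℕ) (S : Finset α) (l : α) : 0 ≤ stopShare p x m S l := by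
  induction m generalizing S l with
  | zero => simp [stopShare]
  | succ m ih =>
    rw [stopShare]
    refine div_nonneg (add_nonneg (mul_nonneg (hp0 l) (le_max_left _ _))
      (Finset.sum_nonneg fun i _ => mul_nonneg ?_ (ih _ _))) (Nat.cast_nonneg _)
    split_ifs <;> linarith [hp1 i]

omit hp1 in
theorem stopDrift_nonneg (m : ℕ) (S : Finset α) : 0 ≤ stopDrift p x m S :=
  div_nonneg (Finset.sum_nonneg fun j _ => mul_nonneg (hp0 j) (le_max_left _ _))
    (Nat.cast_nonneg _)

omit hp0 hp1 in
theorem stopValue_succ (m : ℕ) (S : Finset α) :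
    stopValue p x (m + 1) S = eraseMean (stopValue p x m) S + stopDrift p x m S := by
  rw [stopValue, eraseMean, stopDrift, ← add_div, ← Finset.sum_add_distrib]
  congr 1
  refine Finset.sum_congr rfl fun j _ => ?_
  rcases le_total (x m j) (stopValue p x m (S.erase j)) with h | h
  · rw [max_eq_right h, max_eq_left (by linarith)]; ring
  · rw [max_eq_left h, max_eq_right (by linarith)]; ring

omit hp1 in
theorem eraseMean_stopValue_le (m : ℕ) (S : Finset α) :
    eraseMean (stopValue p x m) S ≤ stopValue p x (m + 1) S := by
  rw [stopValue_succ]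
  linarith [stopDrift_nonneg hp0 x m S]

/-- The optimal rule stops at one variable only, and its reward is at least the excess over the
continuation value there. The shares split this excess among the variables. -/
theorem sum_stopShare_le (m : ℕ) (S : Finset α) :
    ∑ l ∈ S, stopShare p x m S l ≤ stopValue p x m S := by
  induction m generalizing S with
  | zero => simp [stopShare, stopValue]
  | succ m ih =>
    simp only [stopShare, stopValue]
    rw [← Finset.sum_div]
    refine div_le_div_of_nonneg_right ?_ (Nat.cast_nonneg _)
    rw [Finset.sum_add_distrib]
    have hcomm : ∑ l ∈ S, ∑ i ∈ S.erase l,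
        (if stopValue p x m (S.erase i) < x m i then 1 - p i else 1) *
          stopShare p x m (S.erase i) l =
        ∑ i ∈ S, (if stopValue p x m (S.erase i) < x m i then 1 - p i else 1) *
          ∑ l ∈ S.erase i, stopShare p x m (S.erase i) l := by
      simp only [Finset.mul_sum]
      refine Finset.sum_comm' fun a b => ?_
      simp only [Finset.mem_erase]
      tauto
    rw [hcomm, ← Finset.sum_add_distrib]
    refine Finset.sum_le_sum fun i _ => ?_
    have h1 := ih (S.erase i)
    have h2 : 0 ≤ 1 - p i := by linarith [hp1 i]
    split_ifs with h
    · rw [max_eq_right (by linarith), max_eq_left h.le]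
      nlinarith [mul_le_mul_of_nonneg_left h1 h2, hp0 i, stopValue_nonneg hp0 hp1 x m (S.erase i)]
    · rw [max_eq_left (by linarith), max_eq_right (by linarith)]
      linarith

/-- If `l` is exchanged for `j`, the optimal rule for `A` can still be followed, with `j` in the
role of `l` and always discarded. Only what `l` would have contributed is lost. -/
theorem stopValue_sub_share_le (m : ℕ) {A : Finset α} {l j : α} (hl : l ∈ A) (hj : j ∉ A) :
    stopValue p x m A - stopShare p x m A l ≤ stopValue p x m (insert j (A.erase l)) := by
  induction m generalizing A with
  | zero => simp [stopValue, stopShare]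
  | succ m ih =>
    have hjl : j ≠ l := fun h => hj (h ▸ hl)
    have hjA : j ∉ A.erase l := fun h => hj (Finset.mem_of_mem_erase h)
    have hcard : (insert j (A.erase l)).card = A.card := by
      rw [Finset.card_insert_of_notMem hjA, Finset.card_erase_add_one hl]
    simp only [stopValue, stopShare]
    rw [hcard, ← sub_div]
    refine div_le_div_of_nonneg_right ?_ (Nat.cast_nonneg _)
    -- A first arrival `j` in the new set is matched with a first arrival `l` in the old one: both
    -- leave `A.erase l`. All other first arrivals are matched with themselves, by induction.
    rw [Finset.sum_insert hjA, ← Finset.add_sum_erase A _ hl, Finset.erase_insert hjA]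
    have hA := stopValue_nonneg hp0 hp1 x m (A.erase l)
    have h1 : p l * max (x m l) (stopValue p x m (A.erase l)) +
        (1 - p l) * stopValue p x m (A.erase l) ≤ stopValue p x m (A.erase l) +
          p l * max 0 (x m l - stopValue p x m (A.erase l)) := by
      rcases le_total (x m l) (stopValue p x m (A.erase l)) with h | h
      · rw [max_eq_right h, max_eq_left (by linarith)]; linarith
      · rw [max_eq_left h, max_eq_right (by linarith)]; linarith
    have h2 : stopValue p x m (A.erase l) ≤ p j * max (x m j) (stopValue p x m (A.erase l)) +
        (1 - p j) * stopValue p x m (A.erase l) := by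
      nlinarith [mul_le_mul_of_nonneg_left (le_max_right (x m j) (stopValue p x m (A.erase l)))
        (hp0 j)]
    have h3 : ∑ i ∈ A.erase l, (p i * max (x m i) (stopValue p x m (A.erase i)) +
        (1 - p i) * stopValue p x m (A.erase i)) - ∑ i ∈ A.erase l,
          (if stopValue p x m (A.erase i) < x m i then 1 - p i else 1) *
            stopShare p x m (A.erase i) l ≤
        ∑ i ∈ A.erase l, (p i * max (x m i) (stopValue p x m ((insert j (A.erase l)).erase i)) +
          (1 - p i) * stopValue p x m ((insert j (A.erase l)).erase i)) := by
      rw [← Finset.sum_sub_distrib]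
      refine Finset.sum_le_sum fun i hi => ?_
      obtain ⟨hil, hiA⟩ := Finset.mem_erase.mp hi
      have hij : j ≠ i := fun h => hj (h ▸ hiA)
      have heq : (insert j (A.erase l)).erase i = insert j ((A.erase i).erase l) := by
        rw [Finset.erase_insert_of_ne hij, Finset.erase_right_comm]
      rw [heq]
      have := ih (A := A.erase i) (Finset.mem_erase.mpr ⟨hil.symm, hl⟩)
        (fun h => hj (Finset.mem_of_mem_erase h))
      have hs := stopShare_nonneg hp0 hp1 x m (A.erase i) l
      set a := stopValue p x m (A.erase i)
      set b := stopValue p x m (insert j ((A.erase i).erase l))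
      set s := stopShare p x m (A.erase i) l
      have hpi : 0 ≤ 1 - p i := by linarith [hp1 i]
      have e1 := mul_le_mul_of_nonneg_left this hpi
      split_ifs with h
      · have e2 := mul_le_mul_of_nonneg_left (le_max_left (x m i) b) (hp0 i)
        rw [max_eq_left h.le]
        nlinarith
      · have e2 := mul_le_mul_of_nonneg_left (le_max_right (x m i) b) (hp0 i)
        rw [max_eq_right (not_lt.mp h)]
        nlinarith
    linarith

/-- Exchange `j` in turn with every other element `l` of `S` and add up: the losses are the shares
in `S.erase j`, which together cost one copy of its value at most. -/
theorem card_mul_stopValue_erase_le {m : ℕ} {S : Finset α} (hS : S.card = m + 1) {j : α}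
    (hj : j ∈ S) : m * stopValue p x m (S.erase j) ≤ ∑ l ∈ S, stopValue p x m (S.erase l) := by
  have h1 : ∀ l ∈ S.erase j, stopValue p x m (S.erase j) - stopShare p x m (S.erase j) l ≤
      stopValue p x m (S.erase l) := fun l hl => by
    have := stopValue_sub_share_le hp0 hp1 x m hl (Finset.notMem_erase j S)
    rwa [Finset.erase_right_comm, Finset.insert_erase
      (Finset.mem_erase.mpr ⟨(Finset.ne_of_mem_erase hl).symm, hj⟩)] at this
  have h2 := Finset.sum_le_sum h1
  rw [Finset.sum_sub_distrib, Finset.sum_const, Finset.card_erase_of_mem hj, hS,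
    Nat.add_sub_cancel, nsmul_eq_mul] at h2
  rw [← Finset.add_sum_erase S _ hj]
  linarith [sum_stopShare_le hp0 hp1 x m (S.erase j)]

/-- Stability: no single arrival can raise the continuation value by more than a factor 1 + 1/m,
since the mean over all arrivals does not raise it at all. -/
theorem stopValue_erase_sub_le {m : ℕ} {S : Finset α} (hS : S.card = m + 1) {j : α}
    (hj : j ∈ S) :
    stopValue p x m (S.erase j) - stopValue p x (m + 1) S ≤ stopValue p x (m + 1) S / m := by
  -- For m = 0 the value of the empty future is 0 and the right side is a division by zero, that is
  -- 0.
  rcases Nat.eq_zero_or_pos m with rfl | hm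
  · have := stopValue_nonneg hp0 hp1 x (0 + 1) S
    simpa [stopValue] using this
  · have h1 := card_mul_stopValue_erase_le hp0 hp1 x hS hj
    have h2 := eraseMean_stopValue_le hp0 x m S
    rw [eraseMean, hS, div_le_iff₀ (by positivity)] at h2
    have hm' : (0 : ℝ) < m := by exact_mod_cast hm
    rw [le_div_iff₀ hm']
    push_cast at h2
    nlinarith

/-- The mean positive excess of the next reward over the current value. -/
theorem mean_excess_le {m : ℕ} {S : Finset α} (hS : S.card = m + 1) :
    (∑ j ∈ S, (p j * max 0 (max (x m j) (stopValue p x m (S.erase j)) - stopValue p x (m + 1) S) +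
      (1 - p j) * max 0 (stopValue p x m (S.erase j) - stopValue p x (m + 1) S))) / S.card ≤
    stopDrift p x m S + stopValue p x (m + 1) S / m := by
  set c := stopValue p x (m + 1) S with hc
  have hcard : (0 : ℝ) < S.card := by rw [hS]; positivity
  have hup : ∀ j ∈ S, max 0 (stopValue p x m (S.erase j) - c) ≤ c / m := fun j hj =>
    max_le (div_nonneg (stopValue_nonneg hp0 hp1 x _ _) (Nat.cast_nonneg _))
      (stopValue_erase_sub_le hp0 hp1 x hS hj)
  have h1 : ∀ j ∈ S, p j * max 0 (max (x m j) (stopValue p x m (S.erase j)) - c) +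
      (1 - p j) * max 0 (stopValue p x m (S.erase j) - c) ≤
      p j * max 0 (x m j - stopValue p x m (S.erase j)) + c / m := fun j hj => by
    -- The excess is split at the new continuation value: the part above it averages to the drift,
    -- the part below it is bounded by stability.
    have h2 : max 0 (max (x m j) (stopValue p x m (S.erase j)) - c) ≤
        max 0 (x m j - stopValue p x m (S.erase j)) +
          max 0 (stopValue p x m (S.erase j) - c) := by
      have e1 := le_max_left 0 (x m j - stopValue p x m (S.erase j))
      have e2 := le_max_right 0 (x m j - stopValue p x m (S.erase j))
      have e3 := le_max_left 0 (stopValue p x m (S.erase j) - c)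
      have e4 := le_max_right 0 (stopValue p x m (S.erase j) - c)
      refine max_le (by linarith) ?_
      rw [sub_le_iff_le_add]
      exact max_le (by linarith) (by linarith)
    nlinarith [mul_le_mul_of_nonneg_left h2 (hp0 j), hup j hj]
  rw [div_le_iff₀ hcard, stopDrift, add_mul, div_mul_cancel₀ _ hcard.ne']
  refine (Finset.sum_le_sum h1).trans ?_
  rw [Finset.sum_add_distrib, Finset.sum_const, nsmul_eq_mul, mul_comm (c / m)]

end DynamicProgram

end ProphetSecretary

namespace ProphetSecretary

/-! ### Costs accumulated while elements are deleted in random order -/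

section ChainCost

variable {α : Type*} [DecidableEq α]

/-- The expected total of the costs `g m * f m`, where `f m` is charged to the set of the `m + 1`
remaining elements, and elements are deleted one by one in uniformly random order. -/
noncomputable def chainCost (g : ℕ → ℝ) (f : ℕ → Finset α → ℝ) : ℕ → Finset α → ℝ
  | 0, _ => 0
  | m + 1, S => g m * f m S + eraseMean (chainCost g f m) S

theorem chainCost_nonneg {g : ℕ → ℝ} {f : ℕ → Finset α → ℝ} (hg : ∀ m, 0 ≤ g m)
    (hf : ∀ m S, 0 ≤ f m S) (m : ℕ) (S : Finset α) : 0 ≤ chainCost g f m S := by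
  induction m generalizing S with
  | zero => simp [chainCost]
  | succ m ih => exact add_nonneg (mul_nonneg (hg m) (hf m S)) (eraseMean_nonneg fun j _ => ih _)

theorem chainCost_mono {g : ℕ → ℝ} {f f' : ℕ → Finset α → ℝ} (hg : ∀ m, 0 ≤ g m)
    (hf : ∀ m S, g m ≠ 0 → S.card = m + 1 → f m S ≤ f' m S) (m : ℕ) (S : Finset α)
    (hS : S.card = m) : chainCost g f m S ≤ chainCost g f' m S := by
  induction m generalizing S with
  | zero => simp [chainCost]
  | succ m ih =>
    refine add_le_add ?_ (eraseMean_mono fun j hj => ih _ ?_)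
    · rcases eq_or_ne (g m) 0 with h | h
      · simp [h]
      · exact mul_le_mul_of_nonneg_left (hf m S h hS) (hg m)
    · rw [Finset.card_erase_of_mem hj, hS, Nat.add_sub_cancel]

theorem chainCost_add (g : ℕ → ℝ) (f f' : ℕ → Finset α → ℝ) (m : ℕ) (S : Finset α) :
    chainCost g (fun m S => f m S + f' m S) m S = chainCost g f m S + chainCost g f' m S := by
  induction m generalizing S with
  | zero => simp [chainCost]
  | succ m ih =>
    simp only [chainCost, funext ih, eraseMean_add]
    ring

theorem chainCost_const_mul (c : ℝ) (g : ℕ → ℝ) (f : ℕ → Finset α → ℝ) (m : ℕ) (S : Finset α) :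
    chainCost g (fun m S => c * f m S) m S = c * chainCost g f m S := by
  induction m generalizing S with
  | zero => simp [chainCost]
  | succ m ih =>
    simp only [chainCost, funext ih, eraseMean_const_mul]
    ring

theorem chainCost_const (g : ℕ → ℝ) (c : ℝ) (m : ℕ) (S : Finset α) (hS : S.card = m) :
    chainCost g (fun _ _ => c) m S = (∑ i ∈ Finset.range m, g i) * c := by
  induction m generalizing S with
  | zero => simp [chainCost]
  | succ m ih =>
    have hne : S.Nonempty := Finset.card_pos.mp (by omega)
    have : eraseMean (chainCost g (fun _ _ => c) m) S =
        eraseMean (fun _ => (∑ i ∈ Finset.range m, g i) * c) S := by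
      unfold eraseMean
      congr 1
      refine Finset.sum_congr rfl fun j hj => ih _ ?_
      rw [Finset.card_erase_of_mem hj, hS, Nat.add_sub_cancel]
    rw [chainCost, this, eraseMean_const hne, Finset.sum_range_succ]
    ring

variable {p : α → ℝ} (hp0 : ∀ j, 0 ≤ p j) (hp1 : ∀ j, p j ≤ 1) (x : ℕ → α → ℝ)

include hp0

/-- The drift is exactly the mean decrease of the value in one step, so the total drift telescopes.
-/
theorem chainCost_stopDrift_le {g : ℕ → ℝ} {G : ℝ} (hg : ∀ m, g m ≤ G) (m : ℕ)
    (S : Finset α) : chainCost g (stopDrift p x) m S ≤ G * stopValue p x m S := by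
  induction m generalizing S with
  | zero => simp [chainCost, stopValue]
  | succ m ih =>
    have h1 : eraseMean (chainCost g (stopDrift p x) m) S ≤
        G * eraseMean (stopValue p x m) S := by
      rw [← eraseMean_const_mul]
      exact eraseMean_mono fun j _ => ih _
    have h2 := mul_le_mul_of_nonneg_right (hg m) (stopDrift_nonneg hp0 x m S)
    rw [chainCost, stopValue_succ]
    linarith

/-- The value is a supermartingale along the deletions, so its mean at any later step is at most the
initial one. -/
theorem chainCost_mul_stopValue_le {g h : ℕ → ℝ} (hg : ∀ m, 0 ≤ g m) (hh : ∀ m, 0 ≤ h m)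
    (m : ℕ) (S : Finset α) :
    chainCost g (fun m S => h m * stopValue p x (m + 1) S) m S ≤
      (∑ i ∈ Finset.range m, g i * h i) * stopValue p x m S := by
  induction m generalizing S with
  | zero => simp [chainCost]
  | succ m ih =>
    have h1 : eraseMean (chainCost g (fun m S => h m * stopValue p x (m + 1) S) m) S ≤
        (∑ i ∈ Finset.range m, g i * h i) * eraseMean (stopValue p x m) S := by
      rw [← eraseMean_const_mul]
      exact eraseMean_mono fun j _ => ih _
    have h2 := mul_le_mul_of_nonneg_left (eraseMean_stopValue_le hp0 x m S)
      (Finset.sum_nonneg fun i (_ : i ∈ Finset.range m) => mul_nonneg (hg i) (hh i))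
    rw [chainCost, Finset.sum_range_succ]
    nlinarith

end ChainCost

/-! ### Fluctuations of the mean under sampling without replacement -/

section SampleMean

variable {α : Type*} [DecidableEq α]

/-- The mean of `a` over `S`. -/
noncomputable def sampleMean (a : α → ℝ) (S : Finset α) : ℝ := (∑ j ∈ S, a j) / S.card

omit [DecidableEq α] in
theorem sampleMean_nonneg {a : α → ℝ} (ha : ∀ j, 0 ≤ a j) (S : Finset α) : 0 ≤ sampleMean a S :=
  div_nonneg (Finset.sum_nonneg fun j _ => ha j) (Nat.cast_nonneg _)

theorem sampleMean_erase {a : α → ℝ} {m : ℕ} (hm : 0 < m) {S : Finset α} (hS : S.card = m + 1)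
    {j : α} (hj : j ∈ S) :
    sampleMean a (S.erase j) = sampleMean a S + (sampleMean a S - a j) / m := by
  have hm' : (m : ℝ) ≠ 0 := by exact_mod_cast hm.ne'
  have hm1 : (m : ℝ) + 1 ≠ 0 := by positivity
  rw [sampleMean, sampleMean, Finset.card_erase_of_mem hj, hS, Nat.add_sub_cancel,
    ← Finset.add_sum_erase S a hj]
  push_cast
  field_simp
  ring

theorem eraseMean_sampleMean {a : α → ℝ} {m : ℕ} (hm : 0 < m) {S : Finset α}
    (hS : S.card = m + 1) : eraseMean (sampleMean a) S = sampleMean a S := by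
  have hc : (S.card : ℝ) ≠ 0 := by rw [hS]; positivity
  rw [eraseMean, Finset.sum_congr rfl fun j hj => sampleMean_erase hm hS hj,
    Finset.sum_add_distrib, Finset.sum_const, ← Finset.sum_div, Finset.sum_sub_distrib,
    Finset.sum_const, nsmul_eq_mul]
  have : (S.card : ℝ) * sampleMean a S = ∑ j ∈ S, a j := by
    rw [sampleMean]; field_simp
  rw [this, sub_self, zero_div, add_zero, sampleMean]

/-- The increments of the sample mean are centred, so the cross term averages out. Their second
moment is bounded through a² ≤ A·a. -/
theorem eraseMean_sampleMean_sq_le {a : α → ℝ} (ha : ∀ j, 0 ≤ a j) {A : ℝ} (hA : ∀ j, a j ≤ A)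
    (μ : ℝ) {m : ℕ} (hm : 0 < m) {S : Finset α} (hS : S.card = m + 1) :
    eraseMean (fun T => (sampleMean a T - μ) ^ 2) S ≤
      (sampleMean a S - μ) ^ 2 + A * sampleMean a S / m ^ 2 := by
  have hm' : (0 : ℝ) < m := by exact_mod_cast hm
  have hc : (0 : ℝ) < S.card := by rw [hS]; positivity
  set r := sampleMean a S with hr
  have hsum : (S.card : ℝ) * r = ∑ j ∈ S, a j := by
    rw [hr, sampleMean]; field_simp
  have h1 : ∀ j ∈ S, (sampleMean a (S.erase j) - μ) ^ 2 ≤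
      (r - μ) ^ 2 + 2 * (r - μ) / m * (r - a j) + (r ^ 2 - 2 * r * a j + A * a j) / m ^ 2 :=
    fun j hj => by
    rw [sampleMean_erase hm hS hj, ← hr]
    have : (a j) ^ 2 ≤ A * a j := by nlinarith [ha j, hA j]
    have h2 : (r + (r - a j) / m - μ) ^ 2 = (r - μ) ^ 2 + 2 * (r - μ) / m * (r - a j) +
        (r ^ 2 - 2 * r * a j + (a j) ^ 2) / m ^ 2 := by
      field_simp; ring
    rw [h2]
    gcongr
  rw [eraseMean, div_le_iff₀ hc]
  refine (Finset.sum_le_sum h1).trans ?_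
  rw [Finset.sum_add_distrib, Finset.sum_add_distrib, ← Finset.mul_sum, ← Finset.sum_div,
    Finset.sum_add_distrib, Finset.sum_sub_distrib, Finset.sum_sub_distrib, ← Finset.mul_sum,
    ← Finset.mul_sum, ← hsum]
  simp only [Finset.sum_const, nsmul_eq_mul]
  have hr0 : 0 ≤ r := sampleMean_nonneg ha S
  have : (S.card : ℝ) * r ^ 2 - 2 * r * (S.card * r) + A * (S.card * r) ≤ A * (S.card * r) := by
    nlinarith [mul_nonneg hc.le (sq_nonneg r)]
  have h3 := div_le_div_of_nonneg_right this (sq_nonneg (m : ℝ))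
  calc _ ≤ (S.card : ℝ) * (r - μ) ^ 2 + A * (S.card * r) / m ^ 2 := by linarith
    _ = _ := by ring

/-- The variance created with `i` elements left is charged at all later steps, that is with the
weights `g k` for k < i. The term i = 0 is zero, as its inner sum is empty. -/
theorem chainCost_sampleMean_sq_le {a : α → ℝ} (ha : ∀ j, 0 ≤ a j) {A : ℝ} (hA : ∀ j, a j ≤ A)
    (μ : ℝ) {g : ℕ → ℝ} (hg : ∀ m, 0 ≤ g m) (m : ℕ) (S : Finset α) (hS : S.card = m) :
    chainCost g (fun _ T => (sampleMean a T - μ) ^ 2) m S ≤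
      (∑ i ∈ Finset.range m, g i) * (sampleMean a S - μ) ^ 2 +
      (∑ i ∈ Finset.range m, (∑ k ∈ Finset.range i, g k) * A / i ^ 2) * sampleMean a S := by
  induction m generalizing S with
  | zero => simp [chainCost]
  | succ m ih =>
    rcases Nat.eq_zero_or_pos m with rfl | hm
    · simp [chainCost, eraseMean]
    set G := ∑ i ∈ Finset.range m, g i with hG
    set Γ := ∑ i ∈ Finset.range m, (∑ k ∈ Finset.range i, g k) * A / (i : ℝ) ^ 2 with hΓ
    have hG0 : 0 ≤ G := Finset.sum_nonneg fun i _ => hg i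
    have h1 : eraseMean (chainCost g (fun _ T => (sampleMean a T - μ) ^ 2) m) S ≤
        G * eraseMean (fun T => (sampleMean a T - μ) ^ 2) S +
          Γ * eraseMean (sampleMean a) S := by
      rw [← eraseMean_const_mul, ← eraseMean_const_mul, ← eraseMean_add]
      refine eraseMean_mono fun j hj => ih _ ?_
      rw [Finset.card_erase_of_mem hj, hS, Nat.add_sub_cancel]
    have h2 := mul_le_mul_of_nonneg_left (eraseMean_sampleMean_sq_le ha hA μ hm hS) hG0
    rw [eraseMean_sampleMean hm hS] at h1
    rw [chainCost, Finset.sum_range_succ, Finset.sum_range_succ, ← hG, ← hΓ]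
    calc _ ≤ g m * (sampleMean a S - μ) ^ 2 + (G * ((sampleMean a S - μ) ^ 2 +
          A * sampleMean a S / m ^ 2) + Γ * sampleMean a S) := by linarith
      _ = _ := by ring

end SampleMean

end ProphetSecretary

namespace ProphetSecretary

/-! ### Exchangeability of the arrival order -/

theorem sum_pi_bool_pair {κ : Type*} [Fintype κ] [DecidableEq κ] (i : κ) (H : (κ → Bool) → ℝ) :
    2 * ∑ b, H b = ∑ b, (H (Function.update b i true) + H (Function.update b i false)) := by
  have hinv : Function.Involutive (fun b : κ → Bool => Function.update b i (!b i)) := by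
    intro b
    ext k
    by_cases hk : k = i
    · subst hk; simp
    · simp [hk]
  have h1 : ∑ b, H (Function.update b i (!b i)) = ∑ b, H b :=
    Equiv.sum_comp (Function.Involutive.toPerm _ hinv) H
  rw [two_mul]
  nth_rewrite 2 [← h1]
  rw [← Finset.sum_add_distrib]
  refine Finset.sum_congr rfl fun b _ => ?_
  rcases h : b i with _ | _
  · have : Function.update b i false = b := by rw [← h]; exact Function.update_eq_self i b
    rw [this]; simp [add_comm]
  · have : Function.update b i true = b := by rw [← h]; exact Function.update_eq_self i b
    rw [this]; simp

/-- The probability that independent events with probabilities `p` have the pattern `b`. -/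
noncomputable def bitWeight {κ : Type*} [Fintype κ] (p : κ → ℝ) (b : κ → Bool) : ℝ :=
  ∏ i, if b i then p i else 1 - p i

section BitWeight

variable {κ : Type*} [Fintype κ] [DecidableEq κ]

omit [DecidableEq κ] in
theorem bitWeight_nonneg {p : κ → ℝ} (h0 : ∀ i, 0 ≤ p i) (h1 : ∀ i, p i ≤ 1) (b : κ → Bool) :
    0 ≤ bitWeight p b :=
  Finset.prod_nonneg fun i _ => by split_ifs <;> linarith [h0 i, h1 i]

theorem sum_bitWeight_mul_prod (p : κ → ℝ) (f : κ → Bool → ℝ) :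
    ∑ b, bitWeight p b * ∏ i, f i (b i) = ∏ i, (p i * f i true + (1 - p i) * f i false) := by
  simp only [bitWeight, ← Finset.prod_mul_distrib]
  have := Finset.prod_univ_sum (fun _ : κ => (Finset.univ : Finset Bool))
    (fun i β => (if β then p i else 1 - p i) * f i β)
  simp only [Fintype.sum_bool, Fintype.piFinset_univ] at this
  rw [← this]
  simp

theorem sum_bitWeight (p : κ → ℝ) : ∑ b, bitWeight p b = 1 := by
  simpa using sum_bitWeight_mul_prod p (fun _ _ => 1)

theorem bitWeight_update (p : κ → ℝ) (b : κ → Bool) (i : κ) (β : Bool) :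
    bitWeight p (Function.update b i β) = (if β then p i else 1 - p i) *
      ∏ k ∈ Finset.univ.erase i, if b k then p k else 1 - p k := by
  rw [bitWeight, ← Finset.mul_prod_erase _ _ (Finset.mem_univ i)]
  congr 1
  · simp
  · refine Finset.prod_congr rfl fun k hk => ?_
    rw [Function.update_of_ne (Finset.ne_of_mem_erase hk)]

/-- Averaging over one of the independent events. -/
theorem sum_bitWeight_condition (p : κ → ℝ) (i : κ) (G : (κ → Bool) → Bool → ℝ)
    (hG : ∀ b c β, G (Function.update b i c) β = G b β) :
    ∑ b, bitWeight p b * G b (b i) =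
      ∑ b, bitWeight p b * (p i * G b true + (1 - p i) * G b false) := by
  have h1 := sum_pi_bool_pair i (fun b => bitWeight p b * G b (b i))
  have h2 := sum_pi_bool_pair i
    (fun b => bitWeight p b * (p i * G b true + (1 - p i) * G b false))
  have h3 : ∀ b : κ → Bool, bitWeight p (Function.update b i true) *
      G (Function.update b i true) (Function.update b i true i) +
      bitWeight p (Function.update b i false) *
        G (Function.update b i false) (Function.update b i false i) =
      bitWeight p (Function.update b i true) * (p i * G (Function.update b i true) true +
        (1 - p i) * G (Function.update b i true) false) +
      bitWeight p (Function.update b i false) * (p i * G (Function.update b i false) true +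
        (1 - p i) * G (Function.update b i false) false) := fun b => by
    simp only [hG, bitWeight_update, Function.update_self]
    simp only [if_true, Bool.false_eq_true, if_false]
    ring
  simp only [h3] at h1
  linarith

end BitWeight

variable {n : ℕ}

/-- The variables that arrive at time `t` or later. -/
def remaining (σ : Equiv.Perm (Fin n)) (t : ℕ) : Finset (Fin n) :=
  {j | t ≤ (σ.symm j : ℕ)}

theorem mem_remaining {σ : Equiv.Perm (Fin n)} {t : ℕ} {j : Fin n} :
    j ∈ remaining σ t ↔ t ≤ (σ.symm j : ℕ) := by simp [remaining]

theorem remaining_eq_map (σ : Equiv.Perm (Fin n)) (t : ℕ) :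
    remaining σ t = Finset.map σ.toEmbedding {s : Fin n | t ≤ (s : ℕ)} := by
  ext j
  simp [mem_remaining]

theorem card_remaining (σ : Equiv.Perm (Fin n)) (t : ℕ) : (remaining σ t).card = n - t := by
  rw [remaining_eq_map, Finset.card_map]
  have := Fin.card_filter_val_lt (n := n) (m := t)
  have h2 := Finset.card_filter_add_card_filter_not (s := (Finset.univ : Finset (Fin n)))
    (fun s : Fin n => (s : ℕ) < t)
  simp only [not_lt, Finset.card_univ, Fintype.card_fin] at h2
  omega

theorem remaining_zero (σ : Equiv.Perm (Fin n)) : remaining σ 0 = Finset.univ := by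
  ext j; simp [mem_remaining]

theorem remaining_succ (σ : Equiv.Perm (Fin n)) (t : Fin n) :
    remaining σ (t + 1) = (remaining σ t).erase (σ t) := by
  ext j
  rw [Finset.mem_erase, mem_remaining, mem_remaining, Ne, ← Equiv.symm_apply_eq, ← Ne,
    Fin.ne_iff_vne]
  omega

/-- The two outcomes agree on the arrivals before time `t`. -/
def SamePast (t : ℕ) (ω ω' : Outcome n) : Prop :=
  ∀ s : Fin n, (s : ℕ) < t → ω.1 s = ω'.1 s ∧ ω.2 (ω.1 s) = ω'.2 (ω'.1 s)

theorem SamePast.mono {t t' : ℕ} (h : t ≤ t') {ω ω' : Outcome n} (H : SamePast t' ω ω') :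
    SamePast t ω ω' := fun s hs => H s (hs.trans_le h)

theorem SamePast.symm {t : ℕ} {ω ω' : Outcome n} (H : SamePast t ω ω') : SamePast t ω' ω :=
  fun s hs => ⟨(H s hs).1.symm, (H s hs).2.symm⟩

theorem SamePast.trans {t : ℕ} {ω ω' ω'' : Outcome n} (H : SamePast t ω ω')
    (H' : SamePast t ω' ω'') : SamePast t ω ω'' :=
  fun s hs => ⟨(H s hs).1.trans (H' s hs).1, (H s hs).2.trans (H' s hs).2⟩

theorem SamePast.remaining_eq {t : ℕ} {ω ω' : Outcome n} (H : SamePast t ω ω') :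
    remaining ω.1 t = remaining ω'.1 t := by
  have key : ∀ ω ω' : Outcome n, SamePast t ω ω' → ∀ j, t ≤ (ω.1.symm j : ℕ) →
      t ≤ (ω'.1.symm j : ℕ) := fun ω ω' H j hj => by
    by_contra hlt
    have := (H.symm _ (not_le.mp hlt)).1
    rw [Equiv.apply_symm_apply] at this
    rw [this, Equiv.symm_apply_apply] at hj
    exact hlt hj
  ext j
  exact ⟨fun h => mem_remaining.mpr (key _ _ H j (mem_remaining.mp h)),
    fun h => mem_remaining.mpr (key _ _ H.symm j (mem_remaining.mp h))⟩

/-- The arrival at time `t` is, given the past, uniformly distributed on the remaining variables. -/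
theorem sum_perm_condition (t : Fin n) (G : Equiv.Perm (Fin n) → Fin n → ℝ)
    (hG : ∀ (σ : Equiv.Perm (Fin n)) (s : Fin n), t ≤ s → ∀ j,
      G (σ * Equiv.swap t s) j = G σ j) :
    ∑ σ, G σ (σ t) = ∑ σ, (∑ j ∈ remaining σ t, G σ j) / (remaining σ t).card := by
  -- Exchangeability: swapping the times t and s is a bijection of the orders that `G` does not
  -- notice, so the arrivals at t and at s are interchangeable.
  have h1 : ∀ s : Fin n, t ≤ s → ∑ σ, G σ (σ t) = ∑ σ, G σ (σ s) := fun s hs => by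
    rw [← Equiv.sum_comp (Equiv.mulRight (Equiv.swap t s))]
    refine Finset.sum_congr rfl fun σ _ => ?_
    rw [Equiv.coe_mulRight, hG σ s hs, Equiv.Perm.mul_apply, Equiv.swap_apply_left]
  have hpos : (0 : ℝ) < ((n - t : ℕ) : ℝ) := by
    have := t.2
    exact_mod_cast (by omega : 0 < n - (t : ℕ))
  have hcard : (Finset.univ.filter fun s : Fin n => (t : ℕ) ≤ s).card = n - t := by
    have := card_remaining (Equiv.refl (Fin n)) t
    rwa [remaining_eq_map, Finset.card_map] at this
  simp only [card_remaining]
  rw [← Finset.sum_div, eq_div_iff hpos.ne']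
  calc (∑ σ, G σ (σ t)) * ((n - t : ℕ) : ℝ)
      = ∑ s with (t : ℕ) ≤ (s : Fin n), ∑ σ, G σ (σ t) := by
        rw [Finset.sum_const, hcard, nsmul_eq_mul, mul_comm]
    _ = ∑ s with (t : ℕ) ≤ (s : Fin n), ∑ σ, G σ (σ s) :=
        Finset.sum_congr rfl fun s hs => h1 s (by simpa using hs)
    _ = ∑ σ, ∑ s with (t : ℕ) ≤ (s : Fin n), G σ (σ s) := Finset.sum_comm
    _ = _ := by
        refine Finset.sum_congr rfl fun σ _ => ?_
        rw [remaining_eq_map, Finset.sum_map]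
        rfl

namespace Instance

variable (I : Instance n)

theorem weight_eq (ω : Outcome n) : I.weight ω = bitWeight I.prob ω.2 / n.factorial := rfl

theorem weight_nonneg (ω : Outcome n) : 0 ≤ I.weight ω :=
  div_nonneg (bitWeight_nonneg (fun i => (I.prob_pos i).le) I.prob_le_one _) (Nat.cast_nonneg _)

theorem sum_weight_mul (f : Outcome n → ℝ) :
    ∑ ω, I.weight ω * f ω =
      (∑ σ, ∑ b, bitWeight I.prob b * f (σ, b)) / n.factorial := by
  rw [Fintype.sum_prod_type, Finset.sum_div]
  refine Finset.sum_congr rfl fun σ _ => ?_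
  rw [Finset.sum_div]
  refine Finset.sum_congr rfl fun b _ => ?_
  rw [weight_eq]; ring

theorem sum_weight_mul_perm (f : Equiv.Perm (Fin n) → ℝ) :
    ∑ ω, I.weight ω * f ω.1 = (∑ σ, f σ) / n.factorial := by
  rw [sum_weight_mul]
  congr 1
  refine Finset.sum_congr rfl fun σ _ => ?_
  change ∑ b, bitWeight I.prob b * f σ = f σ
  rw [← Finset.sum_mul, sum_bitWeight, one_mul]

theorem sum_weight : ∑ ω, I.weight ω = 1 := by
  have := I.sum_weight_mul_perm (fun _ => 1)
  simp only [mul_one] at this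
  rw [this, Finset.sum_const, Finset.card_univ, Fintype.card_perm, Fintype.card_fin,
    nsmul_eq_mul, mul_one, div_self]
  exact_mod_cast n.factorial_ne_zero

/-- The mean of `F` over the next arrival and its realization. -/
noncomputable def nextMean (S : Finset (Fin n)) (F : Fin n → Bool → ℝ) : ℝ :=
  (∑ j ∈ S, (I.prob j * F j true + (1 - I.prob j) * F j false)) / S.card

theorem nextMean_mono {S : Finset (Fin n)} {F G : Fin n → Bool → ℝ}
    (h : ∀ j ∈ S, ∀ β, F j β ≤ G j β) : I.nextMean S F ≤ I.nextMean S G := by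
  unfold nextMean
  refine div_le_div_of_nonneg_right (Finset.sum_le_sum fun j hj => ?_) (Nat.cast_nonneg _)
  have h1 : 0 ≤ 1 - I.prob j := by linarith [I.prob_le_one j]
  exact add_le_add (mul_le_mul_of_nonneg_left (h j hj _) (I.prob_pos j).le)
    (mul_le_mul_of_nonneg_left (h j hj _) h1)

/-- Conditioning on the past: the realization of the present arrival is averaged first, for a fixed
order, and then its identity. `F` may depend on the outcome through the past only. -/
theorem sum_weight_condition (t : Fin n) (F : Outcome n → Fin n → Bool → ℝ)
    (hF : ∀ ω ω', SamePast t ω ω' → ∀ j β, F ω j β = F ω' j β) :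
    ∑ ω, I.weight ω * F ω (ω.1 t) (ω.2 (ω.1 t)) =
      ∑ ω, I.weight ω * I.nextMean (remaining ω.1 t) (F ω) := by
  have h1 : ∀ σ : Equiv.Perm (Fin n),
      ∑ b, bitWeight I.prob b * F (σ, b) (σ t) (b (σ t)) =
      ∑ b, bitWeight I.prob b * (I.prob (σ t) * F (σ, b) (σ t) true +
        (1 - I.prob (σ t)) * F (σ, b) (σ t) false) := fun σ => by
    refine sum_bitWeight_condition I.prob (σ t) (fun b β => F (σ, b) (σ t) β) fun b c β => ?_
    refine hF (σ, Function.update b (σ t) c) (σ, b) (fun s hs => ⟨rfl, ?_⟩) _ _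
    have : σ s ≠ σ t := fun h => by
      rw [σ.injective h] at hs
      exact lt_irrefl _ hs
    simp [Function.update_of_ne this]
  have h2 : ∀ b : Fin n → Bool, ∑ σ : Equiv.Perm (Fin n),
      (I.prob (σ t) * F (σ, b) (σ t) true + (1 - I.prob (σ t)) * F (σ, b) (σ t) false) =
      ∑ σ, I.nextMean (remaining σ t) (F (σ, b)) := fun b => by
    refine sum_perm_condition t
      (fun σ j => I.prob j * F (σ, b) j true + (1 - I.prob j) * F (σ, b) j false) ?_
    intro σ s hs j
    have : SamePast (t : ℕ) (σ * Equiv.swap t s, b) (σ, b) := fun u hu => by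
      have hu1 : u ≠ t := fun h => by rw [h] at hu; exact lt_irrefl _ hu
      have hu2 : u ≠ s := fun h => by
        rw [h] at hu; exact absurd hu (not_lt.mpr hs)
      simp [Equiv.swap_apply_of_ne_of_ne hu1 hu2]
    rw [hF _ _ this, hF _ _ this]
  rw [sum_weight_mul, sum_weight_mul (f := fun ω => I.nextMean (remaining ω.1 t) (F ω))]
  congr 1
  rw [Finset.sum_congr rfl fun σ _ => h1 σ, Finset.sum_comm]
  refine Eq.trans (Finset.sum_congr rfl fun b _ => ?_) Finset.sum_comm
  rw [← Finset.mul_sum, ← Finset.mul_sum, h2 b]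

end Instance

end ProphetSecretary

namespace ProphetSecretary

set_option linter.unusedSectionVars false

/-! ### Block structures and the potential of the frontloaded game -/

/-- A family of disjoint classes of variables. The members of a class have the same value, and the
arrivals are cut into an initial segment and `K` blocks, separately for every class. -/
structure Blocks {n : ℕ} (I : Instance n) (K : ℕ) (ι : Type) where
  cls : Fin n → Option ι
  val : ι → ℝ
  bd : ι → ℕ → ℕ
  val_pos : ∀ v, 0 < val v
  cls_val : ∀ j v, cls j = some v → I.value j = val v
  cls_prob : ∀ j v, cls j = some v → I.prob j < 1
  bd_mono : ∀ v, Monotone (bd v)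
  bd_last : ∀ v, bd v K = n

namespace Blocks

variable {n K : ℕ} {ι : Type} {I : Instance n} (B : Blocks I K ι)

/-- The value at time `t`, if realized: class members are not realized in the initial segment. -/
noncomputable def gain (t : ℕ) (j : Fin n) : ℝ :=
  match B.cls j with
  | some v => if t < B.bd v 0 then 0 else I.value j
  | none => I.value j

/-- The part of `gain` that does not come from the classes. -/
noncomputable def freeGain (j : Fin n) (β : Bool) : ℝ :=
  if B.cls j = none ∧ β = true then I.value j else 0

/-- The optimal value of the game without frontloading when the `m` variables in `S` remain. -/
noncomputable def contValue (m : ℕ) (S : Finset (Fin n)) : ℝ :=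
  stopValue I.prob (fun m j => B.gain (n - 1 - m) j) m S

/-- The expected one-step loss of `contValue`. -/
noncomputable def drift (m : ℕ) (S : Finset (Fin n)) : ℝ :=
  stopDrift I.prob (fun m j => B.gain (n - 1 - m) j) m S

theorem contValue_nonneg (m : ℕ) (S : Finset (Fin n)) : 0 ≤ B.contValue m S :=
  stopValue_nonneg (fun i => (I.prob_pos i).le) I.prob_le_one _ m S

theorem drift_nonneg (m : ℕ) (S : Finset (Fin n)) : 0 ≤ B.drift m S :=
  stopDrift_nonneg (fun i => (I.prob_pos i).le) _ m S

theorem eraseMean_contValue_le (m : ℕ) (S : Finset (Fin n)) :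
    eraseMean (B.contValue m) S ≤ B.contValue (m + 1) S :=
  eraseMean_stopValue_le (fun i => (I.prob_pos i).le) _ m S

theorem contValue_succ (m : ℕ) (S : Finset (Fin n)) :
    B.contValue (m + 1) S = eraseMean (B.contValue m) S + B.drift m S :=
  stopValue_succ _ m S

theorem contValue_erase_sub_le {m : ℕ} {S : Finset (Fin n)} (hS : S.card = m + 1) {j : Fin n}
    (hj : j ∈ S) :
    B.contValue m (S.erase j) - B.contValue (m + 1) S ≤ B.contValue (m + 1) S / m :=
  stopValue_erase_sub_le (fun i => (I.prob_pos i).le) I.prob_le_one _ hS hj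

theorem gain_nonneg (t : ℕ) (j : Fin n) : 0 ≤ B.gain t j := by
  unfold gain
  split
  · split_ifs
    · exact le_rfl
    · exact I.value_nonneg j
  · exact I.value_nonneg j

theorem freeGain_nonneg (j : Fin n) (β : Bool) : 0 ≤ B.freeGain j β := by
  unfold freeGain
  split_ifs
  · exact I.value_nonneg j
  · exact le_rfl

theorem freeGain_false (j : Fin n) : B.freeGain j false = 0 := by simp [freeGain]

theorem freeGain_le_gain (t : ℕ) (j : Fin n) (β : Bool) : B.freeGain j β ≤ B.gain t j := by
  unfold freeGain
  split_ifs with h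
  · simp [gain, h.1]
  · exact B.gain_nonneg t j

theorem bd_le (v : ι) (k : Fin K) : B.bd v (k + 1) ≤ n :=
  (B.bd_mono v (Nat.succ_le_of_lt k.2)).trans (B.bd_last v).le

/-- Two blocks of the same class that contain the same time are equal. -/
theorem block_unique {v : ι} {k k' t : ℕ} (h1 : B.bd v k ≤ t) (h2 : t < B.bd v (k + 1))
    (h1' : B.bd v k' ≤ t) (h2' : t < B.bd v (k' + 1)) : k = k' := by
  rcases lt_trichotomy k k' with h | h | h
  · have : B.bd v (_ + 1) ≤ _ := B.bd_mono v (Nat.succ_le_of_lt h)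
    omega
  · exact h
  · have : B.bd v (_ + 1) ≤ _ := B.bd_mono v (Nat.succ_le_of_lt h)
    omega

section Potential

variable [Fintype ι] [DecidableEq ι]

/-- The non-final blocks that contain the time `t`. -/
def current (t : ℕ) : Finset (ι × Fin K) :=
  {i | (i.2 : ℕ) + 1 < K ∧ B.bd i.1 i.2 ≤ t ∧ t < B.bd i.1 (i.2 + 1)}

/-- The blocks that start at time `t`. -/
def starting (t : ℕ) : Finset (ι × Fin K) := {i | B.bd i.1 i.2 = t}

/-- The non-final blocks. -/
def regular : Finset (ι × Fin K) := {i | (i.2 : ℕ) + 1 < K}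

/-- The final blocks. -/
def final : Finset (ι × Fin K) := {i | ¬ (i.2 : ℕ) + 1 < K}

/-- The number of steps, from time `t` on, of a block that has begun before time `t`. -/
noncomputable def rest (i : ι × Fin K) (t : ℕ) : ℝ :=
  if B.bd i.1 i.2 < t ∧ t ≤ B.bd i.1 (i.2 + 1) then (B.bd i.1 (i.2 + 1) : ℝ) - t else 0

/-- The best outside option, from non-final blocks, that is held when time `t` begins. -/
noncomputable def held (t : ℕ) (ζ : ι × Fin K → Bool) : ℝ :=
  ⨆ i : ι × Fin K, if (i.2 : ℕ) + 1 < K ∧ B.bd i.1 i.2 < t ∧ t ≤ B.bd i.1 (i.2 + 1) ∧ ζ i = true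
    then B.val i.1 else 0

/-- The best outside option at time `t`. -/
noncomputable def option (t : ℕ) (ζ : ι × Fin K → Bool) : ℝ :=
  ⨆ i : ι × Fin K, if B.bd i.1 i.2 ≤ t ∧ t < B.bd i.1 (i.2 + 1) ∧ ζ i = true
    then B.val i.1 else 0

/-- The conditional probability that the outside option of a block is available, before time `t`,
when every block has it with probability `ρ` and this is shown when the block begins. -/
noncomputable def avail (ρ : ι → ℝ) (t : ℕ) (ζ : ι × Fin K → Bool) (i : ι × Fin K) : ℝ :=
  if B.bd i.1 i.2 < t then (if ζ i = true then 1 else 0) else ρ i.1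

/-- The mean probability of the members of the class `v` in `S`. -/
noncomputable def rate (v : ι) (S : Finset (Fin n)) : ℝ :=
  sampleMean (fun j => if B.cls j = some v then I.prob j else 0) S

/-- The indicator of a block, as a function of the number of arrivals after the present one. -/
noncomputable def blockIndicator (i : ι × Fin K) (m : ℕ) : ℝ :=
  if i ∈ B.current (n - 1 - m) then 1 else 0

/-- The advantage per step of holding an outside option. -/
noncomputable def holdCost (m : ℕ) (S : Finset (Fin n)) : ℝ :=
  2 * B.drift m S + B.contValue (m + 1) S / m

/-- The discrepancy per step between the arrivals of the classes and the nominal rates `r`. -/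
noncomputable def rateCost (r : ι → ℝ) (m : ℕ) (S : Finset (Fin n)) : ℝ :=
  ∑ i ∈ B.current (n - 1 - m), (max 0 (r i.1 - B.rate i.1 S) * B.val i.1 +
    r i.1 * (B.contValue (m + 1) S / m))

/-- The payment that is still due from the blocks under way. -/
noncomputable def debt (r : ι → ℝ) (t : ℕ) (c : ℝ) : ℝ :=
  ∑ i ∈ regular (K := K), r i.1 * B.rest i t * max 0 (B.val i.1 - c)

/-- An upper bound for the value of the frontloaded game. -/
noncomputable def potential (r ρ : ι → ℝ) (D : ℝ) (t : ℕ) (S : Finset (Fin n))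
    (ζ : ι × Fin K → Bool) : ℝ :=
  max (B.contValue (n - t) S) (B.held t ζ) - B.debt r t (B.contValue (n - t) S) + D +
    ∑ i ∈ final (K := K), B.avail ρ t ζ i * B.val i.1 +
    ∑ i ∈ regular (K := K), B.avail ρ t ζ i * chainCost (B.blockIndicator i) B.holdCost (n - t) S +
    chainCost 1 (B.rateCost r) (n - t) S

/-- What is gained if the outside option of a block turns out to be available. -/
noncomputable def jump (m : ℕ) (S : Finset (Fin n)) (i : ι × Fin K) : ℝ :=
  if (i.2 : ℕ) + 1 < K then max 0 (B.val i.1 - B.contValue m S) +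
    chainCost (B.blockIndicator i) B.holdCost m S else B.val i.1

variable {B}

theorem mem_current {t : ℕ} {i : ι × Fin K} : i ∈ B.current t ↔
    (i.2 : ℕ) + 1 < K ∧ B.bd i.1 i.2 ≤ t ∧ t < B.bd i.1 (i.2 + 1) := by simp [current]

theorem held_nonneg (t : ℕ) (ζ : ι × Fin K → Bool) : 0 ≤ B.held t ζ :=
  Real.iSup_nonneg fun i => by split_ifs <;> [exact (B.val_pos _).le; exact le_rfl]

theorem rest_nonneg (i : ι × Fin K) (t : ℕ) : 0 ≤ B.rest i t := by
  unfold rest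
  split_ifs with h
  · have : (t : ℝ) ≤ B.bd i.1 (i.2 + 1) := by exact_mod_cast h.2
    linarith
  · exact le_rfl

theorem avail_nonneg {ρ : ι → ℝ} (hρ : ∀ v, 0 ≤ ρ v) (t : ℕ) (ζ : ι × Fin K → Bool)
    (i : ι × Fin K) : 0 ≤ B.avail ρ t ζ i := by
  unfold avail
  split_ifs <;> [exact zero_le_one; exact le_rfl; exact hρ _]

theorem blockIndicator_nonneg (i : ι × Fin K) (m : ℕ) : 0 ≤ B.blockIndicator i m := by
  unfold blockIndicator
  split_ifs <;> norm_num

theorem holdCost_nonneg (m : ℕ) (S : Finset (Fin n)) : 0 ≤ B.holdCost m S :=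
  add_nonneg (mul_nonneg zero_le_two (B.drift_nonneg m S))
    (div_nonneg (B.contValue_nonneg _ _) (Nat.cast_nonneg _))

theorem rateCost_nonneg {r : ι → ℝ} (hr : ∀ v, 0 ≤ r v) (m : ℕ)
    (S : Finset (Fin n)) : 0 ≤ B.rateCost r m S :=
  Finset.sum_nonneg fun _ _ => add_nonneg
    (mul_nonneg (le_max_left _ _) (B.val_pos _).le)
    (mul_nonneg (hr _) (div_nonneg (B.contValue_nonneg _ _) (Nat.cast_nonneg _)))

theorem rest_succ (i : ι × Fin K) (t : ℕ) :
    B.rest i (t + 1) = B.rest i t -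
      (if B.bd i.1 i.2 ≤ t ∧ t < B.bd i.1 (i.2 + 1) then 1 else 0) +
      (if B.bd i.1 i.2 = t then (B.bd i.1 (i.2 + 1) : ℝ) - B.bd i.1 i.2 else 0) := by
  have hm := B.bd_mono i.1 (Nat.le_succ i.2)
  simp only [Nat.succ_eq_add_one] at hm
  unfold rest
  rcases lt_trichotomy (B.bd i.1 i.2) t with h | h | h
  · rw [if_neg (c := B.bd i.1 i.2 = t) h.ne]
    by_cases h2 : t < B.bd i.1 (i.2 + 1)
    · rw [if_pos ⟨by omega, by omega⟩, if_pos ⟨h, h2.le⟩, if_pos ⟨h.le, h2⟩]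
      push_cast; ring
    · rw [if_neg (by omega), if_neg (c := B.bd i.1 i.2 ≤ t ∧ t < B.bd i.1 (i.2 + 1)) (by omega)]
      split_ifs with h3
      · have : B.bd i.1 (i.2 + 1) = t := by omega
        rw [this]; ring
      · ring
  · rw [if_pos (c := B.bd i.1 i.2 = t) h, if_neg (c := B.bd i.1 i.2 < t ∧ _) (by omega)]
    by_cases h2 : t < B.bd i.1 (i.2 + 1)
    · rw [if_pos ⟨by omega, by omega⟩, if_pos ⟨h.le, h2⟩, h]
      push_cast; ring
    · have : B.bd i.1 (i.2 + 1) = t := by omega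
      rw [if_neg (by omega), if_neg (by omega), this, h]; ring
  · rw [if_neg (by omega), if_neg (by omega), if_neg (by omega), if_neg (by omega)]; ring

theorem sum_rest_le {len : ι → ℝ}
    (hlen : ∀ i : ι × Fin K, (B.bd i.1 (i.2 + 1) : ℝ) - B.bd i.1 i.2 ≤ len i.1)
    (h0 : ∀ v, 0 ≤ len v) (v : ι) (t : ℕ) : ∑ k : Fin K, B.rest (v, k) t ≤ len v := by
  by_cases h : ∃ k : Fin K, B.bd v k < t ∧ t ≤ B.bd v (k + 1)
  · obtain ⟨k, hk1, hk2⟩ := h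
    rw [Finset.sum_eq_single k]
    · have h1 := hlen (v, k)
      have h2 : (B.bd v k : ℝ) ≤ t := by exact_mod_cast hk1.le
      simp only [rest, hk1, hk2, and_self, if_true]
      simp only at h1
      linarith
    · intro k' _ hne
      refine if_neg fun h => hne (Fin.ext ?_)
      obtain ⟨h1, h2⟩ := h
      simp only at h1 h2
      -- A block counts as under way for bd k < t ≤ bd (k+1), so the half-open condition of
      -- `block_unique` holds at t - 1.
      exact B.block_unique (t := t - 1) (v := v) (by omega) (by omega) (by omega) (by omega)
    · simp
  · rw [Finset.sum_eq_zero]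
    · exact h0 v
    · intro k _
      exact if_neg fun h' => h ⟨k, h'⟩

/-- At most one block of each class is under way, and it has at most its whole length left. The
constant `D` of the potential is chosen above this bound, so the debt never makes the potential
negative. -/
theorem debt_le {r len : ι → ℝ} (hr : ∀ v, 0 ≤ r v)
    (hlen : ∀ i : ι × Fin K, (B.bd i.1 (i.2 + 1) : ℝ) - B.bd i.1 i.2 ≤ len i.1)
    (h0 : ∀ v, 0 ≤ len v) (t : ℕ) {c : ℝ} (hc : 0 ≤ c) :
    B.debt r t c ≤ ∑ v, r v * len v * B.val v := by
  have h1 : B.debt r t c ≤ ∑ i : ι × Fin K, r i.1 * B.rest i t * B.val i.1 := by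
    refine (Finset.sum_le_sum fun i _ => ?_).trans (Finset.sum_le_sum_of_subset_of_nonneg
      (Finset.subset_univ _) fun i _ _ => ?_)
    · exact mul_le_mul_of_nonneg_left (max_le (B.val_pos _).le (by linarith))
        (mul_nonneg (hr _) (rest_nonneg _ _))
    · exact mul_nonneg (mul_nonneg (hr _) (rest_nonneg _ _)) (B.val_pos _).le
  refine h1.trans ?_
  rw [Fintype.sum_prod_type]
  refine Finset.sum_le_sum fun v _ => ?_
  simp only
  rw [← Finset.sum_mul, ← Finset.mul_sum]
  exact mul_le_mul_of_nonneg_right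
    (mul_le_mul_of_nonneg_left (sum_rest_le hlen h0 v t) (hr v)) (B.val_pos v).le

/-- The outside option is either held from a non-final block or comes from a final one. -/
theorem option_le (ρ : ι → ℝ) (hρ : ∀ v, 0 ≤ ρ v) (t : ℕ) (ζ : ι × Fin K → Bool) :
    B.option t ζ ≤ B.held (t + 1) ζ + ∑ i ∈ final (K := K), B.avail ρ (t + 1) ζ i * B.val i.1 := by
  have hF : ∀ i : ι × Fin K, 0 ≤ B.avail ρ (t + 1) ζ i * B.val i.1 := fun i =>
    mul_nonneg (avail_nonneg hρ _ _ _) (B.val_pos _).le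
  have hS := Finset.sum_nonneg fun i (_ : i ∈ final (K := K) (ι := ι)) => hF i
  refine Real.iSup_le (fun i => ?_) (add_nonneg (held_nonneg _ _) hS)
  split_ifs with h
  · by_cases hi : (i.2 : ℕ) + 1 < K
    · have h2 : B.val i.1 ≤ B.held (t + 1) ζ := by
        have := le_ciSup (f := fun i : ι × Fin K =>
          if (i.2 : ℕ) + 1 < K ∧ B.bd i.1 i.2 < t + 1 ∧ t + 1 ≤ B.bd i.1 (i.2 + 1) ∧ ζ i = true
          then B.val i.1 else 0) (Set.finite_range _).bddAbove i
        rwa [if_pos ⟨hi, by omega, by omega, h.2.2⟩] at this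
      linarith
    · have hfin : i ∈ final (K := K) := Finset.mem_filter.mpr ⟨Finset.mem_univ _, hi⟩
      have h2 := Finset.single_le_sum (f := fun i => B.avail ρ (t + 1) ζ i * B.val i.1)
        (fun i _ => hF i) hfin
      have h3 : B.avail ρ (t + 1) ζ i = 1 := by
        rw [avail, if_pos (by omega), if_pos h.2.2]
      simp only [h3, one_mul] at h2
      linarith [held_nonneg (B := B) (t + 1) ζ]
  · exact add_nonneg (held_nonneg _ _) hS

/-- The set of held options grows only by blocks that start now, and a new option v adds at most its
excess over c. -/
theorem max_held_succ_le (t : ℕ) (ζ : ι × Fin K → Bool) {c : ℝ} (hc : 0 ≤ c) :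
    max c (B.held (t + 1) ζ) ≤ max c (B.held t ζ) +
      ∑ i ∈ B.starting t with (i.2 : ℕ) + 1 < K,
        (if ζ i = true then 1 else 0) * max 0 (B.val i.1 - c) := by
  have hpos : ∀ i : ι × Fin K, 0 ≤ (if ζ i = true then (1 : ℝ) else 0) * max 0 (B.val i.1 - c) :=
    fun i => mul_nonneg (by split_ifs <;> simp) (le_max_left _ _)
  have hS := Finset.sum_nonneg fun i (_ : i ∈ (B.starting t).filter
    fun i => (i.2 : ℕ) + 1 < K) => hpos i
  refine max_le (by linarith [le_max_left c (B.held t ζ)]) ?_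
  refine Real.iSup_le (fun i => ?_) (by linarith [le_max_left c (B.held t ζ)])
  split_ifs with h
  · obtain ⟨h1, h2, h3, h4⟩ := h
    rcases (Nat.lt_succ_iff_lt_or_eq.mp h2) with h5 | h5
    · have := le_ciSup (f := fun i : ι × Fin K =>
        if (i.2 : ℕ) + 1 < K ∧ B.bd i.1 i.2 < t ∧ t ≤ B.bd i.1 (i.2 + 1) ∧ ζ i = true
        then B.val i.1 else 0) (Set.finite_range _).bddAbove i
      rw [if_pos ⟨h1, h5, by omega, h4⟩] at this
      have h6 : B.held t ζ = ⨆ i : ι × Fin K,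
        if (i.2 : ℕ) + 1 < K ∧ B.bd i.1 i.2 < t ∧ t ≤ B.bd i.1 (i.2 + 1) ∧ ζ i = true
        then B.val i.1 else 0 := rfl
      rw [← h6] at this
      linarith [le_max_right c (B.held t ζ)]
    · have h6 := Finset.single_le_sum (f := fun i : ι × Fin K =>
        (if ζ i = true then (1 : ℝ) else 0) * max 0 (B.val i.1 - c)) (fun i _ => hpos i)
        (show i ∈ (B.starting t).filter fun i => (i.2 : ℕ) + 1 < K by
          simp [starting, h5, h1])
      simp only [h4, if_true, one_mul] at h6
      linarith [le_max_left c (B.held t ζ), le_max_right 0 (B.val i.1 - c)]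
  · linarith [le_max_left c (B.held t ζ)]

/-- The part of the drift that is due to the class `v`. -/
noncomputable def classDrift (B : Blocks I K ι) (v : ι) (m : ℕ) (S : Finset (Fin n)) : ℝ :=
  (∑ j ∈ S, (if B.cls j = some v then I.prob j else 0) *
    max 0 (B.val v - B.contValue m (S.erase j))) / S.card

/-- The variable `j` belongs to at most one current block. If it does, its gain is the class value
while its free gain is 0, and there is equality. -/
theorem sum_current_le (t : ℕ) (j : Fin n) {c : ℝ} (hc : 0 ≤ c) :
    ∑ i ∈ B.current t, (if B.cls j = some i.1 then I.prob j else 0) * max 0 (B.val i.1 - c) ≤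
      I.prob j * (max (B.gain t j) c - max (B.freeGain j true) c) := by
  have hR : 0 ≤ I.prob j * (max (B.gain t j) c - max (B.freeGain j true) c) :=
    mul_nonneg (I.prob_pos j).le
      (sub_nonneg.mpr (max_le_max_right c (B.freeGain_le_gain t j true)))
  by_cases hne : ∃ i ∈ B.current t, B.cls j = some i.1
  · obtain ⟨i, hi, hv⟩ := hne
    rw [Finset.sum_eq_single i]
    · rw [mem_current] at hi
      obtain ⟨-, h1, h2⟩ := hi
      have h0 : ¬ t < B.bd i.1 0 := by
        have := B.bd_mono i.1 (Nat.zero_le i.2)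
        omega
      have h3 : B.gain t j = B.val i.1 := by
        simp only [gain, hv, if_neg h0]
        exact B.cls_val j i.1 hv
      have h4 : B.freeGain j true = 0 := by simp [freeGain, hv]
      rw [if_pos hv, h3, h4, max_eq_right hc]
      refine le_of_eq (congrArg _ ?_)
      rcases le_total (B.val i.1) c with h | h
      · rw [max_eq_left (by linarith), max_eq_right h]; ring
      · rw [max_eq_right (by linarith), max_eq_left h]
    · intro i' hi' hne
      rw [if_neg, zero_mul]
      intro hv'
      refine hne ?_
      have h3 : i'.1 = i.1 := Option.some.inj (hv'.symm.trans hv)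
      rw [mem_current] at hi hi'
      obtain ⟨_, h1, h2⟩ := hi
      obtain ⟨_, h1', h2'⟩ := hi'
      rw [h3] at h1' h2'
      exact Prod.ext h3 (Fin.ext (B.block_unique h1' h2' h1 h2))
    · exact fun h => absurd hi h
  · rw [Finset.sum_eq_zero]
    · exact hR
    · intro i hi
      rw [if_neg fun h => hne ⟨i, hi, h⟩, zero_mul]

/-- In the frontloaded game class members pay through options and not on arrival. The step then
loses at least their part of the drift, which serves to repay the debt. -/
theorem sum_classDrift_le {m : ℕ} (S : Finset (Fin n)) :
    ∑ i ∈ B.current (n - 1 - m), classDrift B i.1 m S ≤ B.contValue (m + 1) S -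
      I.nextMean S (fun j β => max (B.freeGain j β) (B.contValue m (S.erase j))) := by
  rw [contValue, stopValue, Instance.nextMean, ← sub_div, ← Finset.sum_sub_distrib]
  simp only [classDrift]
  rw [← Finset.sum_div, Finset.sum_comm]
  refine div_le_div_of_nonneg_right (Finset.sum_le_sum fun j _ => ?_) (Nat.cast_nonneg _)
  have h0 := B.contValue_nonneg m (S.erase j)
  have h1 := sum_current_le (B := B) (n - 1 - m) j h0
  simp only [contValue] at h0 h1 ⊢
  rw [freeGain_false, max_eq_right h0]
  linarith

/-- A maximum with a constant `a` increases at most by the positive part of the increase of its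
other argument, whose mean `mean_excess_le` controls. -/
theorem nextMean_max_held_le {m : ℕ} {S : Finset (Fin n)} (hS : S.card = m + 1) (a : ℝ) :
    I.nextMean S (fun j β => max (max (B.freeGain j β) (B.contValue m (S.erase j))) a) ≤
      max (B.contValue (m + 1) S) a + (B.drift m S + B.contValue (m + 1) S / m) := by
  have hcard : (0 : ℝ) < S.card := by rw [hS]; positivity
  have h := mean_excess_le (fun i => (I.prob_pos i).le) I.prob_le_one
    (fun m j => B.gain (n - 1 - m) j) hS
  refine le_trans ?_ (add_le_add_right h _)
  set c := B.contValue (m + 1) S with hc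
  rw [Instance.nextMean, div_le_iff₀ hcard, add_mul, div_mul_cancel₀ _ hcard.ne',
    mul_comm (max c a), ← nsmul_eq_mul, ← Finset.sum_const, ← Finset.sum_add_distrib]
  refine Finset.sum_le_sum fun j _ => ?_
  have h0 := B.contValue_nonneg m (S.erase j)
  rw [freeGain_false, max_eq_right h0]
  have key : ∀ y z : ℝ, y ≤ z → max y a ≤ max c a + max 0 (z - c) := fun y z hyz =>
    max_le (by linarith [le_max_left c a, le_max_right 0 (z - c)])
      (by linarith [le_max_right c a, le_max_left 0 (z - c)])
  have e1 := mul_le_mul_of_nonneg_left (key (max (B.freeGain j true) (B.contValue m (S.erase j)))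
    (max (B.gain (n - 1 - m) j) (B.contValue m (S.erase j)))
    (max_le_max_right _ (B.freeGain_le_gain _ _ _))) (I.prob_pos j).le
  have e2 := mul_le_mul_of_nonneg_left (key (B.contValue m (S.erase j)) _ le_rfl)
    (by linarith [I.prob_le_one j] : 0 ≤ 1 - I.prob j)
  simp only [contValue] at e1 e2 hc ⊢
  rw [← hc]
  linarith

theorem sum_classDrift_le_drift {m : ℕ} (S : Finset (Fin n)) :
    ∑ i ∈ B.current (n - 1 - m), classDrift B i.1 m S ≤ B.drift m S := by
  refine (sum_classDrift_le S).trans ?_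
  have h1 : eraseMean (B.contValue m) S ≤
      I.nextMean S (fun j β => max (B.freeGain j β) (B.contValue m (S.erase j))) := by
    refine div_le_div_of_nonneg_right (Finset.sum_le_sum fun j _ => ?_) (Nat.cast_nonneg _)
    nlinarith [mul_le_mul_of_nonneg_left
      (le_max_right (B.freeGain j true) (B.contValue m (S.erase j))) (I.prob_pos j).le,
      mul_le_mul_of_nonneg_left (le_max_right (B.freeGain j false) (B.contValue m (S.erase j)))
        (by linarith [I.prob_le_one j] : 0 ≤ 1 - I.prob j)]
  rw [contValue_succ]
  linarith

/-- The nominal income from a class is covered by the drift and the discrepancy. -/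
theorem nominal_le {r : ι → ℝ} (hr : ∀ v, 0 ≤ r v) {m : ℕ} {S : Finset (Fin n)}
    (hS : S.card = m + 1) (v : ι) :
    r v * max 0 (B.val v - B.contValue (m + 1) S) ≤ classDrift B v m S +
      (max 0 (r v - B.rate v S) * B.val v + r v * (B.contValue (m + 1) S / m)) := by
  set c := B.contValue (m + 1) S with hc
  have hc0 : 0 ≤ c := B.contValue_nonneg _ _
  have hv := B.val_pos v
  have hcm : 0 ≤ c / m := div_nonneg hc0 (Nat.cast_nonneg _)
  -- By stability the continuation value after any arrival is at most c + c/m, so every class member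
  -- earns at least `w` above it.
  set w := max 0 (B.val v - c - c / m) with hw
  have hw0 : 0 ≤ w := le_max_left _ _
  have hw1 : w ≤ B.val v := max_le hv.le (by linarith)
  have hrate : B.rate v S * w ≤ classDrift B v m S := by
    rw [rate, sampleMean, classDrift, div_mul_eq_mul_div, Finset.sum_mul]
    refine div_le_div_of_nonneg_right (Finset.sum_le_sum fun j hj => ?_) (Nat.cast_nonneg _)
    refine mul_le_mul_of_nonneg_left (max_le_max_left 0 ?_) ?_
    · linarith [B.contValue_erase_sub_le hS hj]
    · split_ifs <;> [exact (I.prob_pos j).le; exact le_rfl]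
  have h1 : max 0 (B.val v - c) ≤ w + c / m :=
    max_le (by linarith) (by linarith [le_max_right 0 (B.val v - c - c / m)])
  have h2 : (r v - B.rate v S) * w ≤ max 0 (r v - B.rate v S) * B.val v :=
    (mul_le_mul_of_nonneg_right (le_max_right _ _) hw0).trans
      (mul_le_mul_of_nonneg_left hw1 (le_max_left _ _))
  nlinarith [mul_le_mul_of_nonneg_left h1 (hr v)]

/-- Jensen: the value is a supermartingale, so its positive shortfall below `a` is a submartingale.
An outstanding debt therefore does not shrink on average by itself. -/
theorem eraseMean_max_zero_sub_ge {m : ℕ} {S : Finset (Fin n)} (hS : S.card = m + 1) (a : ℝ) :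
    max 0 (a - B.contValue (m + 1) S) ≤
      eraseMean (fun T => max 0 (a - B.contValue m T)) S := by
  have hne : S.Nonempty := Finset.card_pos.mp (by omega)
  refine max_le (eraseMean_nonneg fun _ _ => le_max_left _ _) ?_
  have h1 : a - eraseMean (B.contValue m) S = eraseMean (fun T => a + (-1) * B.contValue m T) S := by
    rw [eraseMean_add, eraseMean_const_mul, eraseMean_const hne]; ring
  have h2 : eraseMean (fun T => a + (-1) * B.contValue m T) S ≤
      eraseMean (fun T => max 0 (a - B.contValue m T)) S :=
    eraseMean_mono fun j _ => by linarith [le_max_right 0 (a - B.contValue m (S.erase j))]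
  linarith [B.eraseMean_contValue_le m S]

end Potential

end Blocks

end ProphetSecretary

/-! ### One step of the frontloaded game: the potential does not grow -/

namespace ProphetSecretary

set_option linter.unusedSectionVars false

namespace Blocks

variable {n K : ℕ} {ι : Type} {I : Instance n} {B : Blocks I K ι} [Fintype ι] [DecidableEq ι]

/-- Without an option from a current block, the step yields the value minus the class drift. With
one, the maximum may grow, and the class drift subtracted here is not really lost; both errors
together are at most `holdCost`, which is why the drift occurs twice in it. -/
theorem potential_main_le {m t : ℕ} (ht : n = t + m + 1) {S : Finset (Fin n)}
    (hS : S.card = m + 1) (ζ : ι × Fin K → Bool) :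
    I.nextMean S (fun j β => max (max (B.freeGain j β) (B.contValue m (S.erase j)))
        (B.held (t + 1) ζ)) ≤
      max (B.contValue (m + 1) S) (B.held (t + 1) ζ) - ∑ i ∈ B.current t, classDrift B i.1 m S +
        (∑ i ∈ B.current t, if ζ i = true then (1 : ℝ) else 0) * B.holdCost m S := by
  have htm : n - 1 - m = t := by omega
  have hdr := sum_classDrift_le_drift (B := B) (m := m) S
  rw [htm] at hdr
  have hcost := holdCost_nonneg (B := B) m S
  by_cases h : ∃ i ∈ B.current t, ζ i = true
  · obtain ⟨i, hi, hζ⟩ := h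
    have h1 : (1 : ℝ) ≤ ∑ i ∈ B.current t, if ζ i = true then (1 : ℝ) else 0 := by
      have := Finset.single_le_sum (f := fun i => if ζ i = true then (1 : ℝ) else 0)
        (fun i _ => by split_ifs <;> simp) hi
      simpa [hζ] using this
    have h2 := nextMean_max_held_le (B := B) hS (B.held (t + 1) ζ)
    have h3 := mul_le_mul_of_nonneg_right h1 hcost
    have h4 : B.holdCost m S = 2 * B.drift m S + B.contValue (m + 1) S / m := rfl
    linarith
  -- A block held at time t+1 is exactly a current block at time t whose bit is set, so nothing is
  -- held here.
  · have hheld : B.held (t + 1) ζ = 0 := by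
      refine le_antisymm (Real.iSup_le (fun i => ?_) le_rfl) (held_nonneg _ _)
      rw [if_neg]
      rintro ⟨h1, h2, h3, h4⟩
      exact h ⟨i, mem_current.mpr ⟨h1, by omega, by omega⟩, h4⟩
    have h0 : ∑ i ∈ B.current t, (if ζ i = true then (1 : ℝ) else 0) = 0 :=
      Finset.sum_eq_zero fun i hi => if_neg fun h' => h ⟨i, hi, h'⟩
    have h1 := sum_classDrift_le (B := B) (m := m) S
    rw [htm] at h1
    rw [h0, hheld, zero_mul, add_zero, max_eq_left (B.contValue_nonneg _ _)]
    have h2 : I.nextMean S (fun j β => max (max (B.freeGain j β) (B.contValue m (S.erase j))) 0) =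
        I.nextMean S (fun j β => max (B.freeGain j β) (B.contValue m (S.erase j))) := by
      congr 1
      funext j β
      exact max_eq_left (le_max_of_le_left (B.freeGain_nonneg j β))
    rw [h2]
    linarith

/-- A starting block books a loan of rate × length × excess, enough for the expected gain ρ × excess
of its option; each step of a current block repays rate × excess. -/
theorem debt_succ_ge {r ρ : ι → ℝ} (hr : ∀ v, 0 ≤ r v)
    (hρ : ∀ i : ι × Fin K, (i.2 : ℕ) + 1 < K →
      ρ i.1 ≤ r i.1 * ((B.bd i.1 (i.2 + 1) : ℝ) - B.bd i.1 i.2))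
    {m : ℕ} (t : ℕ) {S : Finset (Fin n)} (hS : S.card = m + 1) :
    B.debt r t (B.contValue (m + 1) S) +
        ∑ i ∈ B.starting t with (i.2 : ℕ) + 1 < K,
          ρ i.1 * max 0 (B.val i.1 - B.contValue (m + 1) S) ≤
      eraseMean (fun T => B.debt r (t + 1) (B.contValue m T)) S +
        ∑ i ∈ B.current t, r i.1 * max 0 (B.val i.1 - B.contValue (m + 1) S) := by
  set c := B.contValue (m + 1) S with hc
  have h1 : B.debt r (t + 1) c ≤ eraseMean (fun T => B.debt r (t + 1) (B.contValue m T)) S := by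
    simp only [debt]
    rw [eraseMean_sum]
    refine Finset.sum_le_sum fun i _ => ?_
    rw [eraseMean_const_mul]
    exact mul_le_mul_of_nonneg_left (eraseMean_max_zero_sub_ge hS _)
      (mul_nonneg (hr _) (rest_nonneg _ _))
  have h2 : B.debt r (t + 1) c = B.debt r t c -
      ∑ i ∈ B.current t, r i.1 * max 0 (B.val i.1 - c) +
      ∑ i ∈ B.starting t with (i.2 : ℕ) + 1 < K,
        r i.1 * ((B.bd i.1 (i.2 + 1) : ℝ) - B.bd i.1 i.2) * max 0 (B.val i.1 - c) := by
    have e1 : B.current t = (regular (K := K) (ι := ι)).filter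
        (fun i => B.bd i.1 i.2 ≤ t ∧ t < B.bd i.1 (i.2 + 1)) := by
      ext i; simp [current, regular]
    have e2 : (B.starting t).filter (fun i => (i.2 : ℕ) + 1 < K) =
        (regular (K := K) (ι := ι)).filter (fun i => B.bd i.1 i.2 = t) := by
      ext i; simp [starting, regular, and_comm]
    rw [e1, e2, Finset.sum_filter, Finset.sum_filter]
    simp only [debt]
    rw [← Finset.sum_sub_distrib, ← Finset.sum_add_distrib]
    refine Finset.sum_congr rfl fun i _ => ?_
    rw [rest_succ]
    split_ifs <;> ring
  have h3 : ∑ i ∈ B.starting t with (i.2 : ℕ) + 1 < K, ρ i.1 * max 0 (B.val i.1 - c) ≤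
      ∑ i ∈ B.starting t with (i.2 : ℕ) + 1 < K,
        r i.1 * ((B.bd i.1 (i.2 + 1) : ℝ) - B.bd i.1 i.2) * max 0 (B.val i.1 - c) :=
    Finset.sum_le_sum fun i hi => mul_le_mul_of_nonneg_right
      (hρ i (Finset.mem_filter.mp hi).2) (le_max_left _ _)
  linarith

theorem avail_succ (ρ : ι → ℝ) (t : ℕ) (ζ : ι × Fin K → Bool) (i : ι × Fin K) :
    B.avail ρ (t + 1) ζ i = B.avail ρ t ζ i +
      (if B.bd i.1 i.2 = t then (if ζ i = true then 1 else 0) - ρ i.1 else 0) := by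
  unfold avail
  rcases lt_trichotomy (B.bd i.1 i.2) t with h | h | h
  · rw [if_pos (by omega), if_pos h, if_neg h.ne]; ring
  · rw [if_pos (by omega), if_neg (c := B.bd i.1 i.2 < t) (by omega), if_pos h]; ring
  · rw [if_neg (by omega), if_neg (by omega), if_neg (by omega)]; ring

/-- The reward of stopping at time `t` in the frontloaded game. -/
noncomputable def frontPay (B : Blocks I K ι) (t : ℕ) (ζ : ι × Fin K → Bool) (j : Fin n)
    (β : Bool) : ℝ :=
  max (B.freeGain j β) (B.option t ζ)

/-- One step of the frontloaded game. -/
theorem nextMean_potential_le {r ρ len : ι → ℝ} (hr : ∀ v, 0 ≤ r v) (hρ0 : ∀ v, 0 ≤ ρ v)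
    (hρ : ∀ i : ι × Fin K, (i.2 : ℕ) + 1 < K →
      ρ i.1 ≤ r i.1 * ((B.bd i.1 (i.2 + 1) : ℝ) - B.bd i.1 i.2))
    (hlen : ∀ i : ι × Fin K, (B.bd i.1 (i.2 + 1) : ℝ) - B.bd i.1 i.2 ≤ len i.1)
    (hlen0 : ∀ v, 0 ≤ len v) {D : ℝ} (hD : ∑ v, r v * len v * B.val v ≤ D)
    {m t : ℕ} (ht : n = t + m + 1) {S : Finset (Fin n)} (hS : S.card = m + 1)
    (ζ : ι × Fin K → Bool) :
    I.nextMean S (fun j β => max (B.frontPay t ζ j β)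
        (B.potential r ρ D (t + 1) (S.erase j) ζ)) ≤
      B.potential r ρ D t S ζ + ∑ i ∈ B.starting t,
        ((if ζ i = true then 1 else 0) - ρ i.1) * B.jump (m + 1) S i := by
  have hcard : (0 : ℝ) < S.card := by rw [hS]; positivity
  have hne : S.Nonempty := Finset.card_pos.mp (by omega)
  have e1 : n - t = m + 1 := by omega
  have e2 : n - (t + 1) = m := by omega
  have htm : n - 1 - m = t := by omega
  set F := ∑ i ∈ final (K := K), B.avail ρ (t + 1) ζ i * B.val i.1 with hF
  have hF0 : 0 ≤ F := Finset.sum_nonneg fun i _ =>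
    mul_nonneg (avail_nonneg hρ0 _ _ _) (B.val_pos _).le
  let X : Finset (Fin n) → ℝ := fun T =>
    ∑ i ∈ regular (K := K), B.avail ρ (t + 1) ζ i * chainCost (B.blockIndicator i) B.holdCost m T
  let E : Finset (Fin n) → ℝ := fun T => chainCost 1 (B.rateCost r) m T
  have hX0 : ∀ T, 0 ≤ X T := fun T => Finset.sum_nonneg fun i _ =>
    mul_nonneg (avail_nonneg hρ0 _ _ _)
      (chainCost_nonneg (blockIndicator_nonneg i) holdCost_nonneg _ _)
  have hE0 : ∀ T, 0 ≤ E T := fun T =>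
    chainCost_nonneg (fun _ => zero_le_one) (rateCost_nonneg hr) _ _
  -- Stopping and continuing are bounded by one expression. For stopping this needs debt ≤ `D`, and
  -- the sum over final blocks covers an option that is not held.
  have hstep1 : I.nextMean S (fun j β => max (B.frontPay t ζ j β)
        (B.potential r ρ D (t + 1) (S.erase j) ζ)) ≤
      I.nextMean S (fun j β => max (max (B.freeGain j β) (B.contValue m (S.erase j)))
        (B.held (t + 1) ζ) + (D + F + (X (S.erase j) + E (S.erase j) +
          (-1) * B.debt r (t + 1) (B.contValue m (S.erase j))))) := by
    refine I.nextMean_mono fun j _ β => ?_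
    have hd : B.debt r (t + 1) (B.contValue m (S.erase j)) ≤ D :=
      (debt_le hr hlen hlen0 _ (B.contValue_nonneg _ _)).trans hD
    have ho := option_le (B := B) ρ hρ0 t ζ
    rw [← hF] at ho
    have hx := hX0 (S.erase j)
    have he := hE0 (S.erase j)
    refine max_le (max_le ?_ ?_) ?_
    · have := le_max_left (max (B.freeGain j β) (B.contValue m (S.erase j))) (B.held (t + 1) ζ)
      have := le_max_left (B.freeGain j β) (B.contValue m (S.erase j))
      linarith
    · have := le_max_right (max (B.freeGain j β) (B.contValue m (S.erase j))) (B.held (t + 1) ζ)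
      linarith
    · have : max (B.contValue m (S.erase j)) (B.held (t + 1) ζ) ≤
          max (max (B.freeGain j β) (B.contValue m (S.erase j))) (B.held (t + 1) ζ) :=
        max_le_max_right _ (le_max_right _ _)
      simp only [potential, e2]
      simp only [X, E, F] at *
      linarith
  have hstep2 : ∀ (f : Fin n → Bool → ℝ) (g : Finset (Fin n) → ℝ),
      I.nextMean S (fun j β => f j β + g (S.erase j)) = I.nextMean S f + eraseMean g S := by
    intro f g
    rw [Instance.nextMean, Instance.nextMean, eraseMean, ← add_div, ← Finset.sum_add_distrib]
    congr 1
    exact Finset.sum_congr rfl fun j _ => by ring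
  have hmean : eraseMean (fun T => D + F + (X T + E T +
      (-1) * B.debt r (t + 1) (B.contValue m T))) S = D + F + (eraseMean X S + eraseMean E S -
        eraseMean (fun T => B.debt r (t + 1) (B.contValue m T)) S) := by
    rw [eraseMean_add, eraseMean_const hne, eraseMean_add, eraseMean_add, eraseMean_const_mul]
    ring
  rw [hstep2 (fun j β => max (max (B.freeGain j β) (B.contValue m (S.erase j)))
        (B.held (t + 1) ζ)) (fun T => D + F + (X T + E T +
          (-1) * B.debt r (t + 1) (B.contValue m T))), hmean] at hstep1
  refine hstep1.trans ?_
  set c := B.contValue (m + 1) S with hc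
  have hc0 : 0 ≤ c := B.contValue_nonneg _ _
  have hmain := potential_main_le (B := B) ht hS ζ
  have hheld := max_held_succ_le (B := B) t ζ hc0
  have hdebt := debt_succ_ge (B := B) hr hρ t hS
  rw [← hc] at hmain hdebt
  have hnom : ∑ i ∈ B.current t, r i.1 * max 0 (B.val i.1 - c) ≤
      ∑ i ∈ B.current t, classDrift B i.1 m S + B.rateCost r m S := by
    rw [rateCost, htm, ← Finset.sum_add_distrib]
    exact Finset.sum_le_sum fun i _ => nominal_le hr hS i.1
  -- The holding cost of the present step is the first term of the chain costs of the current
  -- blocks; these have begun, so their availability is already 0 or 1.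
  have hXs : (∑ i ∈ B.current t, if ζ i = true then (1 : ℝ) else 0) * B.holdCost m S +
      eraseMean X S = ∑ i ∈ regular (K := K), B.avail ρ (t + 1) ζ i *
        chainCost (B.blockIndicator i) B.holdCost (m + 1) S := by
    simp only [X]
    rw [eraseMean_sum, Finset.sum_mul]
    have : B.current t = (regular (K := K) (ι := ι)).filter (fun i => i ∈ B.current t) := by
      ext i; simp only [current, regular, Finset.mem_filter, Finset.mem_univ, true_and]; tauto
    rw [this, Finset.sum_filter, ← Finset.sum_add_distrib]
    refine Finset.sum_congr rfl fun i _ => ?_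
    rw [eraseMean_const_mul, chainCost, mul_add, blockIndicator, htm]
    by_cases h : i ∈ B.current t
    · have hav : B.avail ρ (t + 1) ζ i = if ζ i = true then 1 else 0 :=
        if_pos (Nat.lt_succ_of_le (mem_current.mp h).2.1)
      rw [if_pos h, if_pos h, hav]
      ring
    · rw [if_neg h, if_neg h]
      ring
  have hEs : B.rateCost r m S + eraseMean E S = chainCost 1 (B.rateCost r) (m + 1) S := by
    simp only [E, chainCost, Pi.one_apply, one_mul]
  have hsplit : ∀ f : ι × Fin K → ℝ, ∑ i ∈ B.starting t, f i =
      ∑ i ∈ B.starting t with (i.2 : ℕ) + 1 < K, f i +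
      ∑ i ∈ B.starting t with ¬ (i.2 : ℕ) + 1 < K, f i := fun f =>
    (Finset.sum_filter_add_sum_filter_not _ _ _).symm
  -- Revealing the bit of a starting block replaces ρ by ζ. These centred differences, collected in
  -- `jump`, are the only terms that do not decrease pointwise.
  have hswap : ∀ (f : ι × Fin K → ℝ), ∑ i ∈ regular (K := K), B.avail ρ (t + 1) ζ i * f i =
      ∑ i ∈ regular (K := K), B.avail ρ t ζ i * f i +
      ∑ i ∈ B.starting t with (i.2 : ℕ) + 1 < K,
        ((if ζ i = true then 1 else 0) - ρ i.1) * f i := by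
    intro f
    have : (B.starting t).filter (fun i => (i.2 : ℕ) + 1 < K) =
        (regular (K := K) (ι := ι)).filter (fun i => B.bd i.1 i.2 = t) := by
      ext i; simp [starting, regular, and_comm]
    rw [this, Finset.sum_filter, ← Finset.sum_add_distrib]
    refine Finset.sum_congr rfl fun i _ => ?_
    rw [avail_succ]
    split_ifs <;> ring
  have hFs : F = ∑ i ∈ final (K := K), B.avail ρ t ζ i * B.val i.1 +
      ∑ i ∈ B.starting t with ¬ (i.2 : ℕ) + 1 < K,
        ((if ζ i = true then 1 else 0) - ρ i.1) * B.val i.1 := by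
    have : (B.starting t).filter (fun i => ¬ (i.2 : ℕ) + 1 < K) =
        (final (K := K) (ι := ι)).filter (fun i => B.bd i.1 i.2 = t) := by
      ext i; simp only [starting, final, Finset.mem_filter, Finset.mem_univ, true_and]; tauto
    rw [hF, this, Finset.sum_filter, ← Finset.sum_add_distrib]
    refine Finset.sum_congr rfl fun i _ => ?_
    rw [avail_succ]
    split_ifs <;> ring
  have hj1 : ∑ i ∈ B.starting t with (i.2 : ℕ) + 1 < K,
      ((if ζ i = true then 1 else 0) - ρ i.1) * B.jump (m + 1) S i =
      ∑ i ∈ B.starting t with (i.2 : ℕ) + 1 < K,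
        (if ζ i = true then 1 else 0) * max 0 (B.val i.1 - c) -
      ∑ i ∈ B.starting t with (i.2 : ℕ) + 1 < K, ρ i.1 * max 0 (B.val i.1 - c) +
      ∑ i ∈ B.starting t with (i.2 : ℕ) + 1 < K, ((if ζ i = true then 1 else 0) - ρ i.1) *
        chainCost (B.blockIndicator i) B.holdCost (m + 1) S := by
    rw [← Finset.sum_sub_distrib, ← Finset.sum_add_distrib]
    refine Finset.sum_congr rfl fun i hi => ?_
    rw [jump, if_pos (Finset.mem_filter.mp hi).2]
    ring
  have hj2 : ∑ i ∈ B.starting t with ¬ (i.2 : ℕ) + 1 < K,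
      ((if ζ i = true then 1 else 0) - ρ i.1) * B.jump (m + 1) S i =
      ∑ i ∈ B.starting t with ¬ (i.2 : ℕ) + 1 < K,
        ((if ζ i = true then 1 else 0) - ρ i.1) * B.val i.1 := by
    refine Finset.sum_congr rfl fun i hi => ?_
    rw [jump, if_neg (Finset.mem_filter.mp hi).2]
  rw [hsplit, hj1, hj2]
  rw [hswap] at hXs
  simp only [potential, e1]
  rw [← hc]
  linarith

end Blocks

end ProphetSecretary

/-! ### Change of measure to independent outside options -/

namespace ProphetSecretary

set_option linter.unusedSectionVars false

open scoped Classical in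
/-- The indicator of a proposition. -/
noncomputable def ind (P : Prop) : ℝ := if P then 1 else 0

theorem ind_pos {P : Prop} (h : P) : ind P = 1 := if_pos h

theorem ind_neg {P : Prop} (h : ¬ P) : ind P = 0 := if_neg h

theorem ind_false : ind False = 0 := ind_neg not_false

theorem ind_nonneg (P : Prop) : 0 ≤ ind P := by
  by_cases h : P
  · rw [ind_pos h]; exact zero_le_one
  · rw [ind_neg h]

theorem ind_le_one (P : Prop) : ind P ≤ 1 := by
  by_cases h : P
  · rw [ind_pos h]
  · rw [ind_neg h]; exact zero_le_one

theorem ind_congr {P Q : Prop} (h : P ↔ Q) : ind P = ind Q := by rw [propext h]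

theorem Instance.exp_q {n : ℕ} (I : Instance n) {j : Fin n} (h : I.prob j < 1) :
    (1 - I.prob j) * Real.exp (I.q j) = 1 := by
  rw [Instance.q, Real.exp_neg, Real.exp_log (by linarith)]
  exact mul_inv_cancel₀ (by linarith)

theorem Instance.q_nonneg {n : ℕ} (I : Instance n) (j : Fin n) : 0 ≤ I.q j := by
  rw [Instance.q]
  have := Real.log_nonpos (x := 1 - I.prob j) (by linarith [I.prob_le_one j])
    (by linarith [I.prob_pos j])
  linarith

namespace Blocks

variable {n K : ℕ} {ι : Type} {I : Instance n} (B : Blocks I K ι) [Fintype ι] [DecidableEq ι]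

/-- The mass of the class members that arrive in a block before time `t`. -/
noncomputable def mass (i : ι × Fin K) (t : ℕ) (σ : Equiv.Perm (Fin n)) : ℝ :=
  ∑ s : Fin n, if B.bd i.1 i.2 ≤ s ∧ (s : ℕ) < B.bd i.1 (i.2 + 1) ∧ (s : ℕ) < t ∧
    B.cls (σ s) = some i.1 then I.q (σ s) else 0

/-- Some class member that arrives in the block before time `t` is realized. -/
def Realized (i : ι × Fin K) (t : ℕ) (ω : Outcome n) : Prop :=
  ∃ s : Fin n, B.bd i.1 i.2 ≤ s ∧ (s : ℕ) < B.bd i.1 (i.2 + 1) ∧ (s : ℕ) < t ∧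
    B.cls (ω.1 s) = some i.1 ∧ ω.2 (ω.1 s) = true

open scoped Classical in
/-- The pattern of available outside options. -/
noncomputable def zeta (ω : Outcome n) (i : ι × Fin K) : Bool := decide (B.Realized i n ω)

open scoped Classical in
/-- The density of the law of the past of a block, when the outside option of the block is `z` and
has nominal mass `Q`, with respect to independent realizations, as a function of the mass `a` that
has arrived and of whether a member `R` has been realized. -/
noncomputable def blockDensity (Q a : ℝ) (R : Prop) (z : Bool) : ℝ :=
  if R then (if z = true then 1 else 0)
  else (if z = true then 1 - Real.exp (a - Q) else Real.exp (a - Q))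

/-- The density of the past, given the nominal outside options `ζ`. -/
noncomputable def density (Q : ι → ℝ) (ζ : ι × Fin K → Bool) (t : ℕ) (ω : Outcome n) : ℝ :=
  ∏ i : ι × Fin K, blockDensity (Q i.1) (B.mass i t ω.1) (B.Realized i t ω) (ζ i)

/-- No block has received more than its nominal mass before time `t`. -/
def WithinMass (Q : ι → ℝ) (t : ℕ) (σ : Equiv.Perm (Fin n)) : Prop :=
  ∀ i : ι × Fin K, B.mass i t σ ≤ Q i.1

variable {B}

theorem blockDensity_nonneg {Q a : ℝ} (h : a ≤ Q) (R : Prop) (z : Bool) :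
    0 ≤ blockDensity Q a R z := by
  unfold blockDensity
  have : Real.exp (a - Q) ≤ 1 := Real.exp_le_one_iff.mpr (by linarith)
  split_ifs
  · exact zero_le_one
  · exact le_rfl
  · linarith
  · exact (Real.exp_pos _).le

theorem density_nonneg {Q : ι → ℝ} {t : ℕ} {ω : Outcome n} (h : B.WithinMass Q t ω.1)
    (ζ : ι × Fin K → Bool) : 0 ≤ B.density Q ζ t ω :=
  Finset.prod_nonneg fun i _ => blockDensity_nonneg (h i) _ _

theorem mass_congr {t : ℕ} {ω ω' : Outcome n} (h : SamePast t ω ω') (i : ι × Fin K) :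
    B.mass i t ω.1 = B.mass i t ω'.1 := by
  refine Finset.sum_congr rfl fun s _ => ?_
  by_cases hs : (s : ℕ) < t
  · rw [(h s hs).1]
  · rw [if_neg (fun h => hs h.2.2.1), if_neg (fun h => hs h.2.2.1)]

theorem Realized.congr {t : ℕ} {ω ω' : Outcome n} (h : SamePast t ω ω') {i : ι × Fin K}
    (hr : B.Realized i t ω) : B.Realized i t ω' := by
  obtain ⟨s, h1, h2, h3, h4, h5⟩ := hr
  obtain ⟨e1, e2⟩ := h s h3
  exact ⟨s, h1, h2, h3, e1 ▸ h4, e2 ▸ h5⟩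

theorem realized_congr {t : ℕ} {ω ω' : Outcome n} (h : SamePast t ω ω') (i : ι × Fin K) :
    B.Realized i t ω ↔ B.Realized i t ω' := ⟨fun hr => hr.congr h, fun hr => hr.congr h.symm⟩

/-- The next arrival `j` at time `t` belongs to the block `i`. -/
def Hits (B : Blocks I K ι) (t : ℕ) (j : Fin n) (i : ι × Fin K) : Prop :=
  B.bd i.1 i.2 ≤ t ∧ t < B.bd i.1 (i.2 + 1) ∧ B.cls j = some i.1

theorem Hits.unique {t : ℕ} {j : Fin n} {i i' : ι × Fin K} (h : B.Hits t j i)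
    (h' : B.Hits t j i') : i = i' := by
  obtain ⟨h1, h2, h3⟩ := h
  obtain ⟨h1', h2', h3'⟩ := h'
  have h4 : i.1 = i'.1 := Option.some.inj (h3.symm.trans h3')
  rw [h4] at h1 h2
  exact Prod.ext h4 (Fin.ext (B.block_unique h1 h2 h1' h2'))

theorem mass_succ (i : ι × Fin K) (t : Fin n) (σ : Equiv.Perm (Fin n)) :
    B.mass i (t + 1) σ = B.mass i t σ + ind (B.Hits t (σ t) i) * I.q (σ t) := by
  unfold mass
  rw [← Finset.sum_erase_add _ _ (Finset.mem_univ t), ← Finset.sum_erase_add _ _ (Finset.mem_univ t)]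
  have h1 : ∀ s ∈ Finset.univ.erase t, ((s : ℕ) < t + 1 ↔ (s : ℕ) < t) := fun s hs => by
    have := Finset.ne_of_mem_erase hs
    rw [Fin.ne_iff_vne] at this
    omega
  rw [if_neg (c := B.bd i.1 i.2 ≤ t ∧ (t : ℕ) < B.bd i.1 (i.2 + 1) ∧ (t : ℕ) < t ∧
    B.cls (σ t) = some i.1) (fun h => lt_irrefl _ h.2.2.1), add_zero]
  congr 1
  · exact Finset.sum_congr rfl fun s hs => if_congr (by rw [h1 s hs]) rfl rfl
  · by_cases h : B.Hits t (σ t) i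
    · rw [ind_pos h, one_mul, if_pos ⟨h.1, h.2.1, Nat.lt_succ_self _, h.2.2⟩]
    · rw [ind_neg h, zero_mul, if_neg fun h' => h ⟨h'.1, h'.2.1, h'.2.2.2⟩]

theorem realized_succ (i : ι × Fin K) (t : Fin n) (ω : Outcome n) :
    B.Realized i (t + 1) ω ↔ B.Realized i t ω ∨ (B.Hits t (ω.1 t) i ∧ ω.2 (ω.1 t) = true) := by
  constructor
  · rintro ⟨s, h1, h2, h3, h4, h5⟩
    rcases Nat.lt_succ_iff_lt_or_eq.mp h3 with h | h
    · exact Or.inl ⟨s, h1, h2, h, h4, h5⟩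
    · rw [Fin.ext h] at h1 h2 h4 h5
      exact Or.inr ⟨⟨h1, h2, h4⟩, h5⟩
  · rintro (⟨s, h1, h2, h3, h4, h5⟩ | ⟨⟨h1, h2, h3⟩, h4⟩)
    · exact ⟨s, h1, h2, h3.trans (Nat.lt_succ_self _), h4, h5⟩
    · exact ⟨t, h1, h2, Nat.lt_succ_self _, h3, h4⟩

/-- The density is a martingale: a member of mass q stays unrealized with probability exp(-q), which
exactly compensates the arrived mass a + q in the exponent. -/
theorem blockDensity_mean {Q a q p : ℝ} (h : (1 - p) * Real.exp q = 1) (R : Prop) (z : Bool) :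
    p * blockDensity Q (a + q) True z + (1 - p) * blockDensity Q (a + q) R z =
      blockDensity Q a R z := by
  have e : (1 - p) * Real.exp (a + q - Q) = Real.exp (a - Q) := by
    rw [show a + q - Q = q + (a - Q) by ring, Real.exp_add, ← mul_assoc, h, one_mul]
  unfold blockDensity
  by_cases hR : R
  · simp only [hR, if_true]; ring
  · simp only [hR, if_true, if_false]
    split_ifs
    · linarith
    · linarith

/-- The density after one more arrival. -/
noncomputable def nextDensity (B : Blocks I K ι) (Q : ι → ℝ) (ζ : ι × Fin K → Bool) (t : ℕ)
    (ω : Outcome n) (j : Fin n) (β : Bool) : ℝ :=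
  ∏ i : ι × Fin K, blockDensity (Q i.1) (B.mass i t ω.1 + ind (B.Hits t j i) * I.q j)
    (B.Realized i t ω ∨ (B.Hits t j i ∧ β = true)) (ζ i)

theorem density_succ (Q : ι → ℝ) (ζ : ι × Fin K → Bool) (t : Fin n) (ω : Outcome n) :
    B.density Q ζ (t + 1) ω = B.nextDensity Q ζ t ω (ω.1 t) (ω.2 (ω.1 t)) := by
  unfold density nextDensity
  refine Finset.prod_congr rfl fun i _ => ?_
  rw [mass_succ, propext (realized_succ i t ω)]

theorem nextDensity_of_cls_eq_none {Q : ι → ℝ} {ζ : ι × Fin K → Bool} {t : ℕ} {ω : Outcome n}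
    {j : Fin n} (hj : B.cls j = none) (β : Bool) :
    B.nextDensity Q ζ t ω j β = B.density Q ζ t ω := by
  refine Finset.prod_congr rfl fun i _ => ?_
  have : ¬ B.Hits t j i := fun h => by simp [Hits, hj] at h
  simp only [this, ind_false, zero_mul, add_zero, false_and, or_false]

theorem nextDensity_mean (Q : ι → ℝ) (ζ : ι × Fin K → Bool) (t : ℕ) (ω : Outcome n) (j : Fin n) :
    I.prob j * B.nextDensity Q ζ t ω j true + (1 - I.prob j) * B.nextDensity Q ζ t ω j false =
      B.density Q ζ t ω := by
  by_cases h : ∃ i, B.Hits t j i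
  · obtain ⟨i, hi⟩ := h
    have hother : ∀ β, ∀ i' ∈ Finset.univ.erase i,
        blockDensity (Q i'.1) (B.mass i' t ω.1 + ind (B.Hits t j i') * I.q j)
          (B.Realized i' t ω ∨ (B.Hits t j i' ∧ β = true)) (ζ i') =
        blockDensity (Q i'.1) (B.mass i' t ω.1) (B.Realized i' t ω) (ζ i') := fun β i' hi' => by
      have : ¬ B.Hits t j i' := fun h => Finset.ne_of_mem_erase hi' (h.unique hi)
      simp only [this, ind_false, zero_mul, add_zero, false_and, or_false]
    unfold nextDensity density
    rw [← Finset.mul_prod_erase _ _ (Finset.mem_univ i),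
      ← Finset.mul_prod_erase (Finset.univ : Finset (ι × Fin K)) _ (Finset.mem_univ i),
      ← Finset.mul_prod_erase (Finset.univ : Finset (ι × Fin K)) _ (Finset.mem_univ i),
      Finset.prod_congr rfl (hother true), Finset.prod_congr rfl (hother false)]
    have hp := I.exp_q (B.cls_prob j i.1 hi.2.2)
    have := blockDensity_mean (Q := Q i.1) (a := B.mass i t ω.1) hp (B.Realized i t ω) (ζ i)
    rw [ind_pos hi, one_mul]
    simp only [hi, and_true, or_true, Bool.false_eq_true, and_false, or_false]
    rw [← this]
    ring
  · have : ∀ β, B.nextDensity Q ζ t ω j β = B.density Q ζ t ω := fun β => by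
      refine Finset.prod_congr rfl fun i _ => ?_
      have : ¬ B.Hits t j i := fun h' => h ⟨i, h'⟩
      simp only [this, ind_false, zero_mul, add_zero, false_and, or_false]
    rw [this, this]; ring

/-- Passing to the next arrival under the nominal law. -/
theorem sum_density_succ_le (Q : ι → ℝ) (ζ : ι × Fin K → Bool) (t : Fin n)
    (H : Outcome n → Fin n → Bool → ℝ)
    (hH : ∀ ω ω', SamePast t ω ω' → ∀ j β, H ω j β = H ω' j β)
    (hH0 : ∀ ω j β, 0 ≤ H ω j β)
    (hcls : ∀ ω j, B.cls j ≠ none → H ω j true = H ω j false) :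
    ∑ ω, I.weight ω * (B.density Q ζ (t + 1) ω * ind (B.WithinMass Q (t + 1) ω.1) *
        H ω (ω.1 t) (ω.2 (ω.1 t))) ≤
      ∑ ω, I.weight ω * (B.density Q ζ t ω * ind (B.WithinMass Q t ω.1) *
        I.nextMean (remaining ω.1 t) (H ω)) := by
  let W : Outcome n → Fin n → Prop := fun ω j =>
    ∀ i : ι × Fin K, B.mass i t ω.1 + ind (B.Hits t j i) * I.q j ≤ Q i.1
  let F : Outcome n → Fin n → Bool → ℝ := fun ω j β =>
    B.nextDensity Q ζ t ω j β * ind (W ω j) * H ω j β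
  have hF : ∀ ω ω', SamePast t ω ω' → ∀ j β, F ω j β = F ω' j β := by
    intro ω ω' h j β
    have h1 : B.nextDensity Q ζ t ω j β = B.nextDensity Q ζ t ω' j β := by
      unfold nextDensity
      refine Finset.prod_congr rfl fun i _ => ?_
      rw [mass_congr h, propext (realized_congr h i)]
    have h2 : W ω j ↔ W ω' j := by
      refine forall_congr' fun i => ?_
      rw [mass_congr h]
    simp only [F]
    rw [h1, ind_congr h2, hH _ _ h]
  have h1 : ∀ ω, B.density Q ζ (t + 1) ω * ind (B.WithinMass Q (t + 1) ω.1) *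
      H ω (ω.1 t) (ω.2 (ω.1 t)) = F ω (ω.1 t) (ω.2 (ω.1 t)) := fun ω => by
    have : B.WithinMass Q (t + 1) ω.1 ↔ W ω (ω.1 t) := by
      refine forall_congr' fun i => ?_
      rw [mass_succ]
    simp only [F]
    rw [density_succ, ind_congr this]
  rw [Finset.sum_congr rfl fun ω _ => by rw [h1 ω], I.sum_weight_condition t F hF]
  refine Finset.sum_le_sum fun ω _ => mul_le_mul_of_nonneg_left ?_ (I.weight_nonneg ω)
  rw [Instance.nextMean, Instance.nextMean, ← mul_div_assoc, Finset.mul_sum]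
  refine div_le_div_of_nonneg_right (Finset.sum_le_sum fun j _ => ?_) (Nat.cast_nonneg _)
  -- Outside the classes the density does not change. For a class member `H` is blind to the
  -- realization, so only the mean of the two densities enters.
  have hmean : I.prob j * F ω j true + (1 - I.prob j) * F ω j false =
      B.density Q ζ t ω * ind (W ω j) *
        (I.prob j * H ω j true + (1 - I.prob j) * H ω j false) := by
    simp only [F]
    by_cases hj : B.cls j = none
    · rw [nextDensity_of_cls_eq_none hj, nextDensity_of_cls_eq_none hj]; ring
    · rw [← nextDensity_mean Q ζ t ω j, hcls ω j hj]; ring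
  rw [hmean]
  have hnn : 0 ≤ I.prob j * H ω j true + (1 - I.prob j) * H ω j false :=
    add_nonneg (mul_nonneg (I.prob_pos j).le (hH0 _ _ _))
      (mul_nonneg (by linarith [I.prob_le_one j]) (hH0 _ _ _))
  refine mul_le_mul_of_nonneg_right ?_ hnn
  -- Being within the nominal mass after the arrival implies it before. Paths that leave the range
  -- are dropped, which is an inequality because the density before the arrival is nonnegative.
  by_cases hW : W ω j
  · have hW' : B.WithinMass Q t ω.1 := fun i => by
      have := hW i
      have h2 := mul_nonneg (ind_nonneg (B.Hits t j i)) (I.q_nonneg j)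
      linarith
    rw [ind_pos hW, ind_pos hW']
  · rw [ind_neg hW, mul_zero]
    by_cases hW' : B.WithinMass Q t ω.1
    · rw [ind_pos hW', mul_one]; exact density_nonneg hW' ζ
    · rw [ind_neg hW', mul_zero]

/-- The outside option of a block that starts at time `t` has its nominal probability. -/
theorem sum_density_starting (Q : ι → ℝ) {t : ℕ} {i : ι × Fin K} (hi : B.bd i.1 i.2 = t)
    (ω : Outcome n) (h : (ι × Fin K → Bool) → ℝ)
    (hh : ∀ ζ β, h (Function.update ζ i β) = h ζ) :
    ∑ ζ, B.density Q ζ t ω * h ζ *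
      ((if ζ i = true then 1 else 0) - (1 - Real.exp (-Q i.1))) = 0 := by
  have hmass : B.mass i t ω.1 = 0 := by
    refine Finset.sum_eq_zero fun s _ => if_neg fun h => ?_
    omega
  have hreal : ¬ B.Realized i t ω := by
    rintro ⟨s, h1, h2, h3, -⟩
    omega
  have hd : ∀ ζ β, B.density Q (Function.update ζ i β) t ω =
      (if β = true then 1 - Real.exp (-Q i.1) else Real.exp (-Q i.1)) *
      ∏ i' ∈ Finset.univ.erase i,
        blockDensity (Q i'.1) (B.mass i' t ω.1) (B.Realized i' t ω) (ζ i') := fun ζ β => by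
    unfold density
    rw [← Finset.mul_prod_erase _ _ (Finset.mem_univ i)]
    congr 1
    · simp [blockDensity, hmass, hreal]
    · refine Finset.prod_congr rfl fun i' hi' => ?_
      rw [Function.update_of_ne (Finset.ne_of_mem_erase hi')]
  -- The two values of the bit `ζ i` are paired. Before the block starts the density factorizes,
  -- with the nominal probabilities of this bit as one factor, so each pair cancels.
  have h2 := sum_pi_bool_pair i (fun ζ => B.density Q ζ t ω * h ζ *
      ((if ζ i = true then 1 else 0) - (1 - Real.exp (-Q i.1))))
  rw [Finset.sum_eq_zero (s := Finset.univ) (f := fun b : ι × Fin K → Bool => _ + _)] at h2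
  · linarith
  · intro ζ _
    simp only [hd, hh, Function.update_self, if_true, Bool.false_eq_true, if_false]
    ring

end Blocks

end ProphetSecretary

/-! ### The expected reward under the nominal law -/

namespace ProphetSecretary

set_option linter.unusedSectionVars false

namespace Blocks

variable {n K : ℕ} {ι : Type} {I : Instance n} {B : Blocks I K ι} [Fintype ι] [DecidableEq ι]

/-- Nominal masses `Q` and payment rates `r` of the classes. -/
structure Nominal (B : Blocks I K ι) (Q r len : ι → ℝ) (D : ℝ) : Prop where
  mass_nonneg : ∀ v, 0 ≤ Q v
  rate_nonneg : ∀ v, 0 ≤ r v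
  len_nonneg : ∀ v, 0 ≤ len v
  prob_le : ∀ i : ι × Fin K, (i.2 : ℕ) + 1 < K →
    1 - Real.exp (-Q i.1) ≤ r i.1 * ((B.bd i.1 (i.2 + 1) : ℝ) - B.bd i.1 i.2)
  len_le : ∀ i : ι × Fin K, (B.bd i.1 (i.2 + 1) : ℝ) - B.bd i.1 i.2 ≤ len i.1
  pay_le : ∑ v, r v * len v * B.val v ≤ D

/-- The probability of the outside option of a block with nominal mass `Q`. -/
noncomputable def optionProb (Q : ι → ℝ) (v : ι) : ℝ := 1 - Real.exp (-Q v)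

theorem optionProb_nonneg {Q : ι → ℝ} (h : ∀ v, 0 ≤ Q v) (v : ι) : 0 ≤ optionProb Q v := by
  have : Real.exp (-Q v) ≤ 1 := Real.exp_le_one_iff.mpr (by linarith [h v])
  unfold optionProb; linarith

theorem option_nonneg (t : ℕ) (ζ : ι × Fin K → Bool) : 0 ≤ B.option t ζ :=
  Real.iSup_nonneg fun i => by split_ifs <;> [exact (B.val_pos _).le; exact le_rfl]

theorem frontPay_nonneg (t : ℕ) (ζ : ι × Fin K → Bool) (j : Fin n) (β : Bool) :
    0 ≤ B.frontPay t ζ j β := le_max_of_le_left (B.freeGain_nonneg j β)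

theorem Nominal.potential_nonneg {Q r len : ι → ℝ} {D : ℝ} (hN : B.Nominal Q r len D) (t : ℕ)
    (S : Finset (Fin n)) (ζ : ι × Fin K → Bool) : 0 ≤ B.potential r (optionProb Q) D t S ζ := by
  have hρ := optionProb_nonneg hN.mass_nonneg
  have h0 := B.contValue_nonneg (n - t) S
  have h1 := (debt_le hN.rate_nonneg hN.len_le hN.len_nonneg t h0).trans hN.pay_le
  have h2 := le_max_left (B.contValue (n - t) S) (B.held t ζ)
  have h3 : 0 ≤ ∑ i ∈ final (K := K), B.avail (optionProb Q) t ζ i * B.val i.1 :=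
    Finset.sum_nonneg fun i _ => mul_nonneg (avail_nonneg hρ _ _ _) (B.val_pos _).le
  have h4 : 0 ≤ ∑ i ∈ regular (K := K), B.avail (optionProb Q) t ζ i *
      chainCost (B.blockIndicator i) B.holdCost (n - t) S :=
    Finset.sum_nonneg fun i _ => mul_nonneg (avail_nonneg hρ _ _ _)
      (chainCost_nonneg (blockIndicator_nonneg i) holdCost_nonneg _ _)
  have h5 : 0 ≤ chainCost 1 (B.rateCost r) (n - t) S :=
    chainCost_nonneg (fun _ => zero_le_one) (rateCost_nonneg hN.rate_nonneg) _ _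
  unfold potential
  linarith

/-- The initial value of the potential. -/
noncomputable def startValue (B : Blocks I K ι) (Q r : ι → ℝ) (D : ℝ) : ℝ :=
  B.contValue n Finset.univ + D + ∑ i ∈ final (K := K), optionProb Q i.1 * B.val i.1 +
    ∑ i ∈ regular (K := K), optionProb Q i.1 *
      chainCost (B.blockIndicator i) B.holdCost n Finset.univ +
    chainCost 1 (B.rateCost r) n Finset.univ

theorem potential_zero (Q r : ι → ℝ) (D : ℝ) (ζ : ι × Fin K → Bool) :
    B.potential r (optionProb Q) D 0 Finset.univ ζ = B.startValue Q r D := by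
  have h1 : B.held 0 ζ = 0 :=
    le_antisymm (Real.iSup_le (fun i => by simp) le_rfl) (held_nonneg _ _)
  have h2 : B.debt r 0 (B.contValue (n - 0) Finset.univ) = 0 :=
    Finset.sum_eq_zero fun i _ => by simp [rest]
  rw [potential, h1, h2, max_eq_left (B.contValue_nonneg _ _)]
  simp [avail, startValue]

theorem nextMean_affine {S : Finset (Fin n)} (hS : S.Nonempty) (a b : ℝ)
    (F : Fin n → Bool → ℝ) :
    I.nextMean S (fun j β => a + b * F j β) = a + b * I.nextMean S F := by
  have hc : (S.card : ℝ) ≠ 0 := by exact_mod_cast hS.card_pos.ne'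
  rw [Instance.nextMean, Instance.nextMean, div_eq_iff hc, add_mul, mul_assoc, div_mul_cancel₀ _ hc,
    mul_comm a, ← nsmul_eq_mul, ← Finset.sum_const, Finset.mul_sum, ← Finset.sum_add_distrib]
  exact Finset.sum_congr rfl fun j _ => by ring

section Strategy

variable (B) (τ : Outcome n → Option (Fin n))

/-- The strategy does not look beyond the present arrival, except for the outside options of the
blocks that have begun. -/
def Adapted : Prop :=
  ∀ (t : Fin n) (ω ω' : Outcome n), SamePast (t + 1) ω ω' →
    (∀ i : ι × Fin K, B.bd i.1 i.2 ≤ t → B.zeta ω i = B.zeta ω' i) →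
    (τ ω = some t ↔ τ ω' = some t)

/-- The decision to stop at time `t` when the outside options are `ζ`. -/
def Stops (t : Fin n) (ω : Outcome n) (ζ : ι × Fin K → Bool) : Prop :=
  ∃ ω', SamePast (t + 1) ω ω' ∧ (∀ i : ι × Fin K, B.bd i.1 i.2 ≤ t → ζ i = B.zeta ω' i) ∧
    τ ω' = some t

/-- There is no stop before time `t`. -/
def Alive (t : ℕ) (ω : Outcome n) (ζ : ι × Fin K → Bool) : Prop :=
  ∀ s : Fin n, (s : ℕ) < t → ¬ B.Stops τ s ω ζ

/-- The reward that is collected before time `t`. -/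
noncomputable def collected (t : ℕ) (ω : Outcome n) (ζ : ι × Fin K → Bool) : ℝ :=
  ∑ s : Fin n, ind ((s : ℕ) < t ∧ B.Alive τ s ω ζ ∧ B.Stops τ s ω ζ) *
    B.frontPay s ζ (ω.1 s) (ω.2 (ω.1 s))

variable {B τ}

theorem stops_congr {t : Fin n} {ω ω' : Outcome n} (h : SamePast (t + 1) ω ω')
    (ζ : ι × Fin K → Bool) : B.Stops τ t ω ζ ↔ B.Stops τ t ω' ζ :=
  ⟨fun ⟨x, h1, h2, h3⟩ => ⟨x, h.symm.trans h1, h2, h3⟩,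
    fun ⟨x, h1, h2, h3⟩ => ⟨x, h.trans h1, h2, h3⟩⟩

theorem alive_congr {t : ℕ} {ω ω' : Outcome n} (h : SamePast t ω ω')
    (ζ : ι × Fin K → Bool) : B.Alive τ t ω ζ ↔ B.Alive τ t ω' ζ :=
  forall_congr' fun _ => imp_congr_right fun hs =>
    not_congr (stops_congr (h.mono (Nat.succ_le_of_lt hs)) ζ)

theorem collected_congr {t : ℕ} {ω ω' : Outcome n} (h : SamePast t ω ω')
    (ζ : ι × Fin K → Bool) : B.collected τ t ω ζ = B.collected τ t ω' ζ := by
  refine Finset.sum_congr rfl fun s _ => ?_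
  by_cases hs : (s : ℕ) < t
  · have h1 := alive_congr (B := B) (τ := τ) (h.mono hs.le) ζ
    have h2 := stops_congr (B := B) (τ := τ) (h.mono (Nat.succ_le_of_lt hs)) ζ
    obtain ⟨e1, e2⟩ := h s hs
    rw [propext h1, propext h2, e2, e1]
  · rw [ind_neg fun h => hs h.1, ind_neg fun h => hs h.1, zero_mul, zero_mul]

theorem collected_nonneg (t : ℕ) (ω : Outcome n) (ζ : ι × Fin K → Bool) :
    0 ≤ B.collected τ t ω ζ :=
  Finset.sum_nonneg fun _ _ => mul_nonneg (ind_nonneg _) (frontPay_nonneg _ _ _ _)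

theorem alive_update {t : ℕ} {i : ι × Fin K} (hi : B.bd i.1 i.2 = t) (ω : Outcome n)
    (ζ : ι × Fin K → Bool) (β : Bool) :
    B.Alive τ t ω (Function.update ζ i β) ↔ B.Alive τ t ω ζ := by
  refine forall_congr' fun _ => imp_congr_right fun hs => not_congr ?_
  refine exists_congr fun ω' => and_congr_right fun _ => and_congr_left fun _ => ?_
  refine forall_congr' fun i' => imp_congr_right fun h' => ?_
  rw [Function.update_of_ne]
  rintro rfl
  omega

theorem collected_succ (t : Fin n) (ω : Outcome n) (ζ : ι × Fin K → Bool) :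
    B.collected τ (t + 1) ω ζ = B.collected τ t ω ζ +
      ind (B.Alive τ t ω ζ ∧ B.Stops τ t ω ζ) * B.frontPay t ζ (ω.1 t) (ω.2 (ω.1 t)) := by
  unfold collected
  rw [← Finset.sum_erase_add _ _ (Finset.mem_univ t),
    ← Finset.sum_erase_add _ _ (Finset.mem_univ t),
    ind_neg (P := (t : ℕ) < t ∧ _) (fun h => lt_irrefl _ h.1), zero_mul, add_zero]
  congr 1
  · refine Finset.sum_congr rfl fun s hs => ?_
    have := Finset.ne_of_mem_erase hs
    rw [Fin.ne_iff_vne] at this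
    rw [ind_congr (show _ ↔ ((s : ℕ) < t ∧ B.Alive τ s ω ζ ∧ B.Stops τ s ω ζ) from
      and_congr_left' (by omega))]
  · rw [ind_congr (and_iff_right (Nat.lt_succ_self _))]

theorem alive_succ (t : Fin n) (ω : Outcome n) (ζ : ι × Fin K → Bool) :
    B.Alive τ (t + 1) ω ζ ↔ B.Alive τ t ω ζ ∧ ¬ B.Stops τ t ω ζ := by
  constructor
  · exact fun h => ⟨fun s hs => h s (hs.trans (Nat.lt_succ_self _)), h t (Nat.lt_succ_self _)⟩
  · rintro ⟨h, h'⟩ s hs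
    rcases Nat.lt_succ_iff_lt_or_eq.mp hs with h1 | h1
    · exact h s h1
    · rwa [Fin.ext h1]

/-- The expected value, under the nominal law, of the reward collected before time `t` and of the
potential at time `t`. -/
noncomputable def ledger (B : Blocks I K ι) (τ : Outcome n → Option (Fin n)) (Q r : ι → ℝ) (D : ℝ)
    (t : ℕ) : ℝ :=
  ∑ ζ, ∑ ω, I.weight ω * (B.density Q ζ t ω * ind (B.WithinMass Q t ω.1) *
    (B.collected τ t ω ζ + ind (B.Alive τ t ω ζ) *
      B.potential r (optionProb Q) D t (remaining ω.1 t) ζ))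

/-- The ledger of collected reward plus potential is a supermartingale under the nominal law: one
step of the potential inequality, followed by averaging over the bits of the starting blocks. -/
theorem Nominal.ledger_succ_le {Q r len : ι → ℝ} {D : ℝ} (hN : B.Nominal Q r len D) (t : Fin n) :
    B.ledger τ Q r D (t + 1) ≤ B.ledger τ Q r D t := by
  have hn := t.2
  have hcard : ∀ ω : Outcome n, (remaining ω.1 t).card = (n - 1 - t) + 1 := fun ω => by
    rw [card_remaining]; omega
  let J : (ι × Fin K → Bool) → Outcome n → ℝ := fun ζ ω => ∑ i ∈ B.starting t,
    ((if ζ i = true then 1 else 0) - optionProb Q i.1) *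
      B.jump (n - 1 - t + 1) (remaining ω.1 t) i
  have hstep : ∀ ζ, ∑ ω, I.weight ω * (B.density Q ζ (t + 1) ω *
      ind (B.WithinMass Q (t + 1) ω.1) * (B.collected τ (t + 1) ω ζ +
        ind (B.Alive τ (t + 1) ω ζ) *
          B.potential r (optionProb Q) D (t + 1) (remaining ω.1 (t + 1)) ζ)) ≤
      ∑ ω, I.weight ω * (B.density Q ζ t ω * ind (B.WithinMass Q t ω.1) *
        (B.collected τ t ω ζ + ind (B.Alive τ t ω ζ) *
          (B.potential r (optionProb Q) D t (remaining ω.1 t) ζ + J ζ ω))) := by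
    intro ζ
    let H : Outcome n → Fin n → Bool → ℝ := fun ω j β => B.collected τ t ω ζ +
      ind (B.Alive τ t ω ζ) * max (B.frontPay t ζ j β)
        (B.potential r (optionProb Q) D (t + 1) ((remaining ω.1 t).erase j) ζ)
    have h1 := sum_density_succ_le (B := B) Q ζ t H
      (fun ω ω' h j β => by
        simp only [H]
        rw [collected_congr h, ind_congr (alive_congr h ζ), h.remaining_eq])
      (fun ω j β => add_nonneg (collected_nonneg _ _ _) (mul_nonneg (ind_nonneg _)
        (le_max_of_le_left (frontPay_nonneg _ _ _ _))))
      (fun ω j hj => by simp only [H, frontPay, freeGain, hj, false_and, if_false])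
    refine le_trans (Finset.sum_le_sum fun ω _ => mul_le_mul_of_nonneg_left ?_ (I.weight_nonneg ω))
      (h1.trans (Finset.sum_le_sum fun ω _ => mul_le_mul_of_nonneg_left ?_ (I.weight_nonneg ω)))
    · by_cases hW : B.WithinMass Q (t + 1) ω.1
      · refine mul_le_mul_of_nonneg_left ?_ (mul_nonneg (density_nonneg hW ζ) (ind_nonneg _))
        simp only [H]
        rw [collected_succ, add_assoc, remaining_succ]
        refine add_le_add_right ?_ _
        by_cases hA : B.Alive τ t ω ζ
        · by_cases hS : B.Stops τ t ω ζ
          · rw [ind_pos ⟨hA, hS⟩, ind_pos hA, ind_neg fun h => ((alive_succ t ω ζ).mp h).2 hS]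
            simp
          · rw [ind_neg fun h => hS h.2, ind_pos hA, ind_pos ((alive_succ t ω ζ).mpr ⟨hA, hS⟩)]
            simp
        · rw [ind_neg fun h => hA h.1, ind_neg hA,
            ind_neg fun h => hA ((alive_succ t ω ζ).mp h).1]
          simp
      · rw [ind_neg hW]; simp
    · by_cases hW : B.WithinMass Q t ω.1
      · refine mul_le_mul_of_nonneg_left ?_ (mul_nonneg (density_nonneg hW ζ) (ind_nonneg _))
        simp only [H]
        rw [nextMean_affine (Finset.card_pos.mp (by rw [hcard]; omega))]
        refine add_le_add_right (mul_le_mul_of_nonneg_left ?_ (ind_nonneg _)) _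
        exact nextMean_potential_le hN.rate_nonneg (optionProb_nonneg hN.mass_nonneg) hN.prob_le
          hN.len_le hN.len_nonneg hN.pay_le (by omega) (hcard ω) ζ
      · rw [ind_neg hW]; simp
  -- Whether the play has stopped before t, and the size of a jump, do not depend on the bits of
  -- blocks starting at t. The centred differences therefore average to zero.
  have hJ : ∑ ζ, ∑ ω, I.weight ω * (B.density Q ζ t ω * ind (B.WithinMass Q t ω.1) *
      (ind (B.Alive τ t ω ζ) * J ζ ω)) = 0 := by
    rw [Finset.sum_comm]
    refine Finset.sum_eq_zero fun ω _ => ?_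
    have : ∀ ζ, I.weight ω * (B.density Q ζ t ω * ind (B.WithinMass Q t ω.1) *
        (ind (B.Alive τ t ω ζ) * J ζ ω)) = ∑ i ∈ B.starting t,
        (I.weight ω * ind (B.WithinMass Q t ω.1) * B.jump (n - 1 - t + 1) (remaining ω.1 t) i) *
        (B.density Q ζ t ω * ind (B.Alive τ t ω ζ) *
          ((if ζ i = true then 1 else 0) - (1 - Real.exp (-Q i.1)))) := fun ζ => by
      simp only [J, Finset.mul_sum, optionProb]
      exact Finset.sum_congr rfl fun i _ => by ring
    rw [Finset.sum_congr rfl fun ζ _ => this ζ, Finset.sum_comm]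
    refine Finset.sum_eq_zero fun i hi => ?_
    have hi : B.bd i.1 i.2 = t := by simpa [starting] using hi
    rw [← Finset.mul_sum, sum_density_starting Q hi ω (fun ζ => ind (B.Alive τ t ω ζ))
      (fun ζ β => ind_congr (alive_update hi ω ζ β)), mul_zero]
  refine (Finset.sum_le_sum fun ζ _ => hstep ζ).trans (le_of_eq ?_)
  refine Eq.trans ?_ ((congrArg (B.ledger τ Q r D t + ·) hJ).trans (add_zero _))
  rw [ledger, ← Finset.sum_add_distrib]
  refine Finset.sum_congr rfl fun ζ _ => ?_
  rw [← Finset.sum_add_distrib]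
  exact Finset.sum_congr rfl fun ω _ => by ring

theorem Nominal.ledger_zero {Q r len : ι → ℝ} {D : ℝ} (hN : B.Nominal Q r len D) :
    B.ledger τ Q r D 0 = B.startValue Q r D := by
  have hm : ∀ (ω : Outcome n) i, B.mass i 0 ω.1 = 0 := fun ω i =>
    Finset.sum_eq_zero fun s _ => if_neg fun h => Nat.not_lt_zero _ h.2.2.1
  have h1 : ∀ ζ ω, I.weight ω * (B.density Q ζ 0 ω * ind (B.WithinMass Q 0 ω.1) *
      (B.collected τ 0 ω ζ + ind (B.Alive τ 0 ω ζ) *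
        B.potential r (optionProb Q) D 0 (remaining ω.1 0) ζ)) =
      I.weight ω * (bitWeight (fun i : ι × Fin K => optionProb Q i.1) ζ *
        B.startValue Q r D) := fun ζ ω => by
    have h2 : B.density Q ζ 0 ω = bitWeight (fun i : ι × Fin K => optionProb Q i.1) ζ := by
      unfold density bitWeight
      refine Finset.prod_congr rfl fun i _ => ?_
      rw [hm, blockDensity, if_neg fun ⟨s, _, _, h, _⟩ => Nat.not_lt_zero _ h, zero_sub]
      simp only [optionProb, sub_sub_cancel]
    have h3 : B.WithinMass Q 0 ω.1 := fun i => by rw [hm]; exact hN.mass_nonneg _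
    have h4 : B.collected τ 0 ω ζ = 0 := Finset.sum_eq_zero fun s _ => by
      rw [ind_neg fun h => Nat.not_lt_zero _ h.1, zero_mul]
    have h5 : B.Alive τ 0 ω ζ := fun s hs => absurd hs (Nat.not_lt_zero _)
    rw [h2, ind_pos h3, h4, ind_pos h5, remaining_zero, potential_zero]
    ring
  rw [ledger, Finset.sum_congr rfl fun ζ _ => Finset.sum_congr rfl fun ω _ => h1 ζ ω,
    Finset.sum_congr rfl fun ζ _ => (Finset.sum_mul _ _ _).symm, I.sum_weight]
  simp only [one_mul]
  rw [← Finset.sum_mul, sum_bitWeight, one_mul]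

/-- The reward of an adapted strategy in the frontloaded game is bounded by the initial potential,
up to the density of the typical arrival orders. -/
theorem Nominal.sum_frontPay_le {Q r len : ι → ℝ} {D : ℝ} (hN : B.Nominal Q r len D)
    (hτ : B.Adapted τ) {Typ : Equiv.Perm (Fin n) → Prop} {κ : ℝ}
    (h1 : ∀ σ, Typ σ → B.WithinMass Q n σ)
    (h2 : ∀ σ, Typ σ → ∑ i : ι × Fin K, (Q i.1 - B.mass i n σ) ≤ κ) :
    ∑ ω, I.weight ω * (ind (Typ ω.1) * (τ ω).elim 0
      fun t => B.frontPay t (B.zeta ω) (ω.1 t) (ω.2 (ω.1 t))) ≤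
      Real.exp κ * B.startValue Q r D := by
  have hle : ∀ t : ℕ, t ≤ n → B.ledger τ Q r D t ≤ B.startValue Q r D := by
    intro t
    induction t with
    | zero => exact fun _ => hN.ledger_zero.le
    | succ t ih => exact fun ht => (hN.ledger_succ_le ⟨t, ht⟩).trans (ih (Nat.le_of_succ_le ht))
  refine le_trans ?_ (mul_le_mul_of_nonneg_left (hle n le_rfl) (Real.exp_pos κ).le)
  rw [ledger, Finset.sum_comm, Finset.mul_sum]
  refine Finset.sum_le_sum fun ω _ => ?_
  rw [← Finset.mul_sum, mul_left_comm (Real.exp κ)]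
  refine mul_le_mul_of_nonneg_left ?_ (I.weight_nonneg ω)
  have hterm : ∀ ζ, 0 ≤ B.density Q ζ n ω * ind (B.WithinMass Q n ω.1) *
      (B.collected τ n ω ζ + ind (B.Alive τ n ω ζ) *
        B.potential r (optionProb Q) D n (remaining ω.1 n) ζ) := fun ζ => by
    by_cases hW : B.WithinMass Q n ω.1
    · exact mul_nonneg (mul_nonneg (density_nonneg hW ζ) (ind_nonneg _))
        (add_nonneg (collected_nonneg _ _ _) (mul_nonneg (ind_nonneg _)
          (hN.potential_nonneg _ _ _)))
    · rw [ind_neg hW]; simp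
  by_cases hT : Typ ω.1
  swap
  · rw [ind_neg hT, zero_mul]
    exact mul_nonneg (Real.exp_pos κ).le (Finset.sum_nonneg fun ζ _ => hterm ζ)
  -- Of all bit patterns only the true one of the outcome is kept; the others contribute nonnegative
  -- terms.
  refine le_trans ?_ (mul_le_mul_of_nonneg_left (Finset.single_le_sum (fun ζ _ => hterm ζ)
    (Finset.mem_univ (B.zeta ω))) (Real.exp_pos κ).le)
  have hW := h1 _ hT
  rw [ind_pos hT, ind_pos hW, one_mul, mul_one, ← mul_assoc]
  -- At the true pattern a realized block has factor 1 and an unrealized one exp(mass - Q). The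
  -- product is at least exp(-κ).
  have hd : 1 ≤ Real.exp κ * B.density Q (B.zeta ω) n ω := by
    have e1 : Real.exp (-κ) ≤ B.density Q (B.zeta ω) n ω := by
      have e2 : Real.exp (-κ) ≤ ∏ i : ι × Fin K, Real.exp (B.mass i n ω.1 - Q i.1) := by
        rw [← Real.exp_sum]
        refine Real.exp_le_exp.mpr ?_
        have := h2 _ hT
        have e3 : ∑ i : ι × Fin K, (B.mass i n ω.1 - Q i.1) =
            - ∑ i : ι × Fin K, (Q i.1 - B.mass i n ω.1) := by
          rw [← Finset.sum_neg_distrib]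
          exact Finset.sum_congr rfl fun i _ => by ring
        linarith
      refine e2.trans (Finset.prod_le_prod (fun i _ => (Real.exp_pos _).le) fun i _ => ?_)
      unfold blockDensity zeta
      by_cases hR : B.Realized i n ω
      · simp only [hR, if_true, decide_true]
        exact Real.exp_le_one_iff.mpr (by linarith [hW i])
      · simp [hR]
    calc (1 : ℝ) = Real.exp κ * Real.exp (-κ) := by rw [← Real.exp_add]; simp
      _ ≤ _ := mul_le_mul_of_nonneg_left e1 (Real.exp_pos κ).le
  have hcol : (τ ω).elim 0 (fun t => B.frontPay t (B.zeta ω) (ω.1 t) (ω.2 (ω.1 t))) ≤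
      B.collected τ n ω (B.zeta ω) := by
    rcases h : τ ω with _ | t
    · exact collected_nonneg _ _ _
    -- At the true pattern the witness in `Stops` sees the same as ω, so by adaptedness it decides
    -- as τ does on ω.
    · have hS : ∀ s, B.Stops τ s ω (B.zeta ω) → τ ω = some s := by
        rintro s ⟨ω', e1, e2, e3⟩
        exact (hτ s ω ω' e1 e2).mpr e3
      have hA : B.Alive τ t ω (B.zeta ω) := fun s hs hs' => by
        have := hS s hs'
        rw [h] at this
        rw [Option.some.inj this] at hs
        exact lt_irrefl _ hs
      have := Finset.single_le_sum (f := fun s : Fin n => ind ((s : ℕ) < n ∧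
        B.Alive τ s ω (B.zeta ω) ∧ B.Stops τ s ω (B.zeta ω)) *
          B.frontPay s (B.zeta ω) (ω.1 s) (ω.2 (ω.1 s)))
        (fun _ _ => mul_nonneg (ind_nonneg _) (frontPay_nonneg _ _ _ _)) (Finset.mem_univ t)
      rw [ind_pos ⟨t.2, hA, ω, fun _ _ => ⟨rfl, rfl⟩, fun _ _ => rfl, h⟩, one_mul] at this
      exact this
  have hpos : 0 ≤ ind (B.Alive τ n ω (B.zeta ω)) *
      B.potential r (optionProb Q) D n (remaining ω.1 n) (B.zeta ω) :=
    mul_nonneg (ind_nonneg _) (hN.potential_nonneg _ _ _)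
  have h0 := collected_nonneg (B := B) (τ := τ) n ω (B.zeta ω)
  nlinarith

end Strategy

end Blocks

end ProphetSecretary

/-! ### The game without frontloading: the dynamic program is optimal and attained -/

namespace ProphetSecretary

set_option linter.unusedSectionVars false

section FirstTime

variable {n : ℕ} (P : Outcome n → Fin n → Prop)

open scoped Classical in
/-- Stop at the first time at which `P` holds. -/
noncomputable def firstTime (ω : Outcome n) : Option (Fin n) :=
  if h : ∃ t, P ω t ∧ ∀ s < t, ¬ P ω s then some h.choose else none

variable {P}

theorem firstTime_eq_some_iff {ω : Outcome n} {t : Fin n} :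
    firstTime P ω = some t ↔ P ω t ∧ ∀ s < t, ¬ P ω s := by
  unfold firstTime
  constructor
  · intro h
    split_ifs at h with h'
    rw [← Option.some.inj h]
    exact h'.choose_spec
  · intro h
    have h' : ∃ t, P ω t ∧ ∀ s < t, ¬ P ω s := ⟨t, h⟩
    rw [dif_pos h']
    refine congrArg some ?_
    obtain ⟨h1, h2⟩ := h'.choose_spec
    rcases lt_trichotomy h'.choose t with h3 | h3 | h3
    · exact absurd h1 (h.2 _ h3)
    · exact h3
    · exact absurd h.1 (h2 _ h3)

theorem exists_firstTime {ω : Outcome n} {t : Fin n} (h : P ω t) :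
    ∃ s ≤ t, firstTime P ω = some s := by
  induction t using WellFoundedLT.induction with
  | ind t ih =>
    by_cases h' : ∃ s < t, P ω s
    · obtain ⟨s, hs, hP⟩ := h'
      obtain ⟨u, hu, hf⟩ := ih s hs hP
      exact ⟨u, hu.trans hs.le, hf⟩
    · exact ⟨t, le_rfl, firstTime_eq_some_iff.mpr ⟨h, fun s hs hP => h' ⟨s, hs, hP⟩⟩⟩

theorem firstTime_congr {t : Fin n} {ω ω' : Outcome n} (h : ∀ s ≤ t, P ω s ↔ P ω' s) :
    firstTime P ω = some t ↔ firstTime P ω' = some t := by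
  rw [firstTime_eq_some_iff, firstTime_eq_some_iff, h t le_rfl]
  exact and_congr_right fun _ => forall_congr' fun s => imp_congr_right fun hs =>
    not_congr (h s hs.le)

end FirstTime

namespace Blocks

variable {n K : ℕ} {ι : Type} {I : Instance n} (B : Blocks I K ι)

/-- The value obtained at time `t` in the game without frontloading. -/
noncomputable def arrival (ω : Outcome n) (t : Fin n) : ℝ :=
  if ω.2 (ω.1 t) = true then B.gain t (ω.1 t) else 0

theorem arrival_nonneg (ω : Outcome n) (t : Fin n) : 0 ≤ B.arrival ω t := by
  unfold arrival
  split_ifs <;> [exact B.gain_nonneg _ _; exact le_rfl]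

variable (τ : Outcome n → Option (Fin n))

/-- The reward that is collected before time `t` without frontloading. -/
noncomputable def credit (t : ℕ) (ω : Outcome n) : ℝ :=
  ∑ s : Fin n, ind ((s : ℕ) < t ∧ τ ω = some s) * B.arrival ω s

/-- There is no stop before time `t`. -/
def Running (τ : Outcome n → Option (Fin n)) (t : ℕ) (ω : Outcome n) : Prop :=
  ∀ s : Fin n, (s : ℕ) < t → τ ω ≠ some s

/-- The expected value of the collected reward and of the continuation value at time `t`. -/
noncomputable def account (t : ℕ) : ℝ :=
  ∑ ω, I.weight ω * (B.credit τ t ω +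
    ind (Running τ t ω) * B.contValue (n - t) (remaining ω.1 t))

/-- Stopping decisions depend on past arrivals only. -/
def NonAnticipating (τ : Outcome n → Option (Fin n)) : Prop :=
  ∀ (t : Fin n) (ω ω' : Outcome n), SamePast (t + 1) ω ω' → (τ ω = some t ↔ τ ω' = some t)

variable {B τ}

theorem arrival_congr {t : Fin n} {ω ω' : Outcome n} (h : SamePast (t + 1) ω ω') :
    B.arrival ω t = B.arrival ω' t := by
  obtain ⟨h1, h2⟩ := h t (Nat.lt_succ_self _)
  unfold arrival
  rw [h2, h1]

theorem NonAnticipating.running_congr (hτ : NonAnticipating τ) {t : ℕ} {ω ω' : Outcome n}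
    (h : SamePast t ω ω') : Running τ t ω ↔ Running τ t ω' :=
  forall_congr' fun s => imp_congr_right fun hs =>
    not_congr (hτ s ω ω' (h.mono (Nat.succ_le_of_lt hs)))

theorem NonAnticipating.credit_congr (hτ : NonAnticipating τ) {t : ℕ} {ω ω' : Outcome n}
    (h : SamePast t ω ω') : B.credit τ t ω = B.credit τ t ω' := by
  refine Finset.sum_congr rfl fun s _ => ?_
  by_cases hs : (s : ℕ) < t
  · have h1 := h.mono (Nat.succ_le_of_lt hs)
    rw [arrival_congr h1, propext (hτ s ω ω' h1)]
  · rw [ind_neg fun h => hs h.1, ind_neg fun h => hs h.1, zero_mul, zero_mul]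

theorem credit_succ (t : Fin n) (ω : Outcome n) :
    B.credit τ (t + 1) ω = B.credit τ t ω + ind (τ ω = some t) * B.arrival ω t := by
  unfold credit
  rw [← Finset.sum_erase_add _ _ (Finset.mem_univ t),
    ← Finset.sum_erase_add _ _ (Finset.mem_univ t),
    ind_neg (P := (t : ℕ) < t ∧ _) (fun h => lt_irrefl _ h.1), zero_mul, add_zero]
  congr 1
  · refine Finset.sum_congr rfl fun s hs => ?_
    have := Finset.ne_of_mem_erase hs
    rw [Fin.ne_iff_vne] at this
    rw [ind_congr (show _ ↔ ((s : ℕ) < t ∧ τ ω = some s) from and_congr_left' (by omega))]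
  · rw [ind_congr (and_iff_right (Nat.lt_succ_self _))]

theorem running_succ (t : Fin n) (ω : Outcome n) :
    Running τ (t + 1) ω ↔ Running τ t ω ∧ τ ω ≠ some t := by
  constructor
  · exact fun h => ⟨fun s hs => h s (hs.trans (Nat.lt_succ_self _)), h t (Nat.lt_succ_self _)⟩
  · rintro ⟨h, h'⟩ s hs
    rcases Nat.lt_succ_iff_lt_or_eq.mp hs with h1 | h1
    · exact h s h1
    · rwa [Fin.ext h1]

theorem running_of_eq_some {t : Fin n} {ω : Outcome n} (h : τ ω = some t) : Running τ t ω :=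
  fun s hs h' => by
    rw [h] at h'
    rw [Option.some.inj h'] at hs
    exact lt_irrefl _ hs

/-- Bellman's equation in expectation: the continuation value at t is the conditional mean of the
better of taking the arrival and going on. -/
theorem account_eq (hτ : NonAnticipating τ) (t : Fin n) :
    B.account τ t = ∑ ω, I.weight ω * (B.credit τ t ω + ind (Running τ t ω) *
      max (B.arrival ω t) (B.contValue (n - (t + 1)) (remaining ω.1 (t + 1)))) := by
  have hn := t.2
  let H : Outcome n → Fin n → Bool → ℝ := fun ω j β => B.credit τ t ω + ind (Running τ t ω) *
    max (if β = true then B.gain t j else 0) (B.contValue (n - (t + 1)) ((remaining ω.1 t).erase j))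
  have h1 := I.sum_weight_condition t H fun ω ω' h j β => by
    simp only [H]
    rw [hτ.credit_congr h, ind_congr (hτ.running_congr h), h.remaining_eq]
  simp only [H] at h1
  refine Eq.trans ?_ (h1.symm.trans (Finset.sum_congr rfl fun ω _ => by
    rw [remaining_succ, arrival]))
  refine Finset.sum_congr rfl fun ω _ => ?_
  have hcard : (remaining ω.1 t).card = (n - 1 - t) + 1 := by rw [card_remaining]; omega
  rw [nextMean_affine (Finset.card_pos.mp (by rw [hcard]; omega))]
  congr 3
  have e1 : n - (t : ℕ) = (n - (t + 1)) + 1 := by omega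
  have e2 : n - 1 - (n - ((t : ℕ) + 1)) = t := by omega
  rw [e1, contValue, stopValue, Instance.nextMean]
  congr 1
  refine Finset.sum_congr rfl fun j _ => ?_
  rw [e2]
  simp only [if_true, Bool.false_eq_true, if_false]
  rw [max_eq_right (B.contValue_nonneg _ _)]
  rfl

theorem account_zero : B.account τ 0 = B.contValue n Finset.univ := by
  have : ∀ ω, I.weight ω * (B.credit τ 0 ω + ind (Running τ 0 ω) *
      B.contValue (n - 0) (remaining ω.1 0)) = I.weight ω * B.contValue n Finset.univ := fun ω => by
    rw [remaining_zero, ind_pos (P := Running τ 0 ω) fun s hs => absurd hs (Nat.not_lt_zero _), credit,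
      Finset.sum_eq_zero fun s _ => by rw [ind_neg fun h => Nat.not_lt_zero _ h.1, zero_mul]]
    simp
  rw [account, Finset.sum_congr rfl fun ω _ => this ω, ← Finset.sum_mul, I.sum_weight, one_mul]

theorem account_last : B.account τ n = ∑ ω, I.weight ω * (τ ω).elim 0 (B.arrival ω) := by
  refine Finset.sum_congr rfl fun ω _ => ?_
  rw [Nat.sub_self, show B.contValue 0 (remaining ω.1 n) = 0 from rfl, mul_zero, add_zero, credit]
  congr 1
  rcases h : τ ω with _ | t
  · exact Finset.sum_eq_zero fun s _ => by rw [ind_neg (by simp), zero_mul]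
  · rw [Finset.sum_eq_single t]
    · rw [ind_pos ⟨t.2, rfl⟩, one_mul]; rfl
    · intro s _ hs
      rw [ind_neg fun h' => hs (Option.some.inj h'.2).symm, zero_mul]
    · simp

/-- No strategy beats the continuation value at the start. -/
theorem sum_arrival_le (hτ : NonAnticipating τ) :
    ∑ ω, I.weight ω * (τ ω).elim 0 (B.arrival ω) ≤ B.contValue n Finset.univ := by
  have hle : ∀ t : ℕ, t ≤ n → B.account τ t ≤ B.contValue n Finset.univ := by
    intro t
    induction t with
    | zero => exact fun _ => account_zero.le
    | succ t ih =>
      intro ht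
      refine le_trans ?_ (ih (Nat.le_of_succ_le ht))
      rw [account_eq hτ ⟨t, ht⟩]
      refine Finset.sum_le_sum fun ω _ => mul_le_mul_of_nonneg_left ?_ (I.weight_nonneg ω)
      have e1 := credit_succ (B := B) (τ := τ) ⟨t, ht⟩ ω
      have e2 := running_succ (τ := τ) ⟨t, ht⟩ ω
      simp only at e1 e2 ⊢
      rw [e1, ind_congr e2]
      by_cases h : τ ω = some ⟨t, ht⟩
      · have hr : Running τ t ω := running_of_eq_some h
        rw [ind_pos h, ind_neg fun h' => h'.2 h, ind_pos hr, zero_mul, add_zero, one_mul, one_mul]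
        exact add_le_add_right (le_max_left _ _) _
      · rw [ind_neg h, zero_mul, add_zero, ind_congr (and_iff_left h)]
        exact add_le_add_right (mul_le_mul_of_nonneg_left (le_max_right _ _) (ind_nonneg _)) _
  rw [← account_last]
  exact hle n le_rfl

variable (B)

/-- Stop as soon as the arrival is worth at least the continuation value. -/
noncomputable def threshold : Outcome n → Option (Fin n) :=
  firstTime fun ω t => B.contValue (n - (t + 1)) (remaining ω.1 (t + 1)) ≤ B.arrival ω t

theorem threshold_nonAnticipating : NonAnticipating B.threshold := fun t ω ω' h =>
  firstTime_congr fun s hs => by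
    have := h.mono (Nat.succ_le_succ (Fin.le_def.mp hs))
    rw [arrival_congr this, this.remaining_eq]

theorem sum_arrival_threshold :
    ∑ ω, I.weight ω * (B.threshold ω).elim 0 (B.arrival ω) = B.contValue n Finset.univ := by
  have hle : ∀ t : ℕ, t ≤ n → B.account B.threshold t = B.contValue n Finset.univ := by
    intro t
    induction t with
    | zero => exact fun _ => account_zero
    | succ t ih =>
      intro ht
      refine Eq.trans ?_ (ih (Nat.le_of_succ_le ht))
      rw [account_eq B.threshold_nonAnticipating ⟨t, ht⟩]
      refine Finset.sum_congr rfl fun ω _ => ?_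
      congr 1
      have e1 := credit_succ (B := B) (τ := B.threshold) ⟨t, ht⟩ ω
      have e2 := running_succ (τ := B.threshold) ⟨t, ht⟩ ω
      simp only at e1 e2 ⊢
      rw [e1, ind_congr e2]
      by_cases h : B.threshold ω = some ⟨t, ht⟩
      · have hr : Running B.threshold t ω := running_of_eq_some h
        rw [ind_pos h, ind_neg fun h' => h'.2 h, ind_pos hr, zero_mul, add_zero, one_mul, one_mul,
          max_eq_left (firstTime_eq_some_iff.mp h).1]
      · rw [ind_neg h, zero_mul, add_zero, ind_congr (and_iff_left h)]
        by_cases hr : Running B.threshold t ω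
        · rw [max_eq_right]
          by_contra hlt
          -- If the arrival beat the continuation value, the threshold rule would have stopped at t
          -- or earlier.
          obtain ⟨s, hs, hf⟩ := exists_firstTime (P := fun ω t =>
            B.contValue (n - (t + 1)) (remaining ω.1 (t + 1)) ≤ B.arrival ω t)
            (ω := ω) (t := ⟨t, ht⟩) (le_of_lt (not_le.mp hlt))
          rcases hs.lt_or_eq with h1 | h1
          · exact hr s h1 hf
          · exact h (h1 ▸ hf)
        · rw [ind_neg hr, zero_mul, zero_mul]
  rw [← account_last]
  exact hle n le_rfl

/-- The value of the game is at least that of waiting for one of the variables `J` at a time when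
it is worth `u`. -/
theorem mul_sum_ind_le (J : Finset (Fin n)) (u : ℝ) :
    u * ∑ ω, I.weight ω * ind (∃ t : Fin n, ω.1 t ∈ J ∧ ω.2 (ω.1 t) = true ∧
      B.gain t (ω.1 t) = u) ≤ B.contValue n Finset.univ := by
  let P : Outcome n → Fin n → Prop := fun ω t =>
    ω.1 t ∈ J ∧ ω.2 (ω.1 t) = true ∧ B.gain t (ω.1 t) = u
  have hτ : NonAnticipating (firstTime P) := fun t ω ω' h =>
    firstTime_congr fun s hs => by
      obtain ⟨h1, h2⟩ := h s (Nat.lt_succ_of_le (Fin.le_def.mp hs))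
      simp only [P]
      rw [h2, h1]
  refine le_trans ?_ (sum_arrival_le hτ)
  rw [Finset.mul_sum]
  refine Finset.sum_le_sum fun ω _ => ?_
  rw [mul_left_comm]
  refine mul_le_mul_of_nonneg_left ?_ (I.weight_nonneg ω)
  by_cases h : ∃ t, P ω t
  · obtain ⟨t, ht⟩ := h
    obtain ⟨s, -, hs⟩ := exists_firstTime ht
    rw [ind_pos ⟨t, ht⟩, mul_one, hs]
    obtain ⟨-, h1, h2⟩ := (firstTime_eq_some_iff.mp hs).1
    simp [arrival, h1, h2]
  · rw [ind_neg h, mul_zero]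
    rcases firstTime P ω with _ | t
    · exact le_rfl
    · exact B.arrival_nonneg _ _

end Blocks

end ProphetSecretary

namespace ProphetSecretary

/-! ### Concentration for random arrival orders -/

section Concentration

variable {n : ℕ}

open Finset in
/-- The arrival times of different variables are negatively correlated. -/
theorem sum_perm_prod_le (B T : Finset (Fin n)) {c : Fin n → ℝ} (h1 : ∀ i, -1 ≤ c i)
    (hc : (∀ i, 0 ≤ c i) ∨ ∀ i, c i ≤ 0) :
    ∑ σ : Equiv.Perm (Fin n), ∏ i ∈ T, (1 + c i * ind (σ.symm i ∈ B)) ≤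
      n.factorial * ∏ i ∈ T, (1 + c i * (B.card / n)) := by
  have hβ1 : (B.card : ℝ) / n ≤ 1 := by
    refine div_le_one_of_le₀ ?_ (Nat.cast_nonneg _)
    exact_mod_cast (card_le_univ B).trans (Fintype.card_fin n).le
  have hβ0 : 0 ≤ (B.card : ℝ) / n := div_nonneg (Nat.cast_nonneg _) (Nat.cast_nonneg _)
  have hfac : ∀ i x, 0 ≤ x → x ≤ 1 → 0 ≤ 1 + c i * x := fun i x h0 h => by nlinarith [h1 i]
  induction T using Finset.induction_on with
  | empty => simp [Fintype.card_perm]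
  | insert j T hj ih =>
    set X : Equiv.Perm (Fin n) → ℝ := fun σ => ∏ i ∈ T, (1 + c i * ind (σ.symm i ∈ B)) with hX
    set F : Fin n → ℝ := fun t => ∑ σ : Equiv.Perm (Fin n), if σ t = j then X σ else 0 with hF
    have hn : (0 : ℝ) < n := by
      have := j.2
      exact_mod_cast (by omega : 0 < n)
    have hFsum : ∀ A : Finset (Fin n), ∑ t ∈ A, F t = ∑ σ, ind (σ.symm j ∈ A) * X σ := fun A => by
      simp only [hF]
      rw [sum_comm]
      refine sum_congr rfl fun σ _ => ?_
      by_cases h : σ.symm j ∈ A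
      · rw [ind_pos h, one_mul, sum_eq_single (σ.symm j)]
        · simp
        · intro t _ ht
          exact if_neg fun h' => ht (by rw [← h', Equiv.symm_apply_apply])
        · exact fun h' => absurd h h'
      · rw [ind_neg h, zero_mul]
        refine sum_eq_zero fun t ht => if_neg fun h' => h ?_
        rwa [← h', Equiv.symm_apply_apply]
    -- Moving `j` from a time t in `B` to a time s outside it can only move another variable from s
    -- into `B`. This raises the product of the others if all c ≥ 0 and lowers it if all c ≤ 0,
    -- whence the common sign.
    have hswap : ∀ t ∈ B, ∀ s ∉ B, c j * F t ≤ c j * F s := by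
      intro t ht s hs
      have e : F s = ∑ σ : Equiv.Perm (Fin n), if σ t = j then X (σ * Equiv.swap t s) else 0 := by
        simp only [hF]
        rw [← Equiv.sum_comp (Equiv.mulRight (Equiv.swap t s))]
        simp
      rw [e]
      simp only [hF, mul_sum]
      refine sum_le_sum fun σ _ => ?_
      split_ifs with hσ
      · have hpos : ∀ i ∈ T, (σ * Equiv.swap t s).symm i = σ.symm i ∨
            ((σ * Equiv.swap t s).symm i = t ∧ σ.symm i = s) := by
          intro i hi
          have h2 : (σ * Equiv.swap t s).symm i = Equiv.swap t s (σ.symm i) := by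
            rw [Equiv.symm_apply_eq, Equiv.Perm.mul_apply, Equiv.swap_apply_self,
              Equiv.apply_symm_apply]
          have h3 : σ.symm i ≠ t := fun h => hj (by
            rwa [← hσ, ← h, Equiv.apply_symm_apply])
          rw [h2]
          by_cases h4 : σ.symm i = s
          · exact Or.inr ⟨by rw [h4, Equiv.swap_apply_right], h4⟩
          · exact Or.inl (Equiv.swap_apply_of_ne_of_ne h3 h4)
        rcases hc with hc | hc
        · refine mul_le_mul_of_nonneg_left (prod_le_prod
            (fun i _ => hfac _ _ (ind_nonneg _) (ind_le_one _)) fun i hi => ?_) (hc j)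
          rcases hpos i hi with h | ⟨h, h'⟩
          · rw [h]
          · rw [h, h', ind_pos ht, ind_neg hs]
            linarith [hc i]
        · refine mul_le_mul_of_nonpos_left (prod_le_prod
            (fun i _ => hfac _ _ (ind_nonneg _) (ind_le_one _)) fun i hi => ?_) (hc j)
          rcases hpos i hi with h | ⟨h, h'⟩
          · rw [h]
          · rw [h, h', ind_pos ht, ind_neg hs]
            linarith [hc i]
      · exact le_rfl
    have htot : ∑ t ∈ B, F t + ∑ s ∈ Bᶜ, F s = ∑ σ, X σ := by
      rw [sum_add_sum_compl, hFsum]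
      exact sum_congr rfl fun σ _ => by rw [ind_pos (mem_univ _), one_mul]
    -- Averaging the comparison over all pairs (t, s): up to the sign of c, the mean of `F` over `B`
    -- is at most the mean over all times.
    have hkey : c j * ∑ t ∈ B, F t ≤ c j * ((B.card / n) * ∑ σ, X σ) := by
      have h3 : ∑ t ∈ B, ∑ s ∈ Bᶜ, c j * F t ≤ ∑ t ∈ B, ∑ s ∈ Bᶜ, c j * F s :=
        sum_le_sum fun t ht => sum_le_sum fun s hs => hswap t ht s (mem_compl.mp hs)
      simp only [sum_const, nsmul_eq_mul, ← mul_sum] at h3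
      rw [card_compl, Fintype.card_fin, Nat.cast_sub (by
        simpa using card_le_univ B), ← htot] at *
      rw [div_mul_eq_mul_div, mul_div_assoc', le_div_iff₀ hn]
      linarith
    have hexp : ∑ σ : Equiv.Perm (Fin n), ∏ i ∈ insert j T, (1 + c i * ind (σ.symm i ∈ B)) =
        ∑ σ, X σ + c j * ∑ t ∈ B, F t := by
      rw [hFsum, mul_sum, ← sum_add_distrib]
      refine sum_congr rfl fun σ _ => ?_
      rw [prod_insert hj]; ring
    rw [hexp, prod_insert hj]
    have h5 := mul_le_mul_of_nonneg_left ih (hfac j _ hβ0 hβ1)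
    calc _ ≤ ∑ σ, X σ + c j * ((B.card / n) * ∑ σ, X σ) := by linarith
      _ = (1 + c j * (B.card / n)) * ∑ σ, X σ := by ring
      _ ≤ _ := h5
      _ = _ := by ring

theorem exp_le_one_add_add_sq {x : ℝ} (h : |x| ≤ 1) : Real.exp x ≤ 1 + x + x ^ 2 := by
  have := Real.abs_exp_sub_one_sub_id_le h
  linarith [(abs_le.mp this).2]

/-- The exponential moments of the mass that arrives at the times `B`. -/
theorem sum_perm_exp_le (B T : Finset (Fin n)) {a : Fin n → ℝ} {A lam : ℝ} (ha : ∀ i, 0 ≤ a i)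
    (hA : ∀ i ∈ T, a i ≤ A) (hlam : |lam| * A ≤ 1) :
    ∑ σ : Equiv.Perm (Fin n), Real.exp (lam * ∑ i ∈ T, a i * ind (σ.symm i ∈ B)) ≤
      n.factorial * Real.exp ((lam + lam ^ 2 * A) * ((B.card / n) * ∑ i ∈ T, a i)) := by
  have hβ0 : 0 ≤ (B.card : ℝ) / n := div_nonneg (Nat.cast_nonneg _) (Nat.cast_nonneg _)
  have h := sum_perm_prod_le B T (c := fun i => Real.exp (lam * a i) - 1)
    (fun i => by linarith [Real.exp_pos (lam * a i)]) (by
      rcases le_total 0 lam with h | h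
      · left; intro i
        linarith [Real.one_le_exp (mul_nonneg h (ha i))]
      · right; intro i
        linarith [Real.exp_le_one_iff.mpr (mul_nonpos_of_nonpos_of_nonneg h (ha i))])
  have e1 : ∀ σ : Equiv.Perm (Fin n), ∏ i ∈ T, (1 + (Real.exp (lam * a i) - 1) *
      ind (σ.symm i ∈ B)) = Real.exp (lam * ∑ i ∈ T, a i * ind (σ.symm i ∈ B)) := fun σ => by
    rw [Finset.mul_sum, Real.exp_sum]
    refine Finset.prod_congr rfl fun i _ => ?_
    by_cases hi : σ.symm i ∈ B
    · rw [ind_pos hi]; simp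
    · rw [ind_neg hi]; simp
  rw [Finset.sum_congr rfl fun σ _ => e1 σ] at h
  refine h.trans (mul_le_mul_of_nonneg_left ?_ (Nat.cast_nonneg _))
  rw [Finset.mul_sum, Finset.mul_sum, Real.exp_sum]
  refine Finset.prod_le_prod (fun i _ => ?_) fun i hi => ?_
  · have hβ1 : (B.card : ℝ) / n ≤ 1 := by
      refine div_le_one_of_le₀ ?_ (Nat.cast_nonneg _)
      exact_mod_cast (Finset.card_le_univ B).trans (Fintype.card_fin n).le
    nlinarith [Real.exp_pos (lam * a i)]
  · have h2 : |lam * a i| ≤ 1 := by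
      rw [abs_mul, abs_of_nonneg (ha i)]
      exact (mul_le_mul_of_nonneg_left (hA i hi) (abs_nonneg _)).trans hlam
    have h3 : Real.exp (lam * a i) - 1 ≤ (lam + lam ^ 2 * A) * a i := by
      have := exp_le_one_add_add_sq h2
      have h4 : (lam * a i) ^ 2 ≤ lam ^ 2 * A * a i := by
        have := mul_le_mul_of_nonneg_left (mul_le_mul_of_nonneg_right (hA i hi) (ha i))
          (sq_nonneg lam)
        nlinarith
      linarith
    calc _ ≤ 1 + (lam + lam ^ 2 * A) * a i * (B.card / n) := by
          linarith [mul_le_mul_of_nonneg_right h3 hβ0]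
      _ ≤ _ := by
          have := Real.add_one_le_exp ((lam + lam ^ 2 * A) * ((B.card / n) * a i))
          linarith

/-- The mass that arrives at the times `B` is concentrated about its mean. -/
theorem sum_perm_deviation_le (B T : Finset (Fin n)) {a : Fin n → ℝ} {A lam d : ℝ}
    (ha : ∀ i, 0 ≤ a i) (hA : ∀ i ∈ T, a i ≤ A) (hlam0 : 0 ≤ lam) (hlam : lam * A ≤ 1) :
    ∑ σ : Equiv.Perm (Fin n),
      ind (d ≤ |∑ i ∈ T, a i * ind (σ.symm i ∈ B) - (B.card / n) * ∑ i ∈ T, a i|) ≤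
      n.factorial * (2 * Real.exp (lam ^ 2 * A * ((B.card / n) * ∑ i ∈ T, a i) - lam * d)) := by
  set μ := (B.card / n) * ∑ i ∈ T, a i with hμ
  have hu := sum_perm_exp_le B T ha hA (lam := lam) (by rwa [abs_of_nonneg hlam0])
  have hl := sum_perm_exp_le B T ha hA (lam := -lam) (by rwa [abs_neg, abs_of_nonneg hlam0])
  rw [← hμ] at hu hl
  have hpt : ∀ σ : Equiv.Perm (Fin n),
      ind (d ≤ |∑ i ∈ T, a i * ind (σ.symm i ∈ B) - μ|) ≤
      Real.exp (lam * ∑ i ∈ T, a i * ind (σ.symm i ∈ B)) * Real.exp (-lam * μ - lam * d) +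
      Real.exp (-lam * ∑ i ∈ T, a i * ind (σ.symm i ∈ B)) * Real.exp (lam * μ - lam * d) := by
    intro σ
    set M := ∑ i ∈ T, a i * ind (σ.symm i ∈ B)
    rw [← Real.exp_add, ← Real.exp_add]
    by_cases h : d ≤ |M - μ|
    · rw [ind_pos h]
      rcases le_abs.mp h with h | h
      · have : 0 ≤ lam * M + (-lam * μ - lam * d) := by nlinarith
        linarith [Real.one_le_exp this, Real.exp_pos (-lam * M + (lam * μ - lam * d))]
      · have : 0 ≤ -lam * M + (lam * μ - lam * d) := by nlinarith
        linarith [Real.one_le_exp this, Real.exp_pos (lam * M + (-lam * μ - lam * d))]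
    · rw [ind_neg h]
      positivity
  refine (Finset.sum_le_sum fun σ _ => hpt σ).trans ?_
  rw [Finset.sum_add_distrib, ← Finset.sum_mul, ← Finset.sum_mul]
  have e1 := mul_le_mul_of_nonneg_right hu (Real.exp_pos (-lam * μ - lam * d)).le
  have e2 := mul_le_mul_of_nonneg_right hl (Real.exp_pos (lam * μ - lam * d)).le
  rw [mul_assoc, ← Real.exp_add] at e1 e2
  have e3 : (lam + lam ^ 2 * A) * μ + (-lam * μ - lam * d) = lam ^ 2 * A * μ - lam * d := by ring
  have e4 : (-lam + (-lam) ^ 2 * A) * μ + (lam * μ - lam * d) = lam ^ 2 * A * μ - lam * d := by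
    ring
  rw [e3] at e1
  rw [e4] at e2
  linarith

end Concentration

end ProphetSecretary

/-! ### The games of the instance in terms of the block structure -/

namespace ProphetSecretary

set_option linter.unusedSectionVars false

namespace Instance

variable {n : ℕ} (I : Instance n) (ε : ℝ) (K : ℕ)

/-- The positive support values. -/
noncomputable def posValues : Finset ℝ := (Finset.univ.image I.value).filter (0 < ·)

/-- The positive support values of small variables. -/
noncomputable def classes : Finset ℝ := I.posValues.filter fun v => (I.small ε v).Nonempty

variable {I ε K}

theorem mem_posValues {v : ℝ} : v ∈ I.posValues ↔ (∃ i, I.value i = v) ∧ 0 < v := by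
  simp [posValues]

theorem mem_small {v : ℝ} {i : Fin n} : i ∈ I.small ε v ↔
    I.value i = v ∧ I.prob i < 1 ∧ I.q i < ε ^ 20 * I.scale ε v := by
  simp [small]

theorem mem_classes {v : ℝ} : v ∈ I.classes ε ↔ 0 < v ∧ (I.small ε v).Nonempty := by
  rw [classes, Finset.mem_filter, mem_posValues]
  constructor
  · exact fun h => ⟨h.1.2, h.2⟩
  · rintro ⟨h, i, hi⟩
    exact ⟨⟨⟨i, (mem_small.mp hi).1⟩, h⟩, i, hi⟩

variable (I ε K)

open scoped Classical in
/-- The class of a small variable. -/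
noncomputable def classOf (j : Fin n) : Option {v // v ∈ I.classes ε} :=
  if h : I.value j ∈ I.classes ε ∧ j ∈ I.small ε (I.value j) then some ⟨I.value j, h.1⟩ else none

variable {I ε K}

theorem classOf_eq_some_iff {j : Fin n} {v : {v // v ∈ I.classes ε}} :
    I.classOf ε j = some v ↔ j ∈ I.small ε v.1 := by
  unfold classOf
  constructor
  · intro h
    split_ifs at h with h'
    rw [← Option.some.inj h]
    exact h'.2
  · intro h
    have hv := (mem_small.mp h).1
    rw [dif_pos (show _ ∧ _ by rw [hv]; exact ⟨v.2, h⟩)]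
    exact congrArg some (Subtype.ext hv)

theorem classOf_eq_none_iff {j : Fin n} :
    I.classOf ε j = none ↔ ¬ (0 < I.value j ∧ j ∈ I.small ε (I.value j)) := by
  unfold classOf
  split_ifs with h
  · simp only [false_iff, not_not]
    exact ⟨(mem_classes.mp h.1).1, h.2⟩
  · simp only [true_iff]
    exact fun h' => h ⟨mem_classes.mpr ⟨h'.1, j, h'.2⟩, h'.2⟩

theorem totalMass_nonneg (v : ℝ) : 0 ≤ I.totalMass ε v :=
  Finset.sum_nonneg fun i _ => I.q_nonneg i

theorem blockFraction_nonneg (hε : 0 ≤ ε) (v : ℝ) : 0 ≤ I.blockFraction ε v :=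
  div_nonneg (mul_nonneg (pow_nonneg hε 4)
    (le_min (one_div_nonneg.mpr hε) (totalMass_nonneg v))) (totalMass_nonneg v)

variable (I K)

/-- The block structure of the small variables. -/
noncomputable def blocks (hε : 0 ≤ ε) : Blocks I K {v // v ∈ I.classes ε} where
  cls := I.classOf ε
  val v := v.1
  bd v k := ⌈I.blockEnd ε v K k⌉₊
  val_pos v := (mem_classes.mp v.2).1
  cls_val j v h := (mem_small.mp (classOf_eq_some_iff.mp h)).1
  cls_prob j v h := (mem_small.mp (classOf_eq_some_iff.mp h)).2.1
  bd_mono v k k' h := by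
    refine Nat.ceil_mono ?_
    have h1 : (k : ℝ) ≤ k' := by exact_mod_cast h
    have h2 := mul_nonneg (blockFraction_nonneg (I := I) hε v.1) (Nat.cast_nonneg (α := ℝ) n)
    unfold blockEnd
    nlinarith
  bd_last v := by simp [blockEnd]

variable {I K}

theorem mem_block {v : ℝ} {k : Fin K} {t : Fin n} : t ∈ I.block ε v K k ↔
    ⌈I.blockEnd ε v K k⌉₊ ≤ t ∧ (t : ℕ) < ⌈I.blockEnd ε v K (k + 1 : ℕ)⌉₊ := by
  simp [block, Nat.ceil_le, Nat.lt_ceil]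

theorem mem_initialBlock {v : ℝ} {t : Fin n} : t ∈ I.initialBlock ε v K ↔
    (t : ℕ) < ⌈I.blockEnd ε v K (0 : ℕ)⌉₊ := by
  simp [initialBlock, Nat.lt_ceil]

theorem lazyValue_eq (hε : 0 ≤ ε) (ω : Outcome n) (t : Fin n) :
    I.lazyValue ε K ω t = (I.blocks K hε).arrival ω t := by
  set j := ω.1 t with hj
  have hv0 := I.value_nonneg j
  unfold lazyValue arrivalValue Blocks.arrival Blocks.gain
  simp only [← hj]
  rcases h : (I.blocks K hε).cls j with _ | v
  · simp only
    have h' := classOf_eq_none_iff.mp (show I.classOf ε j = none from h)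
    split_ifs with h1 h2 h3
    · have : ¬ 0 < I.value j := fun h4 => h' ⟨h4, h1.1⟩
      linarith
    · rfl
    · rfl
    · rfl
  · simp only
    have h' := classOf_eq_some_iff.mp (show I.classOf ε j = some v from h)
    have hv := (mem_small.mp h').1
    have hmem : (j ∈ I.small ε (I.value j) ∧ t ∈ I.initialBlock ε (I.value j) K) ↔
        (t : ℕ) < (I.blocks K hε).bd v 0 := by
      rw [mem_initialBlock, hv]
      exact and_iff_right h'
    simp only [hmem]
    split_ifs <;> rfl

theorem realized_iff (hε : 0 ≤ ε) (v : {v // v ∈ I.classes ε}) (k : Fin K) (ω : Outcome n) :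
    (I.blocks K hε).Realized (v, k) n ω ↔
      ∃ s ∈ I.block ε v K k, ω.1 s ∈ I.small ε v ∧ ω.2 (ω.1 s) = true := by
  refine exists_congr fun s => ?_
  rw [mem_block]
  constructor
  · rintro ⟨h1, h2, -, h3, h4⟩
    exact ⟨⟨h1, h2⟩, classOf_eq_some_iff.mp h3, h4⟩
  · rintro ⟨⟨h1, h2⟩, h3, h4⟩
    exact ⟨h1, h2, s.2, classOf_eq_some_iff.mpr h3, h4⟩

open scoped Classical in
theorem outsideOption_eq (hε : 0 ≤ ε) (v : {v // v ∈ I.classes ε}) (ω : Outcome n) (t : Fin n) :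
    I.outsideOption ε K v ω t = if ∃ k : Fin K, t ∈ I.block ε v K k ∧
      (I.blocks K hε).zeta ω (v, k) = true then v.1 else 0 := by
  unfold outsideOption Blocks.zeta
  refine if_congr (exists_congr fun k => and_congr_right fun _ => ?_) rfl rfl
  rw [decide_eq_true_iff, realized_iff]

theorem outsideOption_eq_zero {i : Fin n} (h : I.value i ∉ I.classes ε) (ω : Outcome n)
    (t : Fin n) : I.outsideOption ε K (I.value i) ω t = 0 := by
  unfold outsideOption
  split_ifs with h1
  · obtain ⟨k, -, s, -, h2, -⟩ := h1
    have h3 := I.value_nonneg i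
    by_contra h4
    exact h (mem_classes.mpr ⟨lt_of_le_of_ne h3 (Ne.symm h4), _, h2⟩)
  · rfl

theorem lazyValue_nonneg (ω : Outcome n) (t : Fin n) : 0 ≤ I.lazyValue ε K ω t := by
  unfold lazyValue arrivalValue
  split_ifs
  · exact le_rfl
  · exact I.value_nonneg _
  · exact le_rfl

theorem le_option (hε : 0 ≤ ε) {v : {v // v ∈ I.classes ε}} {k : Fin K} {ω : Outcome n}
    {t : Fin n} (h1 : t ∈ I.block ε v K k) (h2 : (I.blocks K hε).zeta ω (v, k) = true) :
    v.1 ≤ (I.blocks K hε).option t ((I.blocks K hε).zeta ω) := by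
  rw [mem_block] at h1
  have := le_ciSup (f := fun i : {v // v ∈ I.classes ε} × Fin K =>
    if (I.blocks K hε).bd i.1 i.2 ≤ t ∧ (t : ℕ) < (I.blocks K hε).bd i.1 (i.2 + 1) ∧
      (I.blocks K hε).zeta ω i = true then (I.blocks K hε).val i.1 else 0)
    (Set.finite_range _).bddAbove (v, k)
  rwa [if_pos ⟨h1.1, h1.2, h2⟩] at this

theorem outsideOption_le_option (hε : 0 ≤ ε) (i : Fin n) (ω : Outcome n) (t : Fin n) :
    I.outsideOption ε K (I.value i) ω t ≤ (I.blocks K hε).option t ((I.blocks K hε).zeta ω) := by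
  by_cases h : I.value i ∈ I.classes ε
  · rw [outsideOption_eq hε ⟨I.value i, h⟩]
    split_ifs with h1
    · obtain ⟨k, h2, h3⟩ := h1
      exact le_option hε h2 h3
    · exact Blocks.option_nonneg _ _
  · rw [outsideOption_eq_zero h]
    exact Blocks.option_nonneg _ _

theorem exists_mem_block (hε : 0 ≤ ε) {v : {v // v ∈ I.classes ε}} {t : Fin n}
    (h : (I.blocks K hε).bd v 0 ≤ t) : ∃ k : Fin K, t ∈ I.block ε v K k := by
  have hex : ∃ k, (t : ℕ) < (I.blocks K hε).bd v k :=
    ⟨K, by rw [(I.blocks K hε).bd_last]; exact t.2⟩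
  classical
  have h1 := Nat.find_spec hex
  obtain ⟨k, hk⟩ : ∃ k, Nat.find hex = k + 1 := by
    refine Nat.exists_eq_succ_of_ne_zero fun h0 => ?_
    rw [h0] at h1
    omega
  have h2 := Nat.find_min hex (m := k) (by omega)
  rw [hk] at h1
  have hkK : k < K := by
    by_contra hge
    have := (I.blocks K hε).bd_mono v (not_lt.mp hge)
    rw [(I.blocks K hε).bd_last] at this
    have := t.2
    omega
  exact ⟨⟨k, hkK⟩, mem_block.mpr ⟨not_lt.mp h2, h1⟩⟩

/-- A realized class member after the initial segment lies in some block and switches on the option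
of that block, so dropping it as an arrival loses nothing. -/
theorem lazyValue_le_frontPay (hε : 0 ≤ ε) (ω : Outcome n) (t : Fin n) :
    I.lazyValue ε K ω t ≤ (I.blocks K hε).frontPay t ((I.blocks K hε).zeta ω) (ω.1 t)
      (ω.2 (ω.1 t)) := by
  rw [lazyValue_eq hε, Blocks.arrival, Blocks.frontPay]
  split_ifs with hb
  swap
  · exact Blocks.frontPay_nonneg _ _ _ _
  rcases h : (I.blocks K hε).cls (ω.1 t) with _ | v
  · refine le_max_of_le_left ?_
    simp [Blocks.gain, Blocks.freeGain, h, hb]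
  · simp only [Blocks.gain, h]
    split_ifs with h0
    · exact Blocks.frontPay_nonneg _ _ _ _
    · refine le_max_of_le_right ?_
      obtain ⟨k, hk⟩ := exists_mem_block hε (not_lt.mp h0)
      have hs := classOf_eq_some_iff.mp (show I.classOf ε (ω.1 t) = some v from h)
      rw [(mem_small.mp hs).1]
      refine le_option hε hk ?_
      classical
      rw [Blocks.zeta, decide_eq_true_iff, realized_iff]
      exact ⟨t, hk, hs, hb⟩

theorem payoffFour_le_frontPay (hε : 0 ≤ ε) (ω : Outcome n) (t : Fin n) :
    (I.gameFour ε K).payoff ω t ≤ (I.blocks K hε).frontPay t ((I.blocks K hε).zeta ω) (ω.1 t)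
      (ω.2 (ω.1 t)) := by
  simp only [gameFour]
  split_ifs
  · exact Blocks.frontPay_nonneg _ _ _ _
  · refine max_le (lazyValue_le_frontPay hε ω t) (Real.iSup_le (fun i => ?_)
      (Blocks.frontPay_nonneg _ _ _ _))
    exact le_max_of_le_right (outsideOption_le_option hε i ω t)

/-- The signals of G₄ up to time t reveal the past arrivals and, beyond them, only the bits of
blocks that have begun by t. -/
theorem adapted_of_isStrategy (hε : 0 ≤ ε) {τ : Outcome n → Option (Fin n)}
    (hτ : (I.gameFour ε K).IsStrategy τ) : (I.blocks K hε).Adapted τ := by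
  intro t ω ω' h hz
  refine hτ t ω ω' fun s hs => ?_
  have hs' : (s : ℕ) ≤ t := Fin.le_def.mp hs
  have h1 := h.mono (Nat.succ_le_succ hs')
  simp only [gameFour]
  rw [lazyValue_eq hε, lazyValue_eq hε, Blocks.arrival_congr h1, (h s (Nat.lt_succ_of_le hs')).1]
  refine congrArg _ (congrArg _ (funext fun i => ?_))
  by_cases hi : I.value i ∈ I.classes ε
  · classical
    rw [outsideOption_eq hε ⟨I.value i, hi⟩, outsideOption_eq hε ⟨I.value i, hi⟩]
    refine if_congr (exists_congr fun k => and_congr_right fun hk => ?_) rfl rfl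
    rw [hz (⟨I.value i, hi⟩, k) ((mem_block.mp hk).1.trans hs')]
  · rw [outsideOption_eq_zero hi, outsideOption_eq_zero hi]

/-- An upper bound for the largest realized value. -/
noncomputable def peak (I : Instance n) (b : Fin n → Bool) : ℝ :=
  ∑ u ∈ I.posValues, u * ind (∃ j, I.value j = u ∧ b j = true)

theorem peak_nonneg (b : Fin n → Bool) : 0 ≤ I.peak b :=
  Finset.sum_nonneg fun _ hu => mul_nonneg (mem_posValues.mp hu).2.le (ind_nonneg _)

theorem value_le_peak {j : Fin n} {b : Fin n → Bool} (hb : b j = true) :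
    I.value j ≤ I.peak b := by
  rcases (I.value_nonneg j).lt_or_eq with h | h
  · have := Finset.single_le_sum (f := fun u => u * ind (∃ j, I.value j = u ∧ b j = true))
      (fun u hu => mul_nonneg (mem_posValues.mp hu).2.le (ind_nonneg _))
      (mem_posValues.mpr ⟨⟨j, rfl⟩, h⟩)
    rwa [ind_pos ⟨j, rfl, hb⟩, mul_one] at this
  · rw [← h]; exact peak_nonneg b

theorem lazyValue_le_peak (ω : Outcome n) (t : Fin n) : I.lazyValue ε K ω t ≤ I.peak ω.2 := by
  unfold lazyValue arrivalValue
  split_ifs with h1 h2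
  · exact peak_nonneg _
  · exact value_le_peak h2
  · exact peak_nonneg _

theorem payoffFour_le_peak (ω : Outcome n) (t : Fin n) :
    (I.gameFour ε K).payoff ω t ≤ I.peak ω.2 := by
  simp only [gameFour]
  split_ifs
  · exact peak_nonneg _
  · refine max_le (lazyValue_le_peak ω t) (Real.iSup_le (fun i => ?_) (peak_nonneg _))
    unfold outsideOption
    split_ifs with h
    · obtain ⟨k, -, s, -, h1, h2⟩ := h
      rw [← (mem_small.mp h1).1]
      exact value_le_peak h2
    · exact peak_nonneg _

theorem payoffThree_le_payoffFour (ω : Outcome n) (t : Fin n) :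
    (I.gameThree ε K).payoff ω t ≤ (I.gameFour ε K).payoff ω t := by
  simp only [gameThree, gameFour]
  split_ifs
  · exact le_rfl
  · exact le_max_left _ _

theorem le_opt {α : Type} (G : Game n α) {τ : Outcome n → Option (Fin n)} (hτ : G.IsStrategy τ) :
    I.reward G τ ≤ I.opt G :=
  le_ciSup (f := fun τ : {τ : Outcome n → Option (Fin n) // G.IsStrategy τ} => I.reward G τ.1)
    (Set.finite_range _).bddAbove ⟨τ, hτ⟩

theorem never_isStrategy {α : Type} (G : Game n α) : G.IsStrategy fun _ => none :=
  fun _ _ _ _ => Iff.rfl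

theorem opt_le {α : Type} {G : Game n α} {a : ℝ}
    (h : ∀ τ, G.IsStrategy τ → I.reward G τ ≤ a) : I.opt G ≤ a := by
  have : Nonempty {τ : Outcome n → Option (Fin n) // G.IsStrategy τ} :=
    ⟨⟨_, never_isStrategy G⟩⟩
  exact ciSup_le fun τ => h τ.1 τ.2

/-- Frontloading does not hurt. -/
theorem opt_gameThree_le : I.opt (I.gameThree ε K) ≤ I.opt (I.gameFour ε K) := by
  refine opt_le fun τ hτ => ?_
  have h4 : (I.gameFour ε K).IsStrategy τ := fun t ω ω' h => hτ t ω ω' fun s hs => by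
    have := h s hs
    simp only [gameFour, Prod.mk.injEq] at this
    simp only [gameThree, this.1, this.2.1]
  refine le_trans (Finset.sum_le_sum fun ω _ => ?_) (le_opt _ h4)
  refine mul_le_mul_of_nonneg_left ?_ (I.weight_nonneg ω)
  rcases τ ω with _ | t
  · exact le_rfl
  · exact payoffThree_le_payoffFour ω t

end Instance

end ProphetSecretary

/-! ### Both games up to the atypical orders; the mass of the large value -/

namespace ProphetSecretary

set_option linter.unusedSectionVars false

namespace Instance

variable {n : ℕ} (I : Instance n)

/-- The probability that one of the variables `J` is realized. -/
noncomputable def hitProb (J : Finset (Fin n)) : ℝ :=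
  ∑ b, bitWeight I.prob b * ind (∃ j ∈ J, b j = true)

theorem ind_exists_eq (J : Finset (Fin n)) (b : Fin n → Bool) :
    ind (∃ j ∈ J, b j = true) = 1 - ∏ j, (if j ∈ J ∧ b j = true then 0 else 1 : ℝ) := by
  by_cases h : ∃ j ∈ J, b j = true
  · obtain ⟨j, hj⟩ := h
    have h0 : ∏ j, (if j ∈ J ∧ b j = true then 0 else 1 : ℝ) = 0 :=
      Finset.prod_eq_zero (Finset.mem_univ j) (if_pos hj)
    rw [ind_pos ⟨j, hj⟩, h0, sub_zero]
  · rw [ind_neg h, Finset.prod_eq_one, sub_self]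
    exact fun j _ => if_neg fun h' => h ⟨j, h'⟩

theorem hitProb_eq (J : Finset (Fin n)) : I.hitProb J = 1 - ∏ j ∈ J, (1 - I.prob j) := by
  unfold hitProb
  simp only [ind_exists_eq, mul_sub, mul_one]
  rw [Finset.sum_sub_distrib, sum_bitWeight,
    sum_bitWeight_mul_prod I.prob (fun j β => if j ∈ J ∧ β = true then (0 : ℝ) else 1)]
  congr 1
  rw [← Finset.prod_subset (Finset.subset_univ J)]
  · exact Finset.prod_congr rfl fun j hj => by simp [hj]
  · intro j _ hj
    simp [hj]

theorem bitWeight_prob_nonneg (b : Fin n → Bool) : 0 ≤ bitWeight I.prob b :=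
  bitWeight_nonneg (fun i => (I.prob_pos i).le) I.prob_le_one b

theorem hitProb_le_sum (J : Finset (Fin n)) : I.hitProb J ≤ ∑ j ∈ J, I.prob j := by
  rw [hitProb_eq]
  suffices h : 1 - ∑ j ∈ J, I.prob j ≤ ∏ j ∈ J, (1 - I.prob j) by linarith
  induction J using Finset.induction_on with
  | empty => simp
  | insert j J hj ih =>
    rw [Finset.sum_insert hj, Finset.prod_insert hj]
    have h1 := I.prob_pos j
    have h2 := I.prob_le_one j
    have h3 : ∏ j ∈ J, (1 - I.prob j) ≤ 1 :=
      Finset.prod_le_one (fun i _ => by linarith [I.prob_le_one i])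
        fun i _ => by linarith [I.prob_pos i]
    nlinarith

theorem hitProb_le_one (J : Finset (Fin n)) : I.hitProb J ≤ 1 := by
  rw [hitProb_eq]
  have := Finset.prod_nonneg (s := J) (f := fun j => 1 - I.prob j)
    fun j _ => by linarith [I.prob_le_one j]
  linarith

/-- The order and the realizations are independent. -/
theorem sum_weight_mul_mul (f : Equiv.Perm (Fin n) → ℝ) (g : (Fin n → Bool) → ℝ) :
    ∑ ω, I.weight ω * (f ω.1 * g ω.2) =
      (∑ σ, f σ) / n.factorial * ∑ b, bitWeight I.prob b * g b := by
  rw [sum_weight_mul]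
  simp only
  rw [div_mul_eq_mul_div, Finset.sum_mul]
  congr 1
  refine Finset.sum_congr rfl fun σ _ => ?_
  rw [Finset.mul_sum]
  exact Finset.sum_congr rfl fun b _ => by ring

theorem sum_weight_mul_snd (g : (Fin n → Bool) → ℝ) :
    ∑ ω, I.weight ω * g ω.2 = ∑ b, bitWeight I.prob b * g b := by
  have h := I.sum_weight_mul_mul (fun _ => 1) g
  have h1 := I.sum_weight_mul_perm (fun _ => 1)
  simp only [one_mul, mul_one] at h h1
  rw [h, ← h1, I.sum_weight, one_mul]

/-- The probability that the arrival order has the property `P`. -/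
noncomputable def orderProb (P : Equiv.Perm (Fin n) → Prop) : ℝ := (∑ σ, ind (P σ)) / n.factorial

/-- The expected value of `peak`. -/
noncomputable def meanPeak : ℝ := ∑ b, bitWeight I.prob b * I.peak b

theorem meanPeak_eq : I.meanPeak =
    ∑ u ∈ I.posValues, u * I.hitProb (Finset.univ.filter fun j => I.value j = u) := by
  unfold meanPeak peak hitProb
  simp only [Finset.mul_sum]
  rw [Finset.sum_comm]
  refine Finset.sum_congr rfl fun u _ => Finset.sum_congr rfl fun b _ => ?_
  rw [ind_congr (show (∃ j, I.value j = u ∧ b j = true) ↔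
    ∃ j ∈ Finset.univ.filter fun j => I.value j = u, b j = true by simp)]
  ring

variable {I} {ε : ℝ} {K : ℕ}

theorem remaining_congr {σ σ' : Equiv.Perm (Fin n)} {t : ℕ}
    (h : ∀ s : Fin n, (s : ℕ) < t → σ s = σ' s) : remaining σ t = remaining σ' t :=
  SamePast.remaining_eq (ω := (σ, fun _ => true)) (ω' := (σ', fun _ => true))
    fun s hs => ⟨h s hs, rfl⟩

/-- Playing the threshold strategy loses only the failing orders. -/
theorem le_opt_gameThree (hε : 0 ≤ ε) {Bad : Equiv.Perm (Fin n) → Prop}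
    (hbad : ∀ σ, I.Fails ε K σ → Bad σ) :
    (I.blocks K hε).contValue n Finset.univ - orderProb Bad * I.meanPeak ≤
      I.opt (I.gameThree ε K) := by
  set B := I.blocks K hε
  have hτ : (I.gameThree ε K).IsStrategy B.threshold := fun t ω ω' h =>
    firstTime_congr fun s hs => by
      have h1 := h s hs
      simp only [gameThree, Prod.mk.injEq] at h1
      rw [lazyValue_eq hε, lazyValue_eq hε] at h1
      -- The threshold needs the set of remaining variables, which the observed arrivals determine.
      rw [h1.2, remaining_congr (σ := ω.1) (σ' := ω'.1) fun u hu => ?_]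
      have h2 := h u ((Fin.le_def.mpr (Nat.le_of_lt_succ hu)).trans hs)
      simp only [gameThree, Prod.mk.injEq] at h2
      exact h2.1
  refine le_trans ?_ (le_opt _ hτ)
  have h2 := I.sum_weight_mul_mul (fun σ => ind (Bad σ)) I.peak
  have h3 : orderProb Bad * I.meanPeak = ∑ ω, I.weight ω * (ind (Bad ω.1) * I.peak ω.2) := h2.symm
  rw [h3, ← B.sum_arrival_threshold, ← Finset.sum_sub_distrib]
  refine Finset.sum_le_sum fun ω _ => ?_
  rw [← mul_sub]
  refine mul_le_mul_of_nonneg_left ?_ (I.weight_nonneg ω)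
  have hp := peak_nonneg (I := I) ω.2
  rcases B.threshold ω with _ | t
  · simp only [Option.elim]
    linarith [mul_nonneg (ind_nonneg (Bad ω.1)) hp]
  · simp only [Option.elim, gameThree]
    rw [← lazyValue_eq hε]
    by_cases hB : Bad ω.1
    · rw [ind_pos hB, one_mul]
      have := lazyValue_le_peak (I := I) (ε := ε) (K := K) ω t
      have := lazyValue_nonneg (I := I) (ε := ε) (K := K) ω t
      split_ifs <;> linarith
    · rw [ind_neg hB, zero_mul, sub_zero, if_neg fun h => hB (hbad _ h)]

/-- The frontloaded game in terms of the initial potential. -/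
theorem opt_gameFour_le (hε : 0 ≤ ε) {Bad : Equiv.Perm (Fin n) → Prop}
    {Q r len : {v // v ∈ I.classes ε} → ℝ} {D κ : ℝ}
    (hN : (I.blocks K hε).Nominal Q r len D)
    (h1 : ∀ σ, ¬ Bad σ → (I.blocks K hε).WithinMass Q n σ)
    (h2 : ∀ σ, ¬ Bad σ → ∑ i : {v // v ∈ I.classes ε} × Fin K,
      (Q i.1 - (I.blocks K hε).mass i n σ) ≤ κ) :
    I.opt (I.gameFour ε K) ≤ Real.exp κ * (I.blocks K hε).startValue Q r D +
      orderProb Bad * I.meanPeak := by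
  set B := I.blocks K hε
  refine opt_le fun τ hτ => ?_
  have h4 := hN.sum_frontPay_le (adapted_of_isStrategy hε hτ) (Typ := fun σ => ¬ Bad σ) h1 h2
  have h3 : orderProb Bad * I.meanPeak = ∑ ω, I.weight ω * (ind (Bad ω.1) * I.peak ω.2) :=
    (I.sum_weight_mul_mul (fun σ => ind (Bad σ)) I.peak).symm
  rw [h3]
  refine le_trans ?_ (add_le_add_left h4 _)
  rw [reward, ← Finset.sum_add_distrib]
  refine Finset.sum_le_sum fun ω _ => ?_
  rw [← mul_add]
  refine mul_le_mul_of_nonneg_left ?_ (I.weight_nonneg ω)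
  have hp := peak_nonneg (I := I) ω.2
  by_cases hB : Bad ω.1
  · rw [ind_pos hB, ind_neg (not_not.mpr hB), zero_mul, zero_add, one_mul]
    rcases τ ω with _ | t
    · exact hp
    · exact payoffFour_le_peak ω t
  · rw [ind_neg hB, ind_pos hB, one_mul, zero_mul, add_zero]
    rcases τ ω with _ | t
    · exact le_rfl
    · exact payoffFour_le_frontPay hε ω t

/-- A value that is worth waiting for in the original game. -/
theorem mul_hitProb_le_opt_gameOne (v : ℝ) :
    v * I.hitProb (Finset.univ.filter fun j => I.value j = v) ≤ I.opt I.gameOne := by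
  let P : Outcome n → Fin n → Prop := fun ω t => I.arrivalValue ω t = v
  have hτ : I.gameOne.IsStrategy (firstTime P) := fun t ω ω' h =>
    firstTime_congr fun s hs => by
      have := h s hs
      simp only [gameOne, Prod.mk.injEq] at this
      simp only [P, this.2]
  refine le_trans ?_ (le_opt _ hτ)
  rw [hitProb, ← sum_weight_mul_snd I (fun b => ind (∃ j ∈ _, b j = true)), Finset.mul_sum]
  refine Finset.sum_le_sum fun ω _ => ?_
  rw [mul_left_comm]
  refine mul_le_mul_of_nonneg_left ?_ (I.weight_nonneg ω)
  by_cases h : ∃ j ∈ Finset.univ.filter fun j => I.value j = v, ω.2 j = true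
  · obtain ⟨j, hj, hb⟩ := h
    have hP : P ω (ω.1.symm j) := by
      simp only [P, arrivalValue, Equiv.apply_symm_apply, hb, if_true]
      exact (Finset.mem_filter.mp hj).2
    obtain ⟨s, -, hs⟩ := exists_firstTime hP
    rw [ind_pos ⟨j, hj, hb⟩, mul_one, hs]
    exact (firstTime_eq_some_iff.mp hs).1.ge
  · rw [ind_neg h, mul_zero]
    rcases firstTime P ω with _ | t
    · exact le_rfl
    · simp only [Option.elim, gameOne, arrivalValue]
      split_ifs <;> [exact I.value_nonneg _; exact le_rfl]

/-- Waiting for a value v > 1/ε² ≥ 4 earns at most 1 in the original game, so v appears with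
probability at most 1/4. A mass above 1 would make this at least 1 - 1/e. -/
theorem scale_le_one (hε : 0 < ε) (hε1 : ε ≤ 1 / 2) (hN : I.IsNormalized ε) (v : ℝ) :
    I.scale ε v ≤ 1 := by
  unfold scale
  split_ifs with h
  · exact le_rfl
  · have hv : 1 / ε ^ 2 < v := not_le.mp h
    have hε2 : 0 < 1 / ε ^ 2 := by positivity
    have hε4 : 4 ≤ 1 / ε ^ 2 := by
      rw [le_div_iff₀ (by positivity)]; nlinarith
    set J := Finset.univ.filter fun j => I.value j = v with hJ
    have h1 := (mul_hitProb_le_opt_gameOne (I := I) v).trans hN.opt_le_one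
    rw [← hJ] at h1
    have h2 : I.hitProb J ≤ 1 / 4 := by
      by_contra hlt
      nlinarith [not_le.mp hlt, not_le.mp h]
    rw [hitProb_eq] at h2
    have hp : ∀ j ∈ J, I.prob j < 1 := fun j hj => by
      by_contra hge
      have : I.prob j = 1 := le_antisymm (I.prob_le_one j) (not_lt.mp hge)
      rw [Finset.prod_eq_zero hj (by rw [this, sub_self])] at h2
      norm_num at h2
    have h3 : ∏ j ∈ J, (1 - I.prob j) = Real.exp (-∑ j ∈ J, I.q j) := by
      rw [← Finset.sum_neg_distrib, Real.exp_sum]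
      refine Finset.prod_congr rfl fun j hj => ?_
      rw [q, neg_neg, Real.exp_log (by linarith [hp j hj])]
    rw [h3] at h2
    by_contra hlt
    have h4 : Real.exp (-∑ j ∈ J, I.q j) ≤ Real.exp (-1) :=
      Real.exp_le_exp.mpr (by linarith [not_le.mp hlt])
    have h5 : Real.exp (-1) < 1 / 2 := by
      rw [Real.exp_neg, inv_lt_comm₀ (Real.exp_pos _) (by norm_num)]
      linarith [Real.add_one_lt_exp (x := 1) one_ne_zero]
    linarith

end Instance

end ProphetSecretary

/-! ### Sizes of the parameters -/

namespace ProphetSecretary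

set_option linter.unusedSectionVars false

namespace Instance

variable {n : ℕ} (I : Instance n) (ε : ℝ) (K : ℕ)

/-- The standing assumptions on an instance and its parameters. -/
structure Regime : Prop where
  pos : 0 < ε
  le : ε ≤ 1 / 100
  blocks : (K : ℝ) * ε ^ 4 = 1
  normalized : I.IsNormalized ε

/-- The relative deviation of the mass of a block that is tolerated. -/
noncomputable def tol (v : ℝ) : ℝ := √(ε ^ 19 * I.scale ε v / I.blockMass ε v)

/-- The number of arrivals in a block, before rounding. -/
noncomputable def blockLen (v : ℝ) : ℝ := I.blockFraction ε v * n

/-- The upper bound for the masses of small variables. -/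
noncomputable def maxMass (v : ℝ) : ℝ := ε ^ 20 * I.scale ε v

variable {I ε K}

theorem prob_le_q {j : Fin n} (h : I.prob j < 1) : I.prob j ≤ I.q j := by
  have := Real.log_le_sub_one_of_pos (x := 1 - I.prob j) (by linarith)
  rw [q]; linarith

theorem q_mul_one_sub_le {j : Fin n} (h : I.prob j < 1) (h1 : I.q j ≤ 1) :
    I.q j * (1 - I.q j) ≤ I.prob j := by
  have h0 := I.q_nonneg j
  have h2 := exp_le_one_add_add_sq (x := -I.q j) (by rw [abs_neg, abs_of_nonneg h0]; exact h1)
  have h3 : Real.exp (-I.q j) = 1 - I.prob j := by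
    rw [q, neg_neg, Real.exp_log (by linarith)]
  nlinarith

namespace Regime

variable (h : I.Regime ε K) {v : ℝ} (hv : v ∈ I.classes ε)

include h

theorem lt_one : ε < 1 := by linarith [h.le]

theorem pow_le {a b : ℕ} (hab : b ≤ a) : ε ^ a ≤ ε ^ b :=
  pow_le_pow_of_le_one h.pos.le h.lt_one.le hab

theorem K_pos : 0 < K := by
  rcases Nat.eq_zero_or_pos K with h0 | h0
  · have := h.blocks
    rw [h0] at this
    norm_num at this
  · exact h0

theorem scale_le_one : I.scale ε v ≤ 1 :=
  Instance.scale_le_one h.pos (by linarith [h.le]) h.normalized v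

theorem maxMass_le : I.maxMass ε v ≤ ε ^ 20 := by
  have := mul_le_mul_of_nonneg_left (h.scale_le_one (v := v)) (pow_nonneg h.pos.le 20)
  rwa [mul_one] at this

include hv

theorem val_pos : 0 < v := (mem_classes.mp hv).1

theorem n_pos : 0 < n := by
  obtain ⟨-, i, -⟩ := mem_classes.mp hv
  exact Fin.pos i

theorem scale_pos : 0 < I.scale ε v := by
  obtain ⟨-, i, hi⟩ := mem_classes.mp hv
  have h1 := (mem_small.mp hi).2.2
  have h2 := I.q_nonneg i
  by_contra hlt
  have := mul_nonpos_of_nonneg_of_nonpos (pow_nonneg h.pos.le 20) (not_lt.mp hlt)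
  linarith

theorem maxMass_pos : 0 < I.maxMass ε v := mul_pos (pow_pos h.pos 20) (h.scale_pos hv)

theorem totalMass_ge : ε ^ 10 * I.scale ε v ≤ I.totalMass ε v :=
  h.normalized.mass v (mem_classes.mp hv).1 (mem_classes.mp hv).2

theorem totalMass_pos : 0 < I.totalMass ε v :=
  (mul_pos (pow_pos h.pos 10) (h.scale_pos hv)).trans_le (h.totalMass_ge hv)

theorem cappedMass_pos : 0 < I.cappedMass ε v :=
  lt_min (one_div_pos.mpr h.pos) (h.totalMass_pos hv)

omit hv in
theorem cappedMass_le : I.cappedMass ε v ≤ I.totalMass ε v := min_le_right _ _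

omit hv in
theorem cappedMass_le_inv : I.cappedMass ε v ≤ 1 / ε := min_le_left _ _

omit hv in
theorem one_le_inv : 1 ≤ 1 / ε := by
  rw [le_div_iff₀ h.pos, one_mul]; exact h.lt_one.le

theorem blockMass_pos : 0 < I.blockMass ε v := mul_pos (pow_pos h.pos 4) (h.cappedMass_pos hv)

omit hv in
theorem K_mul_blockMass : K * I.blockMass ε v = I.cappedMass ε v := by
  rw [blockMass, ← mul_assoc, h.blocks, one_mul]

omit hv in
theorem blockMass_le : I.blockMass ε v ≤ ε ^ 3 := by
  have := mul_le_mul_of_nonneg_left (h.cappedMass_le_inv (v := v)) (pow_nonneg h.pos.le 4)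
  have e : ε ^ 4 * (1 / ε) = ε ^ 3 := by have := h.pos; field_simp
  rw [e] at this
  exact this

theorem n_pos' : (0 : ℝ) < n := by exact_mod_cast h.n_pos hv

theorem blockLen_mul : I.blockLen ε v * I.totalMass ε v = I.blockMass ε v * n := by
  have := h.totalMass_pos hv
  rw [blockLen, blockFraction]
  field_simp

theorem blockLen_pos : 0 < I.blockLen ε v :=
  mul_pos (div_pos (h.blockMass_pos hv) (h.totalMass_pos hv)) (h.n_pos' hv)

theorem K_mul_blockLen_mul : K * I.blockLen ε v * I.totalMass ε v = I.cappedMass ε v * n := by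
  rw [mul_assoc, h.blockLen_mul hv, ← mul_assoc, h.K_mul_blockMass]

theorem K_mul_blockLen_le : K * I.blockLen ε v ≤ n := by
  have h1 := h.totalMass_pos hv
  refine le_of_mul_le_mul_right ?_ h1
  rw [h.K_mul_blockLen_mul hv, mul_comm (n : ℝ)]
  exact mul_le_mul_of_nonneg_right h.cappedMass_le (h.n_pos' hv).le

omit h hv in
theorem _root_.ProphetSecretary.Instance.q_le_maxMass {v : ℝ} {i : Fin n}
    (hi : i ∈ I.small ε v) : I.q i ≤ I.maxMass ε v := (mem_small.mp hi).2.2.le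

omit h hv in
theorem _root_.ProphetSecretary.Instance.totalMass_le (v : ℝ) (h0 : 0 ≤ I.maxMass ε v) :
    I.totalMass ε v ≤ n * I.maxMass ε v := by
  have h1 := Finset.sum_le_card_nsmul (I.small ε v) I.q (I.maxMass ε v) fun i hi => q_le_maxMass hi
  rw [nsmul_eq_mul] at h1
  refine h1.trans (mul_le_mul_of_nonneg_right ?_ h0)
  exact_mod_cast (Finset.card_le_univ _).trans (Fintype.card_fin n).le

theorem tol_pos : 0 < I.tol ε v :=
  Real.sqrt_pos.mpr (div_pos (mul_pos (pow_pos h.pos 19) (h.scale_pos hv)) (h.blockMass_pos hv))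

theorem tol_sq_mul : I.tol ε v ^ 2 * I.blockMass ε v = ε ^ 19 * I.scale ε v := by
  have h1 := h.blockMass_pos hv
  rw [tol, Real.sq_sqrt (div_nonneg (mul_nonneg (pow_nonneg h.pos.le 19) (h.scale_pos hv).le)
    h1.le), div_mul_cancel₀ _ h1.ne']

/-- This identity explains the choice of the tolerance: the Chernoff exponent, of order η²Q°/A,
becomes of order 1/ε. -/
theorem maxMass_eq : I.maxMass ε v = ε * I.tol ε v ^ 2 * I.blockMass ε v := by
  rw [mul_assoc, h.tol_sq_mul hv, maxMass]; ring

/-- Since no small variable exceeds the maximal mass, a block must contain many arrivals. Rounding a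
block by one arrival is then negligible against the tolerance. -/
theorem one_le_mul_blockLen : 1 ≤ ε * I.tol ε v ^ 2 * I.blockLen ε v := by
  have h1 := Instance.totalMass_le (I := I) v (h.maxMass_pos hv).le
  have h2 := h.totalMass_pos hv
  refine le_of_mul_le_mul_right ?_ h2
  rw [one_mul, mul_assoc, h.blockLen_mul hv, ← mul_assoc, ← h.maxMass_eq hv, mul_comm]
  exact h1

theorem scale_mul_le_cappedMass : ε ^ 10 * I.scale ε v ≤ I.cappedMass ε v := by
  refine le_min ?_ (h.totalMass_ge hv)
  have h1 := mul_le_mul (pow_le_one₀ h.pos.le h.lt_one.le (n := 10)) (h.scale_le_one (v := v))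
    (h.scale_pos hv).le zero_le_one
  linarith [h.one_le_inv]

theorem tol_sq_mul_capped : I.tol ε v ^ 2 * I.cappedMass ε v = ε ^ 15 * I.scale ε v := by
  have h1 := h.tol_sq_mul hv
  rw [blockMass] at h1
  refine mul_left_cancel₀ (pow_pos h.pos 4).ne' ?_
  linear_combination h1

theorem tol_sq_le : I.tol ε v ^ 2 ≤ ε ^ 5 := by
  refine le_of_mul_le_mul_right ?_ (h.cappedMass_pos hv)
  rw [h.tol_sq_mul_capped hv]
  have := mul_le_mul_of_nonneg_left (h.scale_mul_le_cappedMass hv) (pow_nonneg h.pos.le 5)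
  calc _ = ε ^ 5 * (ε ^ 10 * I.scale ε v) := by ring
    _ ≤ _ := this

theorem tol_le : I.tol ε v ≤ ε ^ 2 := by
  refine (sq_le_sq₀ (h.tol_pos hv).le (pow_nonneg h.pos.le 2)).mp ?_
  exact (h.tol_sq_le hv).trans (by rw [← pow_mul]; exact h.pow_le (by norm_num))

/-- The square of the left side is ε¹⁵·s·Q*. If the total mass is at most 1, then ε¹⁰s and Q* are
both bounded by it; otherwise s ≤ 1 and Q* ≤ 1/ε. -/
theorem tol_mul_capped_le : I.tol ε v * I.cappedMass ε v ≤
    ε ^ 2 * √ε * min 1 (I.totalMass ε v) := by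
  have h1 := h.totalMass_pos hv
  have hmin : 0 < min 1 (I.totalMass ε v) := lt_min zero_lt_one h1
  have hs := h.scale_le_one (v := v)
  have hs0 := h.scale_pos hv
  have hc := h.cappedMass_pos hv
  have hε5 := pow_pos h.pos 5
  have hε15 := pow_pos h.pos 15
  refine (sq_le_sq₀ (mul_pos (h.tol_pos hv) hc).le (mul_nonneg (mul_nonneg
    (pow_nonneg h.pos.le 2) (Real.sqrt_nonneg _)) hmin.le)).mp ?_
  have e1 : (I.tol ε v * I.cappedMass ε v) ^ 2 = ε ^ 15 * I.scale ε v * I.cappedMass ε v := by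
    rw [← h.tol_sq_mul_capped hv]; ring
  have e2 : (ε ^ 2 * √ε * min 1 (I.totalMass ε v)) ^ 2 = ε ^ 5 * min 1 (I.totalMass ε v) ^ 2 := by
    rw [mul_pow, mul_pow, Real.sq_sqrt h.pos.le]; ring
  rw [e1, e2]
  rcases le_total (I.totalMass ε v) 1 with hQ | hQ
  · rw [min_eq_right hQ]
    have e3 := h.totalMass_ge hv
    have e4 := h.cappedMass_le (v := v)
    calc ε ^ 15 * I.scale ε v * I.cappedMass ε v
        = ε ^ 5 * ((ε ^ 10 * I.scale ε v) * I.cappedMass ε v) := by ring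
      _ ≤ ε ^ 5 * (I.totalMass ε v * I.totalMass ε v) := by gcongr
      _ = _ := by ring
  · rw [min_eq_left hQ]
    have e4 := h.cappedMass_le_inv (v := v)
    calc ε ^ 15 * I.scale ε v * I.cappedMass ε v ≤ ε ^ 15 * 1 * (1 / ε) := by gcongr
      _ = ε ^ 14 := by have := h.pos; field_simp
      _ ≤ ε ^ 5 * 1 ^ 2 := by rw [one_pow, mul_one]; exact h.pow_le (by norm_num)

/-! ### Block lengths -/

theorem blockEnd_nonneg (k : ℕ) : 0 ≤ I.blockEnd ε v K k := by
  have h1 := h.K_mul_blockLen_le hv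
  have h2 := (h.blockLen_pos hv).le
  have h3 : (0 : ℝ) ≤ k := Nat.cast_nonneg k
  unfold blockEnd
  change 0 ≤ (n : ℝ) - (K - k) * I.blockLen ε v
  nlinarith

theorem bd_lt (k : ℕ) :
    ((⌈I.blockEnd ε v K k⌉₊ : ℕ) : ℝ) < n - (K - k) * I.blockLen ε v + 1 :=
  Nat.ceil_lt_add_one (h.blockEnd_nonneg hv k)

omit h hv in
theorem le_bd (k : ℕ) :
    (n : ℝ) - (K - k) * I.blockLen ε v ≤ ((⌈I.blockEnd ε v K k⌉₊ : ℕ) : ℝ) :=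
  Nat.le_ceil (I.blockEnd ε v K k)

theorem card_block_le (k : Fin K) : ((⌈I.blockEnd ε v K (k + 1 : ℕ)⌉₊ : ℕ) : ℝ) -
    (⌈I.blockEnd ε v K k⌉₊ : ℕ) ≤ I.blockLen ε v + 1 := by
  have h1 := h.bd_lt hv (k + 1)
  have h2 := le_bd (I := I) (ε := ε) (K := K) (v := v) k
  push_cast at h1
  linarith

theorem le_card_block (k : Fin K) : I.blockLen ε v - 1 ≤
    ((⌈I.blockEnd ε v K (k + 1 : ℕ)⌉₊ : ℕ) : ℝ) - (⌈I.blockEnd ε v K k⌉₊ : ℕ) := by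
  have h1 := h.bd_lt hv k
  have h2 := le_bd (I := I) (ε := ε) (K := K) (v := v) (k + 1)
  push_cast at h2
  linarith

end Regime

end Instance

end ProphetSecretary

/-! ### Class values against the game value; probability of atypical orders -/

namespace ProphetSecretary

set_option linter.unusedSectionVars false

namespace Instance

variable {n : ℕ} {I : Instance n} {ε : ℝ} {K : ℕ}

theorem mem_remaining_refl {a : ℕ} {t : Fin n} : t ∈ remaining (Equiv.refl (Fin n)) a ↔ a ≤ t := by
  simp [mem_remaining]

theorem card_block (hε : 0 ≤ ε) (v : {v // v ∈ I.classes ε}) (k : Fin K) :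
    ((I.block ε v K k).card : ℝ) = ((⌈I.blockEnd ε v K (k + 1 : ℕ)⌉₊ : ℕ) : ℝ) -
      (⌈I.blockEnd ε v K k⌉₊ : ℕ) := by
  have h1 : ⌈I.blockEnd ε v K k⌉₊ ≤ ⌈I.blockEnd ε v K (k + 1 : ℕ)⌉₊ :=
    (I.blocks K hε).bd_mono v (Nat.le_succ k)
  have h2 : ⌈I.blockEnd ε v K (k + 1 : ℕ)⌉₊ ≤ n := (I.blocks K hε).bd_le v k
  have e : I.block ε v K k = remaining (Equiv.refl (Fin n)) ⌈I.blockEnd ε v K k⌉₊ \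
      remaining (Equiv.refl (Fin n)) ⌈I.blockEnd ε v K (k + 1 : ℕ)⌉₊ := by
    ext t
    rw [mem_block, Finset.mem_sdiff, mem_remaining_refl, mem_remaining_refl, not_le]
  have hsub : remaining (Equiv.refl (Fin n)) ⌈I.blockEnd ε v K (k + 1 : ℕ)⌉₊ ⊆
      remaining (Equiv.refl (Fin n)) ⌈I.blockEnd ε v K k⌉₊ := fun t ht =>
    mem_remaining_refl.mpr (h1.trans (mem_remaining_refl.mp ht))
  rw [e, Finset.card_sdiff_of_subset hsub, card_remaining, card_remaining, ← Nat.cast_sub h1]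
  congr 1
  omega

theorem mass_eq (hε : 0 ≤ ε) (v : {v // v ∈ I.classes ε}) (k : Fin K) (σ : Equiv.Perm (Fin n)) :
    (I.blocks K hε).mass (v, k) n σ =
      ∑ i ∈ I.small ε v, I.q i * ind (σ.symm i ∈ I.block ε v K k) := by
  rw [Blocks.mass, ← Equiv.sum_comp σ.symm, ← Finset.sum_subset (Finset.subset_univ (I.small ε v))]
  · refine Finset.sum_congr rfl fun i hi => ?_
    rw [Equiv.apply_symm_apply]
    by_cases hb : σ.symm i ∈ I.block ε v K k
    · obtain ⟨h1, h2⟩ := mem_block.mp hb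
      rw [ind_pos hb, mul_one, if_pos]
      exact ⟨h1, h2, (σ.symm i).2, classOf_eq_some_iff.mpr hi⟩
    · rw [ind_neg hb, mul_zero, if_neg]
      exact fun h' => hb (mem_block.mpr ⟨h'.1, h'.2.1⟩)
  · intro i _ hi
    rw [if_neg]
    rintro ⟨-, -, -, h'⟩
    rw [Equiv.apply_symm_apply] at h'
    exact hi (classOf_eq_some_iff.mp h')

theorem sum_block_eq (hε : 0 ≤ ε) (v : {v // v ∈ I.classes ε}) (k : Fin K)
    (σ : Equiv.Perm (Fin n)) [DecidablePred fun t => σ t ∈ I.small ε v] :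
    ∑ t ∈ I.block ε v K k with σ t ∈ I.small ε v, I.q (σ t) =
      (I.blocks K hε).mass (v, k) n σ := by
  rw [Blocks.mass, ← Finset.sum_filter]
  refine Finset.sum_congr ?_ fun _ _ => rfl
  ext t
  rw [Finset.mem_filter, Finset.mem_filter, mem_block]
  constructor
  · rintro ⟨⟨h1, h2⟩, h3⟩
    exact ⟨Finset.mem_univ _, h1, h2, t.2, classOf_eq_some_iff.mpr h3⟩
  · rintro ⟨-, h1, h2, -, h3⟩
    exact ⟨⟨h1, h2⟩, classOf_eq_some_iff.mp h3⟩

variable (I ε K)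

/-- Some block has a mass that is off by more than the tolerance. -/
def Atypical (hε : 0 ≤ ε) (σ : Equiv.Perm (Fin n)) : Prop :=
  ∃ i : {v // v ∈ I.classes ε} × Fin K,
    I.tol ε i.1 * I.blockMass ε i.1 < |(I.blocks K hε).mass i n σ - I.blockMass ε i.1|

variable {I ε K}

namespace Regime

variable (h : I.Regime ε K)

include h

theorem blockLen_ge {v : ℝ} (hv : v ∈ I.classes ε) : 8 ≤ I.blockLen ε v := by
  have h1 := h.one_le_mul_blockLen hv
  have h2 := h.tol_sq_le hv
  have h3 := h.blockLen_pos hv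
  have h4 : ε * I.tol ε v ^ 2 ≤ 1 / 100 := by
    have h5 : ε ^ 5 ≤ 1 := pow_le_one₀ h.pos.le h.lt_one.le
    nlinarith [h.pos, h.le, sq_nonneg (I.tol ε v)]
  nlinarith

theorem q_le {v : ℝ} {i : Fin n} (hi : i ∈ I.small ε v) : I.q i ≤ 1 / 2 := by
  have h1 := q_le_maxMass hi
  have h2 := h.maxMass_le (v := v)
  have h3 := h.pow_le (a := 20) (b := 1) (by norm_num)
  rw [pow_one] at h3
  linarith [h.le]

/-- The value of a class, weighted with its mass, is covered by the value of the game. -/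
theorem val_mul_min_le (v : {v // v ∈ I.classes ε}) :
    v.1 * min 1 (I.totalMass ε v) ≤ 8 * (I.blocks K h.pos.le).contValue n Finset.univ := by
  set B := I.blocks K h.pos.le with hB
  set J := I.small ε v.1 with hJ
  set A := remaining (Equiv.refl (Fin n)) (B.bd v 0) with hA
  have hn := h.n_pos' v.2
  have hv := h.val_pos v.2
  have hfac : (0 : ℝ) < n.factorial := by exact_mod_cast n.factorial_pos
  have h1 := B.mul_sum_ind_le J v.1
  have h2 : ∑ ω, I.weight ω * ind (∃ j ∈ J.filter (fun j => ω.1.symm j ∈ A), ω.2 j = true) ≤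
      ∑ ω, I.weight ω * ind (∃ t : Fin n, ω.1 t ∈ J ∧ ω.2 (ω.1 t) = true ∧
        B.gain t (ω.1 t) = v.1) := by
    refine Finset.sum_le_sum fun ω _ => mul_le_mul_of_nonneg_left ?_ (I.weight_nonneg ω)
    by_cases hex : ∃ j ∈ J.filter (fun j => ω.1.symm j ∈ A), ω.2 j = true
    · obtain ⟨j, hj, hb⟩ := hex
      rw [Finset.mem_filter] at hj
      rw [ind_pos ⟨j, Finset.mem_filter.mpr hj, hb⟩, ind_pos]
      refine ⟨ω.1.symm j, ?_⟩
      rw [Equiv.apply_symm_apply]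
      refine ⟨hj.1, hb, ?_⟩
      have hc : B.cls j = some v := classOf_eq_some_iff.mpr hj.1
      have := mem_remaining_refl.mp hj.2
      simp only [Blocks.gain, hc]
      rw [if_neg (not_lt.mpr this)]
      exact (mem_small.mp hj.1).1
    · rw [ind_neg hex]
      exact ind_nonneg _
  have h3 : ∑ ω, I.weight ω * ind (∃ j ∈ J.filter (fun j => ω.1.symm j ∈ A), ω.2 j = true) =
      1 - (∑ σ : Equiv.Perm (Fin n), ∏ j ∈ J, (1 + -I.prob j * ind (σ.symm j ∈ A))) /
        n.factorial := by
    rw [sum_weight_mul I fun ω => ind (∃ j ∈ J.filter (fun j => ω.1.symm j ∈ A), ω.2 j = true)]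
    have e : ∀ σ : Equiv.Perm (Fin n), ∑ b, bitWeight I.prob b *
        ind (∃ j ∈ J.filter (fun j => σ.symm j ∈ A), b j = true) =
        1 - ∏ j ∈ J, (1 + -I.prob j * ind (σ.symm j ∈ A)) := fun σ => by
      change I.hitProb _ = _
      rw [hitProb_eq, Finset.prod_filter]
      congr 1
      refine Finset.prod_congr rfl fun j _ => ?_
      by_cases hj : σ.symm j ∈ A
      · rw [if_pos hj, ind_pos hj]; ring
      · rw [if_neg hj, ind_neg hj]; ring
    simp only [e]
    rw [Finset.sum_sub_distrib, sub_div, Finset.sum_const, Finset.card_univ, Fintype.card_perm,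
      Fintype.card_fin, nsmul_eq_mul, mul_one, div_self hfac.ne']
  have h4 := sum_perm_prod_le A J (c := fun j => -I.prob j)
    (fun j => by linarith [I.prob_le_one j]) (Or.inr fun j => by linarith [I.prob_pos j])
  have h5 : ∏ j ∈ J, (1 + -I.prob j * ((A.card : ℝ) / n)) ≤
      Real.exp (-((A.card : ℝ) / n * ∑ j ∈ J, I.prob j)) := by
    rw [Finset.mul_sum, ← Finset.sum_neg_distrib, Real.exp_sum]
    refine Finset.prod_le_prod (fun j _ => ?_) fun j _ => ?_
    · have hβ1 : (A.card : ℝ) / n ≤ 1 := by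
        refine div_le_one_of_le₀ ?_ (Nat.cast_nonneg _)
        exact_mod_cast (Finset.card_le_univ A).trans (Fintype.card_fin n).le
      have hβ0 : 0 ≤ (A.card : ℝ) / n := div_nonneg (Nat.cast_nonneg _) (Nat.cast_nonneg _)
      nlinarith [I.prob_pos j, I.prob_le_one j]
    · linarith [Real.add_one_le_exp (-((A.card : ℝ) / n * I.prob j))]
  -- Rounding up the end of the initial segment costs less than one of at least 8 arrivals.
  have hcard : K * I.blockLen ε v / 2 ≤ A.card := by
    rw [hA, card_remaining, Nat.cast_sub ((B.bd_mono v (Nat.zero_le K)).trans (B.bd_last v).le)]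
    have e1 := h.bd_lt v.2 0
    have e2 := h.blockLen_ge v.2
    have e3 : (1 : ℝ) ≤ K := by exact_mod_cast h.K_pos
    have e4 : ((B.bd v 0 : ℕ) : ℝ) < n - (K - (0 : ℕ)) * I.blockLen ε v + 1 := e1
    rw [Nat.cast_zero, sub_zero] at e4
    nlinarith
  -- For q ≤ 1/2 the probability is at least q(1 - q) ≥ q/2.
  have hp : I.totalMass ε v / 2 ≤ ∑ j ∈ J, I.prob j := by
    rw [totalMass, Finset.sum_div]
    refine Finset.sum_le_sum fun j hj => ?_
    have e1 := h.q_le hj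
    have e2 := q_mul_one_sub_le (mem_small.mp hj).2.1 (by linarith)
    nlinarith [I.q_nonneg j]
  -- The blocks cover a fraction Q*/(total mass) of the arrivals, and Q* ≥ min(1, total mass). The
  -- two losses of a factor 2 give 1/4.
  have hx : min 1 (I.totalMass ε v) / 4 ≤ (A.card : ℝ) / n * ∑ j ∈ J, I.prob j := by
    rw [div_mul_eq_mul_div, le_div_iff₀ hn]
    have e1 : min 1 (I.totalMass ε v) ≤ I.cappedMass ε v := min_le_min_right _ h.one_le_inv
    have e2 := h.K_mul_blockLen_mul v.2
    have e3 := mul_le_mul hcard hp (div_nonneg (h.totalMass_pos v.2).le zero_le_two)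
      (Nat.cast_nonneg _)
    have e4 := mul_le_mul_of_nonneg_right e1 hn.le
    nlinarith
  set x := min 1 (I.totalMass ε v) with hxdef
  have hx0 : 0 < x := lt_min zero_lt_one (h.totalMass_pos v.2)
  have hx1 : x ≤ 1 := min_le_left _ _
  have h6 : x / 8 ≤ 1 - Real.exp (-((A.card : ℝ) / n * ∑ j ∈ J, I.prob j)) := by
    have e1 : Real.exp (-((A.card : ℝ) / n * ∑ j ∈ J, I.prob j)) ≤ Real.exp (-(x / 4)) :=
      Real.exp_le_exp.mpr (by linarith)
    have e2 := exp_le_one_add_add_sq (x := -(x / 4)) (by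
      rw [abs_neg, abs_of_nonneg (by linarith)]; linarith)
    nlinarith
  have h7 : (∑ σ : Equiv.Perm (Fin n), ∏ j ∈ J, (1 + -I.prob j * ind (σ.symm j ∈ A))) /
      n.factorial ≤ Real.exp (-((A.card : ℝ) / n * ∑ j ∈ J, I.prob j)) := by
    rw [div_le_iff₀ hfac, mul_comm]
    exact h4.trans (mul_le_mul_of_nonneg_left h5 hfac.le)
  have h8 := mul_le_mul_of_nonneg_left (show x / 8 ≤ ∑ ω, I.weight ω * ind (∃ t : Fin n,
    ω.1 t ∈ J ∧ ω.2 (ω.1 t) = true ∧ B.gain t (ω.1 t) = v.1) by linarith) hv.le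
  linarith

/-- The expected largest value is covered by the value of the game. -/
theorem meanPeak_le : I.meanPeak ≤
    9 * (I.posValues.card : ℝ) * (I.blocks K h.pos.le).contValue n Finset.univ := by
  set B := I.blocks K h.pos.le with hB
  set C := B.contValue n Finset.univ with hC
  have hC0 : 0 ≤ C := B.contValue_nonneg _ _
  rw [meanPeak_eq, mul_assoc, mul_left_comm, ← nsmul_eq_mul]
  refine Finset.sum_le_card_nsmul _ _ _ fun u hu => ?_
  have hu0 := (mem_posValues.mp hu).2
  -- Variables that are not small are never dead, so waiting for them gives at most C; small ones
  -- give at most 8C. Together this is the 9 per value.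
  set J₁ := (Finset.univ.filter fun j => I.value j = u).filter (fun j => j ∉ I.small ε u) with hJ₁
  have hsplit : I.hitProb (Finset.univ.filter fun j => I.value j = u) ≤
      I.hitProb J₁ + I.hitProb (I.small ε u) := by
    unfold hitProb
    rw [← Finset.sum_add_distrib]
    refine Finset.sum_le_sum fun b _ => ?_
    rw [← mul_add]
    refine mul_le_mul_of_nonneg_left ?_ (I.bitWeight_prob_nonneg b)
    by_cases hex : ∃ j ∈ Finset.univ.filter fun j => I.value j = u, b j = true
    · obtain ⟨j, hj, hb⟩ := hex
      refine (ind_le_one _).trans ?_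
      by_cases hs : j ∈ I.small ε u
      · have : ind (∃ j ∈ I.small ε u, b j = true) = 1 := ind_pos ⟨j, hs, hb⟩
        linarith [ind_nonneg (∃ j ∈ J₁, b j = true)]
      · have : ind (∃ j ∈ J₁, b j = true) = 1 := ind_pos ⟨j, Finset.mem_filter.mpr ⟨hj, hs⟩, hb⟩
        linarith [ind_nonneg (∃ j ∈ I.small ε u, b j = true)]
    · rw [ind_neg hex]
      exact add_nonneg (ind_nonneg _) (ind_nonneg _)
  have h1 : u * I.hitProb J₁ ≤ C := by
    refine le_trans (le_of_eq ?_) (B.mul_sum_ind_le J₁ u)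
    rw [hitProb, ← sum_weight_mul_snd I (fun b => ind (∃ j ∈ _, b j = true))]
    congr 1
    refine Finset.sum_congr rfl fun ω _ => ?_
    congr 1
    refine ind_congr ⟨?_, ?_⟩
    · rintro ⟨j, hj, hb⟩
      refine ⟨ω.1.symm j, ?_⟩
      rw [Equiv.apply_symm_apply]
      refine ⟨hj, hb, ?_⟩
      obtain ⟨h2, h3⟩ := Finset.mem_filter.mp hj
      have hval : I.value j = u := (Finset.mem_filter.mp h2).2
      have hc : B.cls j = none := classOf_eq_none_iff.mpr fun h' => h3 (by
        rw [← hval]; exact h'.2)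
      simp only [Blocks.gain, hc, hval]
    · rintro ⟨t, h2, h3, -⟩
      exact ⟨_, h2, h3⟩
  have h2 : u * I.hitProb (I.small ε u) ≤ 8 * C := by
    by_cases hne : (I.small ε u).Nonempty
    · have hcl : u ∈ I.classes ε := mem_classes.mpr ⟨hu0, hne⟩
      refine le_trans ?_ (h.val_mul_min_le ⟨u, hcl⟩)
      refine mul_le_mul_of_nonneg_left (le_min (I.hitProb_le_one _) ?_) hu0.le
      exact (I.hitProb_le_sum _).trans
        (Finset.sum_le_sum fun j hj => prob_le_q (mem_small.mp hj).2.1)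
    · rw [Finset.not_nonempty_iff_eq_empty.mp hne, hitProb_eq]
      simp only [Finset.prod_empty, sub_self, mul_zero]
      linarith
  have h3 := mul_le_mul_of_nonneg_left hsplit hu0.le
  linarith

theorem tol_le_eps {v : ℝ} (hv : v ∈ I.classes ε) : I.tol ε v ≤ ε := by
  have h1 := h.tol_le hv
  have h2 := h.pow_le (a := 2) (b := 1) (by norm_num)
  rw [pow_one] at h2
  linarith

theorem atypical_of_fails {σ : Equiv.Perm (Fin n)} (hσ : I.Fails ε K σ) :
    I.Atypical ε K h.pos.le σ := by
  obtain ⟨i, hi, k, hk⟩ := hσ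
  by_cases hne : (I.small ε (I.value i)).Nonempty
  · have hcl : I.value i ∈ I.classes ε := mem_classes.mpr ⟨hi, hne⟩
    by_contra hnot
    refine hk ?_
    have h1 : |(I.blocks K h.pos.le).mass (⟨I.value i, hcl⟩, k) n σ -
        I.blockMass ε (I.value i)| ≤ I.tol ε (I.value i) * I.blockMass ε (I.value i) :=
      not_lt.mp fun hlt => hnot ⟨(⟨I.value i, hcl⟩, k), hlt⟩
    have h2 := mul_le_mul_of_nonneg_right (h.tol_le_eps hcl) (h.blockMass_pos hcl).le
    rw [sum_block_eq h.pos.le ⟨I.value i, hcl⟩ k σ]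
    rw [abs_le] at h1
    constructor <;> linarith [h1.1, h1.2]
  -- Without small variables the nominal block mass and the arriving mass are both 0, so such a
  -- value never causes failure.
  · have he := Finset.not_nonempty_iff_eq_empty.mp hne
    have h0 : I.blockMass ε (I.value i) = 0 := by
      rw [blockMass, cappedMass, totalMass, he, Finset.sum_empty,
        min_eq_right (one_div_nonneg.mpr h.pos.le), mul_zero]
    refine absurd ?_ hk
    rw [h0, Finset.sum_eq_zero]
    · simp
    · intro t ht
      have := (Finset.mem_filter.mp ht).2
      rw [he] at this
      simp at this

/-- Half of the tolerance absorbs the rounding of the block, the other half is a Chernoff deviation.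
-/
theorem orderProb_block_le (v : {v // v ∈ I.classes ε}) (k : Fin K) :
    orderProb (fun σ => I.tol ε v * I.blockMass ε v <
      |(I.blocks K h.pos.le).mass (v, k) n σ - I.blockMass ε v|) ≤
      2 * Real.exp (-(1 / (32 * ε))) := by
  have hfac : (0 : ℝ) < n.factorial := by exact_mod_cast n.factorial_pos
  have hn := h.n_pos' v.2
  have hA := h.maxMass_pos v.2
  have hAeq := h.maxMass_eq v.2
  have hη := h.tol_pos v.2
  have hη1 : I.tol ε v ≤ 1 / 100 := (h.tol_le_eps v.2).trans h.le
  have hQo := h.blockMass_pos v.2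
  have hQb := h.totalMass_pos v.2
  have hL := h.blockLen_pos v.2
  set η := I.tol ε v.1
  set A := I.maxMass ε v.1
  set Qo := I.blockMass ε v.1
  set Qb := I.totalMass ε v.1
  set L := I.blockLen ε v.1
  set bl := I.block ε v.1 K k with hbl
  have hcard1 : (bl.card : ℝ) ≤ L + 1 := by
    rw [card_block h.pos.le v k]; exact h.card_block_le v.2 k
  have hcard2 : L - 1 ≤ (bl.card : ℝ) := by
    rw [card_block h.pos.le v k]; exact h.le_card_block v.2 k
  have hLQ : L * Qb = Qo * n := h.blockLen_mul v.2
  have hround : Qb / n ≤ η * Qo / 2 := by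
    have e1 : 1 ≤ ε * η ^ 2 * L := h.one_le_mul_blockLen v.2
    rw [div_le_iff₀ hn]
    have e2 := mul_le_mul_of_nonneg_right e1 hQb.le
    have e3 : ε * η ^ 2 * L * Qb = ε * η * (η * Qo * n) := by
      rw [mul_assoc, hLQ]; ring
    have e4 : ε * η ≤ 1 / 2 := by nlinarith [h.pos, h.le]
    have e5 : 0 ≤ η * Qo * n := by positivity
    nlinarith
  have hmean : |(bl.card : ℝ) / n * Qb - Qo| ≤ Qb / n := by
    have e1 : Qo = L / n * Qb := by
      rw [div_mul_eq_mul_div, hLQ, mul_div_cancel_right₀ _ hn.ne']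
    have e2 : (bl.card : ℝ) / n * Qb - Qo = (bl.card - L) * (Qb / n) := by
      rw [e1]; ring
    rw [e2, abs_mul, abs_of_pos (div_pos hQb hn)]
    have e3 : |(bl.card : ℝ) - L| ≤ 1 := abs_le.mpr ⟨by linarith, by linarith⟩
    nlinarith [div_pos hQb hn]
  have hch := sum_perm_deviation_le bl (I.small ε v.1) (a := I.q) (A := A) (lam := η / (8 * A))
    (d := η * Qo / 2) I.q_nonneg (fun i hi => q_le_maxMass hi) (by positivity) (by
      rw [div_mul_eq_mul_div, div_le_one (by positivity)]
      nlinarith)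
  -- With mean at most 2Q° and λ = η/(8A), the exponent is η²Q°/(32A) - η²Q°/(16A) = -η²Q°/(32A),
  -- and A = εη²Q°.
  have hexp : (η / (8 * A)) ^ 2 * A * ((bl.card : ℝ) / n * Qb) - η / (8 * A) * (η * Qo / 2) ≤
      -(1 / (32 * ε)) := by
    have e1 : (bl.card : ℝ) / n * Qb ≤ 2 * Qo := by
      have := (abs_le.mp hmean).2
      nlinarith
    have e2 := mul_le_mul_of_nonneg_left e1 (show 0 ≤ (η / (8 * A)) ^ 2 * A by positivity)
    refine (sub_le_sub_right e2 _).trans (le_of_eq ?_)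
    have hε := h.pos
    rw [hAeq]
    field_simp
    norm_num
  rw [orderProb, div_le_iff₀ hfac, mul_comm (2 * Real.exp _)]
  refine le_trans (Finset.sum_le_sum fun σ _ => ?_) (hch.trans (mul_le_mul_of_nonneg_left
    (mul_le_mul_of_nonneg_left (Real.exp_le_exp.mpr hexp) zero_le_two) hfac.le))
  by_cases hσ : η * Qo < |(I.blocks K h.pos.le).mass (v, k) n σ - Qo|
  · rw [ind_pos hσ, ind_pos]
    rw [mass_eq] at hσ
    have e1 := abs_sub_le (∑ i ∈ I.small ε v, I.q i * ind (σ.symm i ∈ bl))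
      ((bl.card : ℝ) / n * Qb) Qo
    have e2 : ∑ i ∈ I.small ε v.1, I.q i = Qb := rfl
    rw [e2]
    linarith
  · rw [ind_neg hσ]
    exact ind_nonneg _

omit h in
theorem card_classes_le : Fintype.card {v // v ∈ I.classes ε} ≤ I.posValues.card := by
  rw [Fintype.card_coe]
  exact Finset.card_filter_le _ _

theorem orderProb_atypical_le : orderProb (I.Atypical ε K h.pos.le) ≤
    I.posValues.card * K * (2 * Real.exp (-(1 / (32 * ε)))) := by
  have h1 : orderProb (I.Atypical ε K h.pos.le) ≤ ∑ i : {v // v ∈ I.classes ε} × Fin K,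
      orderProb (fun σ => I.tol ε i.1 * I.blockMass ε i.1 <
        |(I.blocks K h.pos.le).mass i n σ - I.blockMass ε i.1|) := by
    simp only [orderProb]
    rw [← Finset.sum_div, Finset.sum_comm]
    refine div_le_div_of_nonneg_right (Finset.sum_le_sum fun σ _ => ?_) (Nat.cast_nonneg _)
    by_cases hσ : I.Atypical ε K h.pos.le σ
    · rw [ind_pos hσ]
      obtain ⟨i, hi⟩ := hσ
      have := Finset.single_le_sum (f := fun i : {v // v ∈ I.classes ε} × Fin K =>
        ind (I.tol ε i.1 * I.blockMass ε i.1 <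
          |(I.blocks K h.pos.le).mass i n σ - I.blockMass ε i.1|))
        (fun _ _ => ind_nonneg _) (Finset.mem_univ i)
      rwa [ind_pos hi] at this
    · rw [ind_neg hσ]
      exact Finset.sum_nonneg fun _ _ => ind_nonneg _
  refine h1.trans ((Finset.sum_le_card_nsmul _ _ _ fun i _ =>
    h.orderProb_block_le i.1 i.2).trans ?_)
  rw [nsmul_eq_mul, Finset.card_univ, Fintype.card_prod, Fintype.card_fin, Nat.cast_mul]
  gcongr
  exact card_classes_le

end Regime

end Instance

end ProphetSecretary

namespace ProphetSecretary

set_option linter.unusedSectionVars false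

/-! ### Elementary sums -/

/-- The terms telescope through 1/m ≤ log m - log(m - 1); the truncated logarithm makes this an
induction on the range. -/
theorem sum_range_inv_le {a b : ℝ} (ha : 1 < a) (hab : a ≤ b) (N : ℕ) :
    ∑ m ∈ Finset.range N, (if a < m ∧ (m : ℝ) ≤ b then 1 / (m : ℝ) else 0) ≤
      Real.log (b / (a - 1)) := by
  have ha0 : 0 < a - 1 := by linarith
  have hpos : ∀ x : ℝ, 0 < max (a - 1) x := fun x => lt_max_of_lt_left ha0
  have key : ∑ m ∈ Finset.range N, (if a < m ∧ (m : ℝ) ≤ b then 1 / (m : ℝ) else 0) ≤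
      Real.log (max (a - 1) (min ((N : ℝ) - 1) b)) - Real.log (a - 1) := by
    induction N with
    | zero =>
      have := Real.log_le_log ha0 (le_max_left (a - 1) (min (((0 : ℕ) : ℝ) - 1) b))
      simpa using this
    | succ N ih =>
      rw [Finset.sum_range_succ]
      have e : ((N + 1 : ℕ) : ℝ) - 1 = N := by push_cast; ring
      rw [e]
      split_ifs with hN
      · obtain ⟨h1, h2⟩ := hN
        have h3 : (1 : ℝ) < N := ha.trans h1
        have h4 : max (a - 1) (min ((N : ℝ) - 1) b) ≤ N - 1 :=
          max_le (by linarith) (min_le_left _ _)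
        have h5 := Real.log_le_log (hpos _) h4
        have h6 : max (a - 1) (min (N : ℝ) b) = N := by
          rw [min_eq_left h2, max_eq_right (by linarith)]
        have h7 := Real.log_le_sub_one_of_pos (x := ((N : ℝ) - 1) / N)
          (div_pos (by linarith) (by linarith))
        rw [Real.log_div (by linarith) (by linarith)] at h7
        have h8 : ((N : ℝ) - 1) / N - 1 = -(1 / N) := by
          field_simp; ring
        rw [h6]
        linarith
      · have := Real.log_le_log (hpos (min ((N : ℝ) - 1) b))
          (max_le_max_left (a - 1) (min_le_min_right b (by linarith : (N : ℝ) - 1 ≤ N)))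
        linarith
  refine key.trans ?_
  rw [Real.log_div (by linarith) ha0.ne']
  have : max (a - 1) (min ((N : ℝ) - 1) b) ≤ b := max_le (by linarith) (min_le_right _ _)
  linarith [Real.log_le_log (hpos _) this]

theorem sum_range_inv_sq_le {a : ℝ} (ha : 1 < a) (N : ℕ) :
    ∑ m ∈ Finset.range N, (if a < m then 1 / (m : ℝ) ^ 2 else 0) ≤ 1 / (a - 1) := by
  have ha0 : 0 < a - 1 := by linarith
  have hpos : ∀ x : ℝ, 0 < max (a - 1) x := fun x => lt_max_of_lt_left ha0
  have key : ∑ m ∈ Finset.range N, (if a < m then 1 / (m : ℝ) ^ 2 else 0) ≤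
      1 / (a - 1) - 1 / max (a - 1) ((N : ℝ) - 1) := by
    induction N with
    | zero =>
      have := one_div_le_one_div_of_le ha0 (le_max_left (a - 1) (((0 : ℕ) : ℝ) - 1))
      simpa using this
    | succ N ih =>
      rw [Finset.sum_range_succ]
      have e : ((N + 1 : ℕ) : ℝ) - 1 = N := by push_cast; ring
      rw [e]
      split_ifs with hN
      · have h3 : (1 : ℝ) < N := ha.trans hN
        rw [max_eq_right (by linarith)] at ih
        rw [max_eq_right (by linarith)]
        have h4 : 1 / (N : ℝ) ^ 2 ≤ 1 / (N - 1) - 1 / N := by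
          rw [div_sub_div _ _ (by linarith) (by linarith), div_le_div_iff₀ (by positivity)
            (by nlinarith)]
          nlinarith
        linarith
      · have := one_div_le_one_div_of_le (hpos ((N : ℝ) - 1))
          (max_le_max_left (a - 1) (by linarith : (N : ℝ) - 1 ≤ N))
        linarith
  have := one_div_nonneg.mpr (hpos ((N : ℝ) - 1)).le
  linarith

theorem sum_range_one_le {b : ℝ} (hb : 0 ≤ b) (N : ℕ) :
    ∑ m ∈ Finset.range N, (if (m : ℝ) + 1 ≤ b then (1 : ℝ) else 0) ≤ b := by
  have key : ∑ m ∈ Finset.range N, (if (m : ℝ) + 1 ≤ b then (1 : ℝ) else 0) ≤ min (N : ℝ) b := by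
    induction N with
    | zero => simp [hb]
    | succ N ih =>
      rw [Finset.sum_range_succ]
      split_ifs with h
      · push_cast
        rw [min_eq_left h]
        linarith [min_le_left (N : ℝ) b]
      · rw [add_zero]
        exact ih.trans (min_le_min_right b (by push_cast; linarith))
  exact key.trans (min_le_right _ _)

theorem chainCost_sum_weights {α κ : Type*} [DecidableEq α] (A : Finset κ) (g : κ → ℕ → ℝ)
    (f : κ → ℕ → Finset α → ℝ) (m : ℕ) (S : Finset α) :
    chainCost 1 (fun m S => ∑ v ∈ A, g v m * f v m S) m S =
      ∑ v ∈ A, chainCost (g v) (f v) m S := by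
  induction m generalizing S with
  | zero => simp [chainCost]
  | succ m ih =>
    simp only [chainCost, Pi.one_apply, one_mul]
    rw [Finset.sum_add_distrib, funext ih, eraseMean_sum]

theorem chainCost_one_mul {α : Type*} [DecidableEq α] (g : ℕ → ℝ) (f : ℕ → Finset α → ℝ) (m : ℕ)
    (S : Finset α) : chainCost 1 (fun m S => g m * f m S) m S = chainCost g f m S := by
  have := chainCost_sum_weights (Finset.univ : Finset Unit) (fun _ => g) (fun _ => f) m S
  simpa using this

namespace Blocks

variable {n K : ℕ} {ι : Type} {I : Instance n} (B : Blocks I K ι) [Fintype ι] [DecidableEq ι]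

/-- The indicator of the non-final blocks of a class. -/
noncomputable def window (v : ι) (m : ℕ) : ℝ := ∑ k : Fin K, B.blockIndicator (v, k) m

variable {B}

theorem window_nonneg (v : ι) (m : ℕ) : 0 ≤ B.window v m :=
  Finset.sum_nonneg fun _ _ => blockIndicator_nonneg _ _

theorem exists_of_window_ne_zero {v : ι} {m : ℕ} (h : B.window v m ≠ 0) :
    ∃ k : Fin K, (v, k) ∈ B.current (n - 1 - m) := by
  obtain ⟨k, -, hk⟩ := Finset.exists_ne_zero_of_sum_ne_zero h
  refine ⟨k, ?_⟩
  by_contra hnot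
  exact hk (if_neg hnot)

theorem window_le_one (v : ι) (m : ℕ) : B.window v m ≤ 1 := by
  by_cases h : B.window v m = 0
  · rw [h]; exact zero_le_one
  · obtain ⟨k, hk⟩ := exists_of_window_ne_zero h
    rw [window, Finset.sum_eq_single k]
    · rw [blockIndicator, if_pos hk]
    · intro k' _ hne
      refine if_neg fun h' => hne (Fin.ext ?_)
      rw [mem_current] at hk h'
      exact B.block_unique h'.2.1 h'.2.2 hk.2.1 hk.2.2
    · simp

theorem sum_regular_le {f : ι → ℝ} (hf : ∀ v, 0 ≤ f v) :
    ∑ i ∈ regular (K := K), f i.1 * chainCost (B.blockIndicator i) B.holdCost n Finset.univ ≤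
      ∑ v, f v * chainCost (B.window v) B.holdCost n Finset.univ := by
  have h1 : ∀ v, chainCost (B.window v) B.holdCost n Finset.univ =
      ∑ k : Fin K, chainCost (B.blockIndicator (v, k)) B.holdCost n Finset.univ := fun v => by
    rw [← chainCost_sum_weights, ← chainCost_one_mul]
    simp only [window, Finset.sum_mul]
  simp only [h1, Finset.mul_sum]
  rw [← Fintype.sum_prod_type (fun i : ι × Fin K =>
    f i.1 * chainCost (B.blockIndicator i) B.holdCost n Finset.univ)]
  exact Finset.sum_le_sum_of_subset_of_nonneg (Finset.subset_univ _) fun i _ _ =>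
    mul_nonneg (hf _) (chainCost_nonneg (blockIndicator_nonneg i) holdCost_nonneg _ _)

theorem sum_final_le {f : ι → ℝ} (hf : ∀ v, 0 ≤ f v) :
    ∑ i ∈ final (K := K), f i.1 ≤ ∑ v, f v := by
  rw [final, Finset.sum_filter, Fintype.sum_prod_type]
  refine Finset.sum_le_sum fun v _ => ?_
  by_cases h : ∃ k : Fin K, ¬ (k : ℕ) + 1 < K
  · obtain ⟨k, hk⟩ := h
    rw [Finset.sum_eq_single k]
    · rw [if_pos hk]
    · intro k' _ hne
      refine if_neg fun h' => hne (Fin.ext ?_)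
      have h1 := k.2
      have h2 := k'.2
      simp only at h'
      omega
    · simp
  · rw [Finset.sum_eq_zero]
    · exact hf v
    · exact fun k _ => if_neg fun h' => h ⟨k, h'⟩

/-- The discrepancy cost of a class. -/
noncomputable def classCost (B : Blocks I K ι) (r : ι → ℝ) (v : ι) (m : ℕ) (S : Finset (Fin n)) :
    ℝ :=
  B.val v * max 0 (r v - B.rate v S) + r v * (1 / m * B.contValue (m + 1) S)

theorem chainCost_rateCost (r : ι → ℝ) :
    chainCost 1 (B.rateCost r) n Finset.univ =
      ∑ v, chainCost (B.window v) (B.classCost r v) n Finset.univ := by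
  rw [← chainCost_sum_weights]
  congr 1
  funext m S
  have hcur : B.current (n - 1 - m) =
      Finset.univ.filter fun i => i ∈ B.current (n - 1 - m) := by ext; simp
  rw [rateCost, hcur, Finset.sum_filter, Fintype.sum_prod_type]
  refine Finset.sum_congr rfl fun v _ => ?_
  rw [window, Finset.sum_mul]
  refine Finset.sum_congr rfl fun k _ => ?_
  unfold blockIndicator classCost
  split_ifs <;> ring

/-- The drift part telescopes to at most the initial value, since blocks of one class do not
overlap; the stability part is a supermartingale weighted by 1/m. -/
theorem chainCost_window_holdCost_le (v : ι) :
    chainCost (B.window v) B.holdCost n Finset.univ ≤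
      (2 + ∑ m ∈ Finset.range n, B.window v m * (1 / m)) * B.contValue n Finset.univ := by
  have hp : ∀ i, 0 ≤ I.prob i := fun i => (I.prob_pos i).le
  have e : B.holdCost = fun m S => 2 * B.drift m S + 1 / (m : ℝ) * B.contValue (m + 1) S := by
    funext m S
    unfold holdCost
    ring
  rw [e, chainCost_add, chainCost_const_mul]
  have h1 := chainCost_stopDrift_le hp (fun m j => B.gain (n - 1 - m) j)
    (window_le_one (B := B) v) n Finset.univ
  have h2 := chainCost_mul_stopValue_le hp (fun m j => B.gain (n - 1 - m) j)
    (window_nonneg (B := B) v) (h := fun m => 1 / (m : ℝ))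
    (fun m => one_div_nonneg.mpr (Nat.cast_nonneg m)) n Finset.univ
  change chainCost (B.window v) B.drift n Finset.univ ≤ 1 * B.contValue n Finset.univ at h1
  change chainCost (B.window v) (fun m S => 1 / (m : ℝ) * B.contValue (m + 1) S) n Finset.univ ≤
    (∑ m ∈ Finset.range n, B.window v m * (1 / m)) * B.contValue n Finset.univ at h2
  linarith

theorem chainCost_window_classCost_le {r : ι → ℝ} (hr : ∀ v, 0 ≤ r v) (v : ι) {A lam μ : ℝ}
    (hA : ∀ j, B.cls j = some v → I.prob j ≤ A) (hA0 : 0 ≤ A) (hlam : 0 < lam)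
    (hμ : B.rate v Finset.univ = μ) :
    chainCost (B.window v) (B.classCost r v) n Finset.univ ≤
      B.val v * (lam / 2 * ((∑ i ∈ Finset.range n, (∑ k ∈ Finset.range i, B.window v k) * A /
        (i : ℝ) ^ 2) * μ) + (∑ m ∈ Finset.range n, B.window v m) *
          (max 0 (r v - μ) + 1 / (2 * lam))) +
      r v * ((∑ m ∈ Finset.range n, B.window v m * (1 / m)) * B.contValue n Finset.univ) := by
  have hp : ∀ i, 0 ≤ I.prob i := fun i => (I.prob_pos i).le
  have hcard : (Finset.univ : Finset (Fin n)).card = n := by simp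
  unfold classCost
  rw [chainCost_add, chainCost_const_mul, chainCost_const_mul]
  have h2 := chainCost_mul_stopValue_le hp (fun m j => B.gain (n - 1 - m) j)
    (window_nonneg (B := B) v) (h := fun m => 1 / (m : ℝ))
    (fun m => one_div_nonneg.mpr (Nat.cast_nonneg m)) n Finset.univ
  change chainCost (B.window v) (fun m S => 1 / (m : ℝ) * B.contValue (m + 1) S) n Finset.univ ≤
    (∑ m ∈ Finset.range n, B.window v m * (1 / m)) * B.contValue n Finset.univ at h2
  refine add_le_add (mul_le_mul_of_nonneg_left ?_ (B.val_pos v).le)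
    (mul_le_mul_of_nonneg_left h2 (hr v))
  have h3 : chainCost (B.window v) (fun _ S => max 0 (r v - B.rate v S)) n Finset.univ ≤
      chainCost (B.window v) (fun _ S => lam / 2 * (B.rate v S - μ) ^ 2 +
        (max 0 (r v - μ) + 1 / (2 * lam))) n Finset.univ := by
    refine chainCost_mono (window_nonneg v) (fun m S _ _ => ?_) n Finset.univ hcard
    -- Young's inequality μ - rate ≤ (λ/2)(rate - μ)² + 1/(2λ) turns the one-sided discrepancy into
    -- a variance.
    have e1 : 0 ≤ lam / 2 * (B.rate v S - μ + 1 / lam) ^ 2 := by positivity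
    have e2 : lam / 2 * (B.rate v S - μ + 1 / lam) ^ 2 =
        lam / 2 * (B.rate v S - μ) ^ 2 + (B.rate v S - μ) + 1 / (2 * lam) := by
      field_simp; ring
    have e3 : 0 ≤ lam / 2 * (B.rate v S - μ) ^ 2 := by positivity
    have e4 : 0 ≤ 1 / (2 * lam) := by positivity
    refine max_le (by linarith [le_max_left 0 (r v - μ)]) ?_
    linarith [le_max_right 0 (r v - μ)]
  refine h3.trans ?_
  rw [chainCost_add, chainCost_const_mul, chainCost_const _ _ _ _ hcard]
  refine add_le_add_left (mul_le_mul_of_nonneg_left ?_ (by positivity)) _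
  have h4 := chainCost_sampleMean_sq_le (a := fun j => if B.cls j = some v then I.prob j else 0)
    (fun j => by split_ifs <;> [exact hp j; exact le_rfl]) (A := A)
    (fun j => by split_ifs with hj <;> [exact hA j hj; exact hA0]) μ (window_nonneg (B := B) v) n
    Finset.univ hcard
  change chainCost (B.window v) (fun _ T => (B.rate v T - μ) ^ 2) n Finset.univ ≤
    _ * (B.rate v Finset.univ - μ) ^ 2 + _ * B.rate v Finset.univ at h4
  rw [hμ, sub_self] at h4
  simpa using h4

end Blocks

end ProphetSecretary

/-! ### Nominal masses and rates, and the resulting bound for the potential -/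

namespace ProphetSecretary

set_option linter.unusedSectionVars false

/-- The nominal rate of a block exceeds the true rate by little. -/
theorem excess_le {ε η Q A L x r : ℝ} (hε : 0 < ε) (hε1 : ε ≤ 1 / 100) (hη : 0 < η)
    (hη1 : η ≤ 1 / 100) (hQ : 0 < Q) (hQ1 : Q ≤ 1) (hA : A = ε * η ^ 2 * Q) (hL : 8 ≤ L)
    (hL1 : 1 ≤ ε * η ^ 2 * L) (hx : Q * (1 - A) ≤ L * x) (hr : r = (1 + η) * Q / (L - 1)) :
    L * max 0 (r - x) ≤ 2 * η * Q := by
  set y := ε * η ^ 2 with hy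
  have hy0 : 0 < y := by positivity
  have hy1 : y ≤ η / 100 := by
    have : y = ε * η * η := by rw [hy]; ring
    rw [this]
    have : ε * η ≤ 1 / 100 := by nlinarith
    nlinarith
  have e1 : L * r ≤ (1 + η) * Q * (1 + 2 * y) := by
    have e2 : L * r = (1 + η) * Q * (L / (L - 1)) := by rw [hr]; ring
    rw [e2]
    refine mul_le_mul_of_nonneg_left ?_ (by positivity)
    rw [div_le_iff₀ (by linarith)]
    nlinarith
  have e3 : L * (r - x) ≤ 2 * η * Q := by
    have e5 : A ≤ η / 100 := by
      rw [hA]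
      nlinarith
    have e6 : (1 + η) * (1 + 2 * y) ≤ 1 + η + η / 10 := by nlinarith
    have e7 := mul_le_mul_of_nonneg_left e6 hQ.le
    have e8 := mul_le_mul_of_nonneg_left e5 hQ.le
    have e9 := mul_pos hη hQ
    linarith
  rcases le_total 0 (r - x) with h0 | h0
  · rw [max_eq_right h0]; exact e3
  · rw [max_eq_left h0, mul_zero]; positivity

namespace Instance

variable {n : ℕ} {I : Instance n} {ε : ℝ} {K : ℕ}

variable (I ε) in
/-- The nominal mass of a block. -/
noncomputable def nominalMass (v : {v // v ∈ I.classes ε}) : ℝ :=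
  (1 + I.tol ε v) * I.blockMass ε v

variable (I ε) in
/-- The nominal payment rate of a block. -/
noncomputable def nominalRate (v : {v // v ∈ I.classes ε}) : ℝ :=
  I.nominalMass ε v / (I.blockLen ε v - 1)

variable (I ε) in
/-- An upper bound for the length of a block. -/
noncomputable def nominalLen (v : {v // v ∈ I.classes ε}) : ℝ := I.blockLen ε v + 1

namespace Regime

variable (h : I.Regime ε K)

include h

theorem nominalMass_nonneg (v : {v // v ∈ I.classes ε}) : 0 ≤ I.nominalMass ε v :=
  mul_nonneg (by linarith [h.tol_pos v.2]) (h.blockMass_pos v.2).le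

theorem nominalMass_le (v : {v // v ∈ I.classes ε}) :
    I.nominalMass ε v ≤ 101 / 100 * I.blockMass ε v :=
  mul_le_mul_of_nonneg_right (by linarith [h.tol_le_eps v.2, h.le]) (h.blockMass_pos v.2).le

theorem nominalRate_nonneg (v : {v // v ∈ I.classes ε}) : 0 ≤ I.nominalRate ε v :=
  div_nonneg (h.nominalMass_nonneg v) (by linarith [h.blockLen_ge v.2])

theorem nominalRate_le (v : {v // v ∈ I.classes ε}) : I.nominalRate ε v ≤ ε ^ 3 := by
  have h1 := h.blockLen_ge v.2
  rw [nominalRate, div_le_iff₀ (by linarith)]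
  have h2 := h.nominalMass_le v
  have h3 := h.blockMass_le (v := v)
  have h4 := pow_pos h.pos 3
  nlinarith

theorem nominalRate_mul_len_le (v : {v // v ∈ I.classes ε}) :
    I.nominalRate ε v * I.nominalLen ε v ≤ 2 * I.blockMass ε v := by
  have h1 := h.blockLen_ge v.2
  have h2 := h.nominalMass_le v
  have h3 := h.blockMass_pos v.2
  rw [nominalRate, nominalLen, div_mul_eq_mul_div, div_le_iff₀ (by linarith)]
  nlinarith [h.nominalMass_nonneg v]

theorem optionProb_le (v : {v // v ∈ I.classes ε}) :
    Blocks.optionProb (I.nominalMass ε) v ≤ I.nominalMass ε v := by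
  unfold Blocks.optionProb
  linarith [Real.add_one_le_exp (-I.nominalMass ε v)]

/-- The rate is the nominal mass divided by the least possible length L - 1 of a rounded block, so
the payments over any block cover ρ ≤ Q. -/
theorem nominal : (I.blocks K h.pos.le).Nominal (I.nominalMass ε) (I.nominalRate ε)
    (I.nominalLen ε) (∑ v, I.nominalRate ε v * I.nominalLen ε v * v.1) where
  mass_nonneg := h.nominalMass_nonneg
  rate_nonneg := h.nominalRate_nonneg
  len_nonneg v := by
    have := h.blockLen_ge v.2
    unfold nominalLen; linarith
  prob_le i _ := by
    have h1 := h.blockLen_ge i.1.2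
    refine (h.optionProb_le i.1).trans ?_
    calc I.nominalMass ε i.1 = I.nominalRate ε i.1 * (I.blockLen ε i.1 - 1) := by
          rw [nominalRate, div_mul_cancel₀ _ (by linarith)]
      _ ≤ _ := mul_le_mul_of_nonneg_left (h.le_card_block i.1.2 i.2) (h.nominalRate_nonneg i.1)
  len_le i := h.card_block_le i.1.2 i.2
  pay_le := le_rfl

theorem withinMass_of_not_atypical {σ : Equiv.Perm (Fin n)} (hσ : ¬ I.Atypical ε K h.pos.le σ) :
    (I.blocks K h.pos.le).WithinMass (I.nominalMass ε) n σ := fun i => by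
  have h1 := (abs_le.mp (not_lt.mp fun hlt => hσ ⟨i, hlt⟩)).2
  unfold nominalMass
  linarith

/-- In every block at most 2ηQ° is missing, and the K blocks of a class together have Q° sum Q*, so
each class contributes at most 2ηQ*. -/
theorem sum_sub_mass_le {σ : Equiv.Perm (Fin n)} (hσ : ¬ I.Atypical ε K h.pos.le σ) :
    ∑ i : {v // v ∈ I.classes ε} × Fin K,
      (I.nominalMass ε i.1 - (I.blocks K h.pos.le).mass i n σ) ≤
      I.posValues.card * (2 * (ε ^ 2 * √ε)) := by
  have h1 : ∀ i : {v // v ∈ I.classes ε} × Fin K,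
      I.nominalMass ε i.1 - (I.blocks K h.pos.le).mass i n σ ≤
        2 * (I.tol ε i.1 * I.blockMass ε i.1) := fun i => by
    have h1 := (abs_le.mp (not_lt.mp fun hlt => hσ ⟨i, hlt⟩)).1
    unfold nominalMass
    linarith
  refine (Finset.sum_le_sum fun i _ => h1 i).trans ?_
  rw [Fintype.sum_prod_type]
  have h0 : 0 ≤ ε ^ 2 * √ε := mul_nonneg (pow_nonneg h.pos.le 2) (Real.sqrt_nonneg _)
  have h2 : ∀ v : {v // v ∈ I.classes ε},
      ∑ _k : Fin K, 2 * (I.tol ε v * I.blockMass ε v) ≤ 2 * (ε ^ 2 * √ε) := fun v => by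
    rw [Finset.sum_const, Finset.card_univ, Fintype.card_fin, nsmul_eq_mul]
    have e := h.K_mul_blockMass (v := v)
    have h3 := h.tol_mul_capped_le v.2
    have h4 := mul_le_mul_of_nonneg_left (min_le_left 1 (I.totalMass ε v)) h0
    calc (K : ℝ) * (2 * (I.tol ε v * I.blockMass ε v))
        = 2 * (I.tol ε v * (K * I.blockMass ε v)) := by ring
      _ ≤ _ := by rw [e]; linarith
  refine (Finset.sum_le_card_nsmul _ _ _ fun v _ => h2 v).trans ?_
  rw [nsmul_eq_mul, Finset.card_univ]
  refine mul_le_mul_of_nonneg_right ?_ (by linarith)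
  exact_mod_cast card_classes_le

/-! ### The non-final blocks of a class -/

/-- A non-final block leaves at least about one block length of arrivals, so m ranges over about [L,
KL]. This keeps the sum of 1/m at log(2K), and is the reason for excluding the final block. -/
theorem window_support {v : {v // v ∈ I.classes ε}} {m : ℕ} (hm : m < n)
    (hw : (I.blocks K h.pos.le).window v m ≠ 0) :
    I.blockLen ε v - 1 < m ∧ (m : ℝ) + 1 ≤ K * I.blockLen ε v := by
  set B := I.blocks K h.pos.le
  obtain ⟨k, hk⟩ := Blocks.exists_of_window_ne_zero hw
  rw [Blocks.mem_current] at hk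
  obtain ⟨h1, h2, h3⟩ := hk
  simp only at h1 h2 h3
  have hK := h.K_pos
  have h4 : B.bd v (k + 1) ≤ B.bd v (K - 1) := B.bd_mono v (by omega)
  have h5 : B.bd v 0 ≤ B.bd v k := B.bd_mono v (Nat.zero_le _)
  have h6 : ((B.bd v (K - 1) : ℕ) : ℝ) < n - (K - ((K - 1 : ℕ) : ℝ)) * I.blockLen ε v + 1 :=
    h.bd_lt v.2 (K - 1)
  have h7 : (n : ℝ) - (K - (0 : ℕ)) * I.blockLen ε v ≤ ((B.bd v 0 : ℕ) : ℝ) := le_bd 0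
  have h8 : ((n - m : ℕ) : ℝ) ≤ (B.bd v (K - 1) : ℕ) := by exact_mod_cast (by omega)
  have h9 : ((B.bd v 0 : ℕ) : ℝ) ≤ ((n - 1 - m : ℕ) : ℝ) := by exact_mod_cast h5.trans h2
  rw [Nat.cast_sub hm.le] at h8
  rw [Nat.sub_sub, Nat.cast_sub (by omega)] at h9
  push_cast at h9
  rw [Nat.cast_sub (by omega)] at h6
  push_cast at h6 h7
  constructor <;> linarith

theorem sum_window_div_le (v : {v // v ∈ I.classes ε}) :
    ∑ m ∈ Finset.range n, (I.blocks K h.pos.le).window v m * (1 / m) ≤ Real.log (2 * K) := by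
  have hL := h.blockLen_ge v.2
  have hK : (1 : ℝ) ≤ K := by exact_mod_cast h.K_pos
  have h1 := sum_range_inv_le (a := I.blockLen ε v - 1) (b := K * I.blockLen ε v) (by linarith)
    (by nlinarith) n
  refine le_trans (Finset.sum_le_sum fun m hm => ?_) (h1.trans ?_)
  · by_cases hw : (I.blocks K h.pos.le).window v m = 0
    · rw [hw, zero_mul]
      split_ifs <;> [positivity; exact le_rfl]
    · have h2 := h.window_support (Finset.mem_range.mp hm) hw
      rw [if_pos ⟨h2.1, by linarith⟩]
      exact mul_le_of_le_one_left (by positivity) (Blocks.window_le_one _ _)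
  · refine Real.log_le_log (by
      refine div_pos ?_ ?_ <;> nlinarith) ?_
    rw [div_le_iff₀ (by linarith)]
    nlinarith

theorem sum_window_le (v : {v // v ∈ I.classes ε}) {i : ℕ} (hi : i ≤ n) :
    ∑ m ∈ Finset.range i, (I.blocks K h.pos.le).window v m ≤ K * I.blockLen ε v := by
  have h1 := sum_range_one_le (b := K * I.blockLen ε v)
    (mul_nonneg (Nat.cast_nonneg _) (h.blockLen_pos v.2).le) i
  refine le_trans (Finset.sum_le_sum fun m hm => ?_) h1
  by_cases hw : (I.blocks K h.pos.le).window v m = 0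
  · rw [hw]
    split_ifs <;> norm_num
  · have h2 := h.window_support ((Finset.mem_range.mp hm).trans_le hi) hw
    rw [if_pos h2.2]
    exact Blocks.window_le_one _ _

theorem sum_window_sq_le (v : {v // v ∈ I.classes ε}) {A : ℝ} (hA : 0 ≤ A) :
    ∑ i ∈ Finset.range n, (∑ k ∈ Finset.range i, (I.blocks K h.pos.le).window v k) * A /
      (i : ℝ) ^ 2 ≤ 2 * K * A := by
  have hL := h.blockLen_ge v.2
  have h1 := sum_range_inv_sq_le (a := I.blockLen ε v - 1) (by linarith) n
  have hKL : 0 ≤ K * I.blockLen ε v := mul_nonneg (Nat.cast_nonneg _) (h.blockLen_pos v.2).le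
  have h2 := mul_le_mul_of_nonneg_left h1 (mul_nonneg hKL hA)
  rw [Finset.mul_sum] at h2
  refine le_trans (Finset.sum_le_sum fun i hi => ?_) (h2.trans ?_)
  · have hi := Finset.mem_range.mp hi
    by_cases hw : ∑ k ∈ Finset.range i, (I.blocks K h.pos.le).window v k = 0
    · rw [hw, zero_mul, zero_div]
      refine mul_nonneg (mul_nonneg hKL hA) ?_
      split_ifs <;> [positivity; exact le_rfl]
    · obtain ⟨k, hk, hne⟩ := Finset.exists_ne_zero_of_sum_ne_zero hw
      have hk := Finset.mem_range.mp hk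
      have h3 := (h.window_support (hk.trans hi) hne).1
      have h4 : (k : ℝ) < i := by exact_mod_cast hk
      rw [if_pos (h3.trans h4), mul_one_div]
      exact div_le_div_of_nonneg_right
        (mul_le_mul_of_nonneg_right (h.sum_window_le v hi.le) hA) (sq_nonneg _)
  · rw [mul_one_div, div_le_iff₀ (by linarith)]
    have : 0 ≤ (K : ℝ) * A := mul_nonneg (Nat.cast_nonneg _) hA
    nlinarith

/-! ### The initial potential -/

theorem val_mul_blockMass_le (v : {v // v ∈ I.classes ε}) :
    v.1 * I.blockMass ε v ≤ 8 * ε ^ 3 * (I.blocks K h.pos.le).contValue n Finset.univ := by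
  have h1 := h.val_mul_min_le v
  have h2 : I.cappedMass ε v ≤ 1 / ε * min 1 (I.totalMass ε v) := by
    have h3 := h.one_le_inv
    have h4 := h.totalMass_pos v.2
    unfold cappedMass
    rcases le_total 1 (I.totalMass ε v) with h5 | h5
    · rw [min_eq_left h5, mul_one]; exact min_le_left _ _
    · rw [min_eq_right h5]
      exact (min_le_right _ _).trans (le_mul_of_one_le_left h4.le h3)
  have hv := h.val_pos v.2
  calc v.1 * I.blockMass ε v = ε ^ 4 * v.1 * I.cappedMass ε v := by rw [blockMass]; ring
    _ ≤ ε ^ 4 * v.1 * (1 / ε * min 1 (I.totalMass ε v)) :=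
      mul_le_mul_of_nonneg_left h2 (mul_nonneg (pow_nonneg h.pos.le 4) hv.le)
    _ = ε ^ 3 * (v.1 * min 1 (I.totalMass ε v)) := by have := h.pos; field_simp
    _ ≤ ε ^ 3 * (8 * (I.blocks K h.pos.le).contValue n Finset.univ) :=
      mul_le_mul_of_nonneg_left h1 (pow_nonneg h.pos.le 3)
    _ = _ := by ring

theorem val_mul_tol_le (v : {v // v ∈ I.classes ε}) :
    v.1 * (I.tol ε v * I.cappedMass ε v) ≤
      8 * (ε ^ 2 * √ε) * (I.blocks K h.pos.le).contValue n Finset.univ := by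
  have h1 := h.val_mul_min_le v
  have h0 : 0 ≤ ε ^ 2 * √ε := mul_nonneg (pow_nonneg h.pos.le 2) (Real.sqrt_nonneg _)
  have h2 := mul_le_mul_of_nonneg_left (h.tol_mul_capped_le v.2) (h.val_pos v.2).le
  have h3 := mul_le_mul_of_nonneg_left h1 h0
  linarith

omit h in
theorem rate_univ (hε : 0 ≤ ε) (v : {v // v ∈ I.classes ε}) :
    (I.blocks K hε).rate v Finset.univ = (∑ j ∈ I.small ε v, I.prob j) / n := by
  rw [Blocks.rate, sampleMean, Finset.card_univ, Fintype.card_fin, ← Finset.sum_filter]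
  congr 2
  ext j
  rw [Finset.mem_filter]
  exact (and_iff_right (Finset.mem_univ j)).trans classOf_eq_some_iff

theorem discrepancy_le (v : {v // v ∈ I.classes ε}) :
    chainCost ((I.blocks K h.pos.le).window v)
      ((I.blocks K h.pos.le).classCost (I.nominalRate ε) v) n Finset.univ ≤
      (24 * (ε ^ 2 * √ε) + ε ^ 3 * Real.log (2 * K)) *
        (I.blocks K h.pos.le).contValue n Finset.univ := by
  set B := I.blocks K h.pos.le with hB
  set C := B.contValue n Finset.univ with hC
  have hC0 : 0 ≤ C := B.contValue_nonneg _ _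
  have hn := h.n_pos' v.2
  have hη := h.tol_pos v.2
  have hη1 : I.tol ε v ≤ 1 / 100 := (h.tol_le_eps v.2).trans h.le
  have hA := h.maxMass_pos v.2
  have hAeq := h.maxMass_eq v.2
  have hQo := h.blockMass_pos v.2
  have hQo1 : I.blockMass ε v ≤ 1 :=
    (h.blockMass_le).trans (pow_le_one₀ h.pos.le h.lt_one.le)
  have hQb := h.totalMass_pos v.2
  have hQs := h.cappedMass_pos v.2
  have hL := h.blockLen_ge v.2
  have hL1 := h.one_le_mul_blockLen v.2
  have hLQ := h.blockLen_mul v.2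
  have hKL := h.K_mul_blockLen_mul v.2
  have hKQ := h.K_mul_blockMass (v := v)
  have hlog := h.sum_window_div_le v
  set P := ∑ j ∈ I.small ε v.1, I.prob j with hP
  have hp0 : I.totalMass ε v * (1 - I.maxMass ε v) ≤ P := by
    rw [totalMass, Finset.sum_mul]
    refine Finset.sum_le_sum fun j hj => ?_
    have e1 := h.q_le hj
    have e2 := q_mul_one_sub_le (mem_small.mp hj).2.1 (by linarith)
    have e3 := mul_le_mul_of_nonneg_left
      (sub_le_sub_left (q_le_maxMass hj) 1) (I.q_nonneg j)
    linarith
  have hp1 : P ≤ I.totalMass ε v :=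
    Finset.sum_le_sum fun j hj => prob_le_q (mem_small.mp hj).2.1
  have hPpos : 0 < P := by
    obtain ⟨-, i, hi⟩ := mem_classes.mp v.2
    exact (I.prob_pos i).trans_le
      (Finset.single_le_sum (f := I.prob) (fun j _ => (I.prob_pos j).le) hi)
  -- The choice λ = 1/(ημ), with μ the mean rate, makes 1/(2λ) summed over the window at most ηQ*/2,
  -- while the variance term is at most KA/η = εηQ*.
  have hcost := Blocks.chainCost_window_classCost_le (B := B) h.nominalRate_nonneg v
    (A := I.maxMass ε v) (lam := 1 / (I.tol ε v * (P / n))) (μ := P / n)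
    (fun j hj => by
      have hj' := classOf_eq_some_iff.mp hj
      exact (prob_le_q (mem_small.mp hj').2.1).trans (q_le_maxMass hj')) hA.le
    (by positivity) (rate_univ h.pos.le v)
  have hW := h.sum_window_le v le_rfl
  have hS := h.sum_window_sq_le v hA.le
  refine hcost.trans ?_
  change v.1 * _ + _ ≤ _
  set η := I.tol ε v.1
  set A := I.maxMass ε v.1
  set Qo := I.blockMass ε v.1
  set Qb := I.totalMass ε v.1
  set Qs := I.cappedMass ε v.1
  set L := I.blockLen ε v.1
  set r := I.nominalRate ε v
  have hε := h.pos
  have t1 : 1 / (η * (P / n)) / 2 * ((∑ i ∈ Finset.range n,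
      (∑ k ∈ Finset.range i, B.window v k) * A / (i : ℝ) ^ 2) * (P / n)) ≤ ε * (η * Qs) := by
    have e1 : ∀ x : ℝ, 1 / (η * (P / n)) / 2 * (x * (P / n)) = x / (2 * η) := fun x => by
      field_simp
    rw [e1, div_le_iff₀ (by positivity)]
    refine hS.trans (le_of_eq ?_)
    rw [hAeq, ← hKQ]; ring
  have hKLμ : K * L * (P / n) ≤ Qs := by
    rw [← mul_div_assoc, div_le_iff₀ hn, ← hKL]
    exact mul_le_mul_of_nonneg_left hp1 (by positivity)
  have t2 : K * L * max 0 (r - P / n) ≤ 2 * (η * Qs) := by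
    have e0 : L * (P / n) ≥ Qo * (1 - A) := by
      rw [ge_iff_le, ← mul_div_assoc, le_div_iff₀ hn]
      have := mul_le_mul_of_nonneg_left hp0 (show 0 ≤ L by linarith)
      nlinarith
    have e9 : L * max 0 (r - P / n) ≤ 2 * η * Qo :=
      excess_le hε h.le hη hη1 hQo hQo1 hAeq hL hL1 e0 rfl
    calc K * L * max 0 (r - P / n) = K * (L * max 0 (r - P / n)) := by ring
      _ ≤ K * (2 * η * Qo) := mul_le_mul_of_nonneg_left e9 (Nat.cast_nonneg _)
      _ = _ := by rw [← hKQ]; ring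
  have t3 : (∑ m ∈ Finset.range n, B.window v m) *
      (max 0 (r - P / n) + 1 / (2 * (1 / (η * (P / n))))) ≤ 5 / 2 * (η * Qs) := by
    have e1 : 1 / (2 * (1 / (η * (P / n)))) = η * (P / n) / 2 := by field_simp
    rw [e1]
    have e2 := mul_le_mul_of_nonneg_right hW
      (show 0 ≤ max 0 (r - P / n) + η * (P / n) / 2 by positivity)
    have e3 := mul_le_mul_of_nonneg_left hKLμ hη.le
    nlinarith
  have t4 : v.1 * (1 / (η * (P / n)) / 2 * ((∑ i ∈ Finset.range n,
      (∑ k ∈ Finset.range i, B.window v k) * A / (i : ℝ) ^ 2) * (P / n)) +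
      (∑ m ∈ Finset.range n, B.window v m) *
        (max 0 (r - P / n) + 1 / (2 * (1 / (η * (P / n)))))) ≤ v.1 * (3 * (η * Qs)) := by
    refine mul_le_mul_of_nonneg_left ?_ (h.val_pos v.2).le
    have : ε * (η * Qs) ≤ 1 / 2 * (η * Qs) :=
      mul_le_mul_of_nonneg_right (by linarith [h.le]) (by positivity)
    linarith
  have t5 := h.val_mul_tol_le v
  have t6 : r * ((∑ m ∈ Finset.range n, B.window v m * (1 / m)) * C) ≤
      ε ^ 3 * (Real.log (2 * K) * C) := by
    refine mul_le_mul (h.nominalRate_le v) (mul_le_mul_of_nonneg_right hlog hC0) ?_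
      (pow_nonneg hε.le 3)
    exact mul_nonneg (Finset.sum_nonneg fun m _ =>
      mul_nonneg (Blocks.window_nonneg _ _) (by positivity)) hC0
  refine (add_le_add t4 t6).trans ?_
  rw [← hB, ← hC] at t5
  change v.1 * (η * Qs) ≤ _ at t5
  linarith

/-- Per class: 16ε³C for the final block, 16ε³C for `D`, 2ε³(2 + log 2K)C for holding options, and
the discrepancy. -/
theorem startValue_le : (I.blocks K h.pos.le).startValue (I.nominalMass ε) (I.nominalRate ε)
    (∑ v, I.nominalRate ε v * I.nominalLen ε v * v.1) ≤
    (1 + I.posValues.card * (33 * ε ^ 3 + 4 * ε ^ 3 * (2 + Real.log (2 * K)) +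
      24 * (ε ^ 2 * √ε))) * (I.blocks K h.pos.le).contValue n Finset.univ := by
  set B := I.blocks K h.pos.le with hB
  set C := B.contValue n Finset.univ with hC
  have hC0 : 0 ≤ C := B.contValue_nonneg _ _
  have hK1 : (1 : ℝ) ≤ K := by exact_mod_cast h.K_pos
  have hlog0 : 0 ≤ Real.log (2 * K) := Real.log_nonneg (by linarith)
  have hε3 := pow_nonneg h.pos.le 3
  have hρ := Blocks.optionProb_nonneg h.nominalMass_nonneg
  have h1 : ∑ i ∈ Blocks.final (K := K), Blocks.optionProb (I.nominalMass ε) i.1 * B.val i.1 ≤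
      ∑ v : {v // v ∈ I.classes ε}, 16 * ε ^ 3 * C := by
    refine (Blocks.sum_final_le (K := K) (f := fun v =>
      Blocks.optionProb (I.nominalMass ε) v * B.val v)
      fun v => mul_nonneg (hρ v) (B.val_pos v).le).trans (Finset.sum_le_sum fun v _ => ?_)
    have e1 := h.val_mul_blockMass_le v
    have e2 : Blocks.optionProb (I.nominalMass ε) v * B.val v ≤ 2 * I.blockMass ε v * v.1 :=
      mul_le_mul_of_nonneg_right (by
        linarith [h.optionProb_le v, h.nominalMass_le v, h.blockMass_pos v.2]) (h.val_pos v.2).le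
    rw [← hB, ← hC] at e1
    linarith
  have h2 : ∑ v, I.nominalRate ε v * I.nominalLen ε v * v.1 ≤
      ∑ v : {v // v ∈ I.classes ε}, 16 * ε ^ 3 * C := by
    refine Finset.sum_le_sum fun v _ => ?_
    have e1 := h.val_mul_blockMass_le v
    have e2 := mul_le_mul_of_nonneg_right (h.nominalRate_mul_len_le v) (h.val_pos v.2).le
    rw [← hB, ← hC] at e1
    linarith
  have h3 : ∑ i ∈ Blocks.regular (K := K), Blocks.optionProb (I.nominalMass ε) i.1 *
      chainCost (B.blockIndicator i) B.holdCost n Finset.univ ≤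
      ∑ v : {v // v ∈ I.classes ε}, 2 * ε ^ 3 * ((2 + Real.log (2 * K)) * C) := by
    refine (Blocks.sum_regular_le (B := B) hρ).trans (Finset.sum_le_sum fun v _ => ?_)
    refine mul_le_mul ?_ ?_ (chainCost_nonneg (Blocks.window_nonneg v) Blocks.holdCost_nonneg _ _)
      (by linarith)
    · have := h.blockMass_le (v := v)
      linarith [h.optionProb_le v, h.nominalMass_le v]
    · refine (Blocks.chainCost_window_holdCost_le v).trans (mul_le_mul_of_nonneg_right ?_ hC0)
      linarith [h.sum_window_div_le v]
  have h4 : chainCost 1 (B.rateCost (I.nominalRate ε)) n Finset.univ ≤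
      ∑ v : {v // v ∈ I.classes ε}, (24 * (ε ^ 2 * √ε) + ε ^ 3 * Real.log (2 * K)) * C := by
    rw [Blocks.chainCost_rateCost]
    exact Finset.sum_le_sum fun v _ => h.discrepancy_le v
  have h5 : (Fintype.card {v // v ∈ I.classes ε} : ℝ) ≤ I.posValues.card := by
    exact_mod_cast card_classes_le
  rw [Finset.sum_const, Finset.card_univ, nsmul_eq_mul] at h1 h2 h3 h4
  rw [Blocks.startValue, ← hC]
  have h6 : 0 ≤ (33 * ε ^ 3 + 4 * ε ^ 3 * (2 + Real.log (2 * K)) + 24 * (ε ^ 2 * √ε)) * C := by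
    have := Real.sqrt_nonneg ε
    have := h.pos
    positivity
  have h7 := mul_le_mul_of_nonneg_right h5 h6
  have h8 : 0 ≤ (Fintype.card {v // v ∈ I.classes ε} : ℝ) *
      ((ε ^ 3 * 5 + ε ^ 3 * Real.log (2 * K)) * C) := by positivity
  linarith

end Regime

end Instance

end ProphetSecretary

/-! ### Choice of ε₀ and conclusion -/

namespace ProphetSecretary

theorem exists_threshold : ∃ ε₀ : ℝ, 0 < ε₀ ∧ ∀ ε : ℝ, 0 < ε → ε < ε₀ → ε ≤ 1 / 100 ∧
    √ε * Real.log ε ^ 2 ≤ 1 / 100000 ∧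
    1800 * (1 / ε) ^ 8 * Real.exp (-(1 / (32 * ε))) ≤ 1 / 100 := by
  have h1 : ∀ᶠ ε : ℝ in nhdsWithin 0 (Set.Ioi 0), ε ≤ 1 / 100 :=
    nhdsWithin_le_nhds (Iic_mem_nhds (by norm_num))
  have h2 : ∀ᶠ ε : ℝ in nhdsWithin 0 (Set.Ioi 0),
      (Real.log ε * ε ^ (1 / 4 : ℝ)) ^ 2 ≤ 1 / 100000 := by
    have := (tendsto_log_mul_rpow_nhdsGT_zero (r := 1 / 4) (by norm_num)).pow 2
    rw [zero_pow two_ne_zero] at this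
    exact this.eventually (Iic_mem_nhds (by norm_num))
  have h3 : ∀ᶠ ε : ℝ in nhdsWithin 0 (Set.Ioi 0),
      1800 * 32 ^ 8 * ((ε⁻¹ / 32) ^ 8 * Real.exp (-(ε⁻¹ / 32))) ≤ 1 / 100 := by
    have e1 : Filter.Tendsto (fun ε : ℝ => ε⁻¹ / 32) (nhdsWithin 0 (Set.Ioi 0)) Filter.atTop :=
      tendsto_inv_nhdsGT_zero.atTop_div_const (by norm_num)
    have e2 := ((Real.tendsto_pow_mul_exp_neg_atTop_nhds_zero 8).comp e1).const_mul
      ((1800 : ℝ) * 32 ^ 8)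
    rw [mul_zero] at e2
    exact e2.eventually (Iic_mem_nhds (by norm_num))
  obtain ⟨ε₀, h0, hs⟩ := mem_nhdsGT_iff_exists_Ioo_subset.mp (h1.and (h2.and h3))
  refine ⟨ε₀, h0, fun ε hε hε₀ => ?_⟩
  obtain ⟨e1, e2, e3⟩ := hs ⟨hε, hε₀⟩
  refine ⟨e1, ?_, ?_⟩
  · have : (ε ^ (1 / 4 : ℝ)) ^ 2 = √ε := by
      rw [← Real.rpow_natCast, ← Real.rpow_mul hε.le, Real.sqrt_eq_rpow]
      norm_num
    rw [mul_pow, this, mul_comm] at e2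
    exact e2
  · refine le_trans (le_of_eq ?_) e3
    have : -(ε⁻¹ / 32) = -(1 / (32 * ε)) := by field_simp
    rw [this, div_pow, one_div, ← mul_assoc]
    ring

namespace Instance

variable {n : ℕ} {I : Instance n} {ε : ℝ} {K : ℕ}

namespace Regime

variable (h : I.Regime ε K)

include h

theorem one_le_neg_log : 1 ≤ -Real.log ε := by
  have h1 := Real.log_le_log h.pos h.le
  have h2 : Real.log (1 / 100) ≤ -1 := by
    rw [Real.log_le_iff_le_exp (by norm_num), Real.exp_neg]
    rw [le_inv_comm₀ (by norm_num) (Real.exp_pos _)]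
    linarith [Real.exp_one_lt_d9]
  linarith

/-- Exponents m with (1+ε)^m between ε and 1/ε² satisfy |m|·log(1+ε) ≤ 2 log(1/ε), and log(1+ε) ≥
ε/2. The large value adds one more. -/
theorem card_posValues_le : (I.posValues.card : ℝ) ≤ 10 * -Real.log ε / ε := by
  obtain ⟨vmax, -, hvals⟩ := h.normalized.values
  have hε := h.pos
  have hl := h.one_le_neg_log
  have hlog : ε / 2 ≤ Real.log (1 + ε) := by
    have h1 := Real.log_le_sub_one_of_pos (x := 1 / (1 + ε)) (by positivity)
    rw [one_div, Real.log_inv] at h1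
    have h2 : 1 - (1 + ε)⁻¹ = ε / (1 + ε) := by field_simp; ring
    have h3 : ε / 2 ≤ ε / (1 + ε) :=
      div_le_div_of_nonneg_left hε.le (by linarith) (by linarith [h.lt_one])
    linarith
  have hlog0 : 0 < Real.log (1 + ε) := by linarith
  set M := ⌊2 * -Real.log ε / Real.log (1 + ε)⌋₊ with hM
  have hsub : I.posValues ⊆ insert vmax
      ((Finset.Icc (-(M : ℤ)) M).image fun m : ℤ => (1 + ε) ^ m) := by
    intro u hu
    obtain ⟨⟨i, hi⟩, hu0⟩ := mem_posValues.mp hu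
    rw [Finset.mem_insert, Finset.mem_image]
    rcases hvals i with h0 | ⟨h1, h2, m, hm⟩ | h3
    · exact absurd (hi ▸ h0) hu0.ne'
    · right
      rw [hi] at h1 h2 hm
      refine ⟨m, ?_, hm.symm⟩
      have e0 : Real.log u = m * Real.log (1 + ε) := by rw [hm, Real.log_zpow]
      have e1 := Real.log_le_log hε h1
      have e2 := Real.log_le_log hu0 h2
      rw [one_div, Real.log_inv, Real.log_pow] at e2
      push_cast at e2
      have e3 : |(m : ℝ)| ≤ 2 * -Real.log ε / Real.log (1 + ε) := by
        rw [le_div_iff₀ hlog0, ← abs_of_pos hlog0, ← abs_mul, ← e0]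
        exact abs_le.mpr ⟨by linarith, by linarith⟩
      have e4 : (m.natAbs : ℝ) ≤ 2 * -Real.log ε / Real.log (1 + ε) := by
        rwa [Nat.cast_natAbs, Int.cast_abs]
      have e5 : m.natAbs ≤ M := Nat.le_floor e4
      rw [Finset.mem_Icc]
      omega
    · exact Or.inl (hi ▸ h3)
  have hcard : I.posValues.card ≤ 2 * M + 1 + 1 := by
    refine (Finset.card_le_card hsub).trans ((Finset.card_insert_le _ _).trans ?_)
    refine Nat.succ_le_succ (Finset.card_image_le.trans ?_)
    rw [Int.card_Icc]
    omega
  have hMle : (M : ℝ) ≤ 4 * -Real.log ε / ε := by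
    refine (Nat.floor_le (by positivity)).trans ?_
    rw [div_le_div_iff₀ hlog0 hε]
    nlinarith
  have h3 : (I.posValues.card : ℝ) ≤ 2 * M + 2 := by
    have : (I.posValues.card : ℝ) ≤ ((2 * M + 1 + 1 : ℕ) : ℝ) := by exact_mod_cast hcard
    push_cast at this
    linarith
  have h4 : 1 ≤ -Real.log ε / ε := by
    rw [le_div_iff₀ hε]; linarith [h.lt_one]
  rw [mul_div_assoc] at hMle ⊢
  linarith

theorem log_two_mul_K_le : 2 + Real.log (2 * K) ≤ 7 * -Real.log ε := by
  have hl := h.one_le_neg_log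
  have hK : (K : ℝ) = (ε ^ 4)⁻¹ := eq_inv_of_mul_eq_one_left h.blocks
  rw [hK, Real.log_mul (by norm_num) (inv_ne_zero (pow_pos h.pos 4).ne'), Real.log_inv,
    Real.log_pow]
  push_cast
  linarith [Real.log_two_lt_d9]

/-- Frontloading gains at most a factor `1 + ε`. -/
theorem opt_gameFour_le (h1 : √ε * Real.log ε ^ 2 ≤ 1 / 100000)
    (h2 : 1800 * (1 / ε) ^ 8 * Real.exp (-(1 / (32 * ε))) ≤ 1 / 100) :
    I.opt (I.gameFour ε K) ≤ (1 + ε) * I.opt (I.gameThree ε K) := by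
  have hε := h.pos
  have hε1 := h.le
  have hl := h.one_le_neg_log
  have hN := h.card_posValues_le
  have hlg := h.log_two_mul_K_le
  have hs := Real.sqrt_nonneg ε
  have hsε : √ε * √ε = ε := Real.mul_self_sqrt hε.le
  set C := (I.blocks K hε.le).contValue n Finset.univ with hC
  have hC0 : 0 ≤ C := (I.blocks K hε.le).contValue_nonneg _ _
  set N : ℝ := (I.posValues.card : ℝ) with hNdef
  have hN0 : 0 ≤ N := Nat.cast_nonneg _
  set l := -Real.log ε with hldef
  have hlsq : Real.log ε ^ 2 = l ^ 2 := by rw [hldef]; ring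
  rw [hlsq] at h1
  have hl2 : l ≤ l ^ 2 := by nlinarith
  have hs1 : √ε ≤ 1 := Real.sqrt_le_one.mpr h.lt_one.le
  have hεs : ε ≤ √ε := by nlinarith
  have hNε : N * ε ≤ 10 * l := by rwa [le_div_iff₀ hε] at hN
  have hsl : √ε * l ≤ √ε * l ^ 2 := mul_le_mul_of_nonneg_left hl2 hs
  have hεl : ε * l ^ 2 ≤ √ε * l ^ 2 := mul_le_mul_of_nonneg_right hεs (sq_nonneg l)
  have hεl1 : ε * l ≤ ε * l ^ 2 := mul_le_mul_of_nonneg_left hl2 hε.le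
  have hx : N * (33 * ε ^ 3 + 4 * ε ^ 3 * (2 + Real.log (2 * K)) + 24 * (ε ^ 2 * √ε)) ≤
      ε / 100 := by
    have e1 : 33 * ε ^ 3 + 4 * ε ^ 3 * (2 + Real.log (2 * K)) + 24 * (ε ^ 2 * √ε) ≤
        33 * ε ^ 3 + 4 * ε ^ 3 * (7 * l) + 24 * (ε ^ 2 * √ε) := by gcongr
    refine (mul_le_mul_of_nonneg_left e1 hN0).trans ?_
    have e2 := mul_le_mul_of_nonneg_right hNε
      (show 0 ≤ ε * (33 * ε + 28 * ε * l + 24 * √ε) by positivity)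
    calc N * (33 * ε ^ 3 + 4 * ε ^ 3 * (7 * l) + 24 * (ε ^ 2 * √ε))
        = N * ε * (ε * (33 * ε + 28 * ε * l + 24 * √ε)) := by ring
      _ ≤ 10 * l * (ε * (33 * ε + 28 * ε * l + 24 * √ε)) := e2
      _ = ε * (330 * (ε * l) + 280 * (ε * l ^ 2) + 240 * (√ε * l)) := by ring
      _ ≤ ε * (1 / 100) := mul_le_mul_of_nonneg_left (by linarith) hε.le
      _ = ε / 100 := by ring
  have hκ : N * (2 * (ε ^ 2 * √ε)) ≤ ε / 100 := by
    have e2 := mul_le_mul_of_nonneg_right hNε (show 0 ≤ 2 * (ε * √ε) by positivity)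
    calc N * (2 * (ε ^ 2 * √ε)) = N * ε * (2 * (ε * √ε)) := by ring
      _ ≤ 10 * l * (2 * (ε * √ε)) := e2
      _ = ε * (20 * (√ε * l)) := by ring
      _ ≤ ε * (1 / 100) := mul_le_mul_of_nonneg_left (by linarith) hε.le
      _ = ε / 100 := by ring
  have hp : orderProb (I.Atypical ε K hε.le) * I.meanPeak ≤ ε / 100 * C := by
    have e1 := h.orderProb_atypical_le
    have e2 := h.meanPeak_le
    rw [← hNdef] at e1 e2
    rw [← hC] at e2
    have e3 : orderProb (I.Atypical ε K hε.le) * I.meanPeak ≤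
        N * K * (2 * Real.exp (-(1 / (32 * ε)))) * (9 * N * C) :=
      mul_le_mul e1 e2 (Finset.sum_nonneg fun b _ =>
        mul_nonneg (I.bitWeight_prob_nonneg b) (peak_nonneg b)) (by positivity)
    refine e3.trans ?_
    have hK : (K : ℝ) = (1 / ε) ^ 4 := by
      rw [one_div, inv_pow]; exact eq_inv_of_mul_eq_one_left h.blocks
    -- From Nε ≤ 10·log(1/ε) and ε·log²ε ≤ 1. One factor ε is kept apart, so that the exponential
    -- need only beat (1/ε)⁸.
    have hNsq : N ^ 2 ≤ 100 * ε * (1 / ε) ^ 4 := by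
      have e4 : (N * ε) ^ 2 ≤ (10 * l) ^ 2 := pow_le_pow_left₀ (by positivity) hNε 2
      have e5 : ε * l ^ 2 ≤ 1 := by linarith
      have e6 : N ^ 2 * ε ^ 3 ≤ 100 := by nlinarith
      have e7 : 100 * ε * (1 / ε) ^ 4 = 100 / ε ^ 3 := by field_simp
      rw [e7, le_div_iff₀ (by positivity)]
      exact e6
    calc N * K * (2 * Real.exp (-(1 / (32 * ε)))) * (9 * N * C)
        = 18 * N ^ 2 * ((1 / ε) ^ 4 * Real.exp (-(1 / (32 * ε))) * C) := by rw [hK]; ring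
      _ ≤ 18 * (100 * ε * (1 / ε) ^ 4) * ((1 / ε) ^ 4 * Real.exp (-(1 / (32 * ε))) * C) := by
        gcongr
      _ = ε * C * (1800 * (1 / ε) ^ 8 * Real.exp (-(1 / (32 * ε)))) := by ring
      _ ≤ ε * C * (1 / 100) := mul_le_mul_of_nonneg_left h2 (by positivity)
      _ = _ := by ring
  have h3 := le_opt_gameThree (I := I) hε.le (fun σ => h.atypical_of_fails)
  have h4 := Instance.opt_gameFour_le hε.le h.nominal (fun σ => h.withinMass_of_not_atypical)
    (fun σ => h.sum_sub_mass_le)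
  have h5 := h.startValue_le
  rw [← hC, ← hNdef] at h5
  rw [← hC] at h3
  rw [← hNdef] at h4
  have h6 : Real.exp (N * (2 * (ε ^ 2 * √ε))) ≤ 1 + ε / 50 := by
    refine (Real.exp_le_exp.mpr hκ).trans ?_
    have := exp_le_one_add_add_sq (x := ε / 100) (by
      rw [abs_of_nonneg (by positivity)]; linarith)
    nlinarith
  have h7 : (I.blocks K hε.le).startValue (I.nominalMass ε) (I.nominalRate ε)
      (∑ v, I.nominalRate ε v * I.nominalLen ε v * v.1) ≤ (1 + ε / 100) * C :=
    h5.trans (mul_le_mul_of_nonneg_right (by linarith) hC0)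
  have h8 : Real.exp (N * (2 * (ε ^ 2 * √ε))) *
      (I.blocks K hε.le).startValue (I.nominalMass ε) (I.nominalRate ε)
        (∑ v, I.nominalRate ε v * I.nominalLen ε v * v.1) ≤ (1 + ε / 50) * ((1 + ε / 100) * C) :=
    (mul_le_mul_of_nonneg_left h7 (Real.exp_pos _).le).trans
      (mul_le_mul_of_nonneg_right h6 (by positivity))
  have h9 : (1 - ε / 100) * C ≤ I.opt (I.gameThree ε K) := by linarith
  have h10 := mul_le_mul_of_nonneg_left h9 (show 0 ≤ 1 + ε by linarith)
  -- The factors are the change of measure and the start of the potential; the terms ε/100 are the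
  -- atypical orders, once in each game.
  have h11 : (1 + ε / 50) * (1 + ε / 100) + ε / 100 ≤ (1 + ε) * (1 - ε / 100) := by nlinarith
  have h12 := mul_le_mul_of_nonneg_right h11 hC0
  linarith

end Regime

end Instance

end ProphetSecretary

theorem mainTheorem6 :
    ∃ ε₀ : ℝ, 0 < ε₀ ∧ ∀ (ε : ℝ) (K : ℕ), 0 < ε → ε < ε₀ → (K : ℝ) * ε ^ 4 = 1 →
      ∀ (n : ℕ) (I : ProphetSecretary.Instance n), I.IsNormalized ε →
        I.opt (I.gameThree ε K) ≤ I.opt (I.gameFour ε K) ∧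
        I.opt (I.gameFour ε K) ≤ (1 + ε) * I.opt (I.gameThree ε K) := by
  obtain ⟨ε₀, h0, h⟩ := ProphetSecretary.exists_threshold
  refine ⟨ε₀, h0, fun ε K hε hε₀ hK n I hI => ?_⟩
  obtain ⟨h1, h2, h3⟩ := h ε hε hε₀
  have hR : I.Regime ε K := ⟨hε, h1, hK, hI⟩
  exact ⟨ProphetSecretary.Instance.opt_gameThree_le, hR.opt_gameFour_le h2 h3⟩
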